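/- Let $M,N\ge 0$ be integers; all spaces are over $\mathbb C$ and $\delta$ is Kronecker's delta. **Lattice, cocycle.** Let $\Gamma=\bigoplus_{i=1}^M\mathbb Z e_i$ with $(e_i,e_j)=\delta_{ij}$, $\alpha_{ij}=e_i-e_j$, and let $F:\Gamma\times\Gamma\to\{\pm1\}$ be the bimultiplicative map with $F(e_i,e_j)=1$ for $i\le j$ and $F(e_i,e_j)=-1$ for $i>j$. **The superalgebra.** Let $T$ have basis $T_{ij}$ ($1\le i,j\le M+N$), where $T_{ij}$ is even if $i,j$ are both $\le M$ or both $>M$, and odd otherwise. Its superbracket is given as follows; each line also determines the bracket in the opposite order by super-skew-symmetry. Below $i,j,k,l$ run over $1,\dots,M$ when unshifted and over $1,\dots,N$ when shifted by $M$. * For $i\ne j$, $k\neq l$: $[T_{ij},T_{kl}]$ is $0$ if $(\alpha_{ij},\alpha_{kl})\ge0$; $F(\alpha_{ij},\alpha_{kl})T_{il}$ if $j=k$, $l\ne i$; $F(\alpha_{ij},\alpha_{kl})T_{kj}$ if $l=i$, $j\neq k$; $F(\alpha_{ij},\alpha_{kl})(T_{ii}-T_{jj})$ if $l=i$, $j=k$.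 For $k\ne l$: $[T_{ii},T_{kl}]=(e_i,\alpha_{kl})T_{kl}$. Also $[T_{ii},T_{kk}]=0$. * $[T_{i+M,j+M},T_{k+M,l+M}]=\delta_{jk}T_{i+M,l+M}-\delta_{il}T_{k+M,j+M}$. * $[T_{ij},T_{k+M,l}]=\delta_{il}F(e_j,e_i)T_{k+M,j}$ for $i\ne j$, and $[T_{ii},T_{k+M,l}]=-\delta_{il}T_{k+M,l}$; $[T_{ij},T_{k,l+M}]=\delta_{jk}F(e_i,e_j)T_{i,l+M}$. * $[T_{i+M,j+M},T_{k+M,l}]=\delta_{jk}T_{i+M,l}$; $[T_{i+M,j+M},T_{k,l+M}]=-\delta_{il}T_{k,j+M}$. * $[T_{i+M,j},T_{k,l+M}]=\delta_{jk}T_{i+M,l+M}+F(e_k,e_j)\delta_{il}T_{kj}$; all other brackets of basis vectors are $0$. The form $(\cdot,\cdot)_T$ is $(T_{ij},T_{kl})_T=F(\alpha_{ij},\alpha_{kl})\delta_{jk}\delta_{il}$, $(T_{i+M,j},T_{k,l+M})_T=-\delta_{jk}\delta_{il}$, $(T_{k,l+M},T_{i+M,j})_T=\delta_{jk}\delta_{il}$,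 $(T_{i+M,j+M},T_{k+M,l+M})_T=-\delta_{jk}\delta_{il}$, and $0$ on all other pairs of basis vectors. Let $\widehat T=T\otimes\mathbb C[t,t^{-1}]\oplus\mathbb CK$ with $K$ even and central and, for $X(m)=X\otimes t^m$, $$[X(m),Y(n)]=[X,Y](m+n)+m\,\delta_{m+n,0}\,(X,Y)_T\,K .$$ Let $\widehat{gl}(M|N)$ be built in the same way from $gl(M|N)$ (with the supercommutator) and the supertrace form $\mathrm{str}(XY)$. **Vertex operators.** Let $\mathfrak h=\mathbb C\otimes_{\mathbb Z}\Gamma$, let $S$ be the symmetric algebra of $\mathfrak h_-=\bigoplus_{k<0}\mathfrak h(k)$, where each $\mathfrak h(k)=\{\alpha(k)\}$ is a copy of $\mathfrak h$, and $V[\Gamma]=\mathbb C[\Gamma]\otimes S$ with basis $e^\gamma$ ($\gamma\in\Gamma$) of the first factor. For $m>0$, $\alpha(-m)$ acts on $S$ by multiplication, and $\alpha(m)$ by the derivation with $\beta(-n)\mapsto\delta_{mn}m(\alpha,\beta)$; $\alpha(0)(e^\gamma\otimes u)=(\alpha,\gamma)e^\gamma\otimes u$. Let $e^\alpha(e^\gamma\otimes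 u)=F(\alpha,\gamma)e^{\alpha+\gamma}\otimes u$, $z^{\alpha(0)}(e^\gamma\otimes u)=z^{(\alpha,\gamma)}e^\gamma\otimes u$, and $$Y(\alpha,z)=e^\alpha z^{\alpha(0)}\exp\Big(-\sum_{n<0}\tfrac1n\alpha(n)z^{-n}\Big)\exp\Big(-\sum_{n>0}\tfrac1n\alpha(n)z^{-n}\Big).$$ For $(\alpha,\alpha)$ even put $z^{(\alpha,\alpha)/2}Y(\alpha,z)=\sum_{n\in\mathbb Z}X_n(\alpha)z^{-n}$; for $(\alpha,\alpha)$ odd put $Y(\alpha,z)=\sum_{n\in\mathbb Z}X_{n-1/2}(\alpha)z^{-n}$. Normal ordering is $:\!X_a(e_i)X_b(-e_i)\!:\;=X_a(e_i)X_b(-e_i)$ if $a\le b$ and $-X_b(-e_i)X_a(e_i)$ if $a>b$. **Bosons.** Let $\mathfrak F$ be the bosonic Fock space, with operators $\varphi^i_{r-1/2},\varphi^{i*}_{r-1/2}$ ($1\le i\le N$, $r\in\mathbb Z$) that commute except for $$[\varphi^i_{r-1/2},\varphi^{j*}_{s-1/2}]=-\delta_{r+s,1}\delta_{ij},$$ the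 operators with $r>0$ killing the vacuum and those with $r\le0$ acting freely and generating $\mathfrak F$ from the vacuum. Normal ordering is $:\!\varphi^i_a\varphi^{j*}_b\!:\;=\varphi^i_a\varphi^{j*}_b$ if $a\le b$ and $\varphi^{j*}_b\varphi^i_a$ if $a>b$. Grade $V[\Gamma]\otimes\mathfrak F$ by $\mathbb Z_2$, giving $e^\gamma\otimes u\otimes v$ the parity of $(\gamma,\gamma)$; the $X$'s act on the first factor and the $\varphi$'s on the second. **Proposition 3.3.** $\widehat T$ is a Lie superalgebra, and it is isomorphic to $\widehat{gl}(M|N)$ by an isomorphism taking $K$ to $K$. All the infinite sums of operators above and below have only finitely many non-zero terms on each vector; for $1\le i\le M$ and $m\in\mathbb Z$, $e_i(m)=\sum_{r\in\mathbb Z}:\!X_{r-1/2}(e_i)X_{m-r+1/2}(-e_i)\!:$. The linear map determined, for $m\in\mathbb Z$, by * $T_{ii}(m)\mapsto e_i(m)$ for $1\le i\le M$; * $T_{ij}(m)\mapsto X_m(e_i-e_j)$ for $1\le i\ne j\le M$; * $T_{i,j+M}(m)\mapsto\sum_{r\in\mathbb Z}X_{r-1/2}(e_i)\,\varphi^{j*}_{m-r+1/2}$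 for $1\le i\le M$, $1\le j\le N$; * $T_{j+M,i}(m)\mapsto\sum_{r\in\mathbb Z}X_{r-1/2}(-e_i)\,\varphi^{j}_{m-r+1/2}$ for $1\le i\le M$, $1\le j\le N$; * $T_{i+M,j+M}(m)\mapsto\sum_{r\in\mathbb Z}:\!\varphi^i_{r-1/2}\,\varphi^{j*}_{m-r+1/2}\!:$ for $1\le i,j\le N$; * $K\mapsto\mathrm{Id}$ is a representation of the Lie superalgebra $\widehat T\cong\widehat{gl}(M|N)$ on the $\mathbb Z_2$-graded space $V[\Gamma]\otimes\mathfrak F$: it is even and takes the superbracket to the supercommutator. -/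

import Mathlib

open scoped TensorProduct

noncomputable section

namespace AffineGlSuper

/-! ### Lie superalgebras and their representations -/

/-- The Koszul sign `(-1)^{ij}`. -/
def koszul (i j : ZMod 2) : ℂ := (-1) ^ (i.val * j.val)

/-- `L = L₀ ⊕ L₁` with the bilinear operation `br` is a complex Lie superalgebra. -/
structure IsLieSuperalgebra {L : Type} [AddCommGroup L] [Module ℂ L]
    (gr : ZMod 2 → Submodule ℂ L) (br : L →ₗ[ℂ] L →ₗ[ℂ] L) : Prop where
  isInternal : DirectSum.IsInternal gr
  bracket_mem : ∀ i j, ∀ x ∈ gr i, ∀ y ∈ gr j, br x y ∈ gr (i + j)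
  skew : ∀ i j, ∀ x ∈ gr i, ∀ y ∈ gr j, br x y = -(koszul i j • br y x)
  jacobi : ∀ i j, ∀ x ∈ gr i, ∀ y ∈ gr j, ∀ z,
    br (br x y) z = br x (br y z) - koszul i j • br y (br x z)

/-- A linear bijection that is an isomorphism of superalgebras (even, and compatible with the
brackets). -/
structure IsSuperIso {L L' : Type} [AddCommGroup L] [Module ℂ L] [AddCommGroup L'] [Module ℂ L']
    (gr : ZMod 2 → Submodule ℂ L) (br : L →ₗ[ℂ] L →ₗ[ℂ] L)
    (gr' : ZMod 2 → Submodule ℂ L') (br' : L' →ₗ[ℂ] L' →ₗ[ℂ] L') (Φ : L ≃ₗ[ℂ] L') : Prop where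
  map_grading : ∀ i, (gr i).map Φ.toLinearMap = gr' i
  map_bracket : ∀ x y, Φ (br x y) = br' (Φ x) (Φ y)

/-- `ρ` is a representation of the superalgebra `L` on the superspace `W = W₀ ⊕ W₁`: it is even,
and it carries the bracket to the supercommutator. -/
structure IsSuperRepresentation {L W : Type} [AddCommGroup L] [Module ℂ L]
    [AddCommGroup W] [Module ℂ W]
    (gr : ZMod 2 → Submodule ℂ L) (br : L →ₗ[ℂ] L →ₗ[ℂ] L)
    (grW : ZMod 2 → Submodule ℂ W) (ρ : L →ₗ[ℂ] Module.End ℂ W) : Prop where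
  isInternal : DirectSum.IsInternal grW
  apply_mem : ∀ i j, ∀ x ∈ gr i, ∀ w ∈ grW j, ρ x w ∈ grW (i + j)
  map_bracket : ∀ i j, ∀ x ∈ gr i, ∀ y ∈ gr j,
    ρ (br x y) = ρ x * ρ y - koszul i j • (ρ y * ρ x)

/-! ### Affinization -/

section Affinization

variable {g : Type} [AddCommGroup g] [Module ℂ g]

/-- `g ⊗ ℂ[t, t⁻¹] ⊕ ℂ K`. An element of `g ⊗ ℂ[t, t⁻¹]` is the finitely supported family of its
coefficients. -/
abbrev Affine (g : Type) [AddCommGroup g] [Module ℂ g] : Type := (ℤ →₀ g) × ℂ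

/-- `X(m) = X ⊗ t^m`. -/
def Affine.mode (X : g) (m : ℤ) : Affine g := (Finsupp.single m X, 0)

/-- The central element `K`. -/
def Affine.K : Affine g := (0, 1)

/-- The even part is `g₀ ⊗ ℂ[t, t⁻¹] ⊕ ℂ K`, the odd part is `g₁ ⊗ ℂ[t, t⁻¹]`. -/
def affGrading (gr : ZMod 2 → Submodule ℂ g) (i : ZMod 2) : Submodule ℂ (Affine g) :=
  (⨅ m : ℤ, (gr i).comap (Finsupp.lapply m)).prod (if i = 0 then ⊤ else ⊥)

/-- `[X(m), Y(n)] = [X, Y](m + n) + (X, Y) m δ_{m+n,0} K`, with `K` central. -/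
def affBracket (br : g →ₗ[ℂ] g →ₗ[ℂ] g) (B : g →ₗ[ℂ] g →ₗ[ℂ] ℂ) :
    Affine g →ₗ[ℂ] Affine g →ₗ[ℂ] Affine g :=
  LinearMap.compl₁₂
    (Finsupp.lsum ℂ fun m : ℤ => LinearMap.flip (Finsupp.lsum ℂ fun n : ℤ => LinearMap.flip
      (br.compr₂ (LinearMap.inl ℂ (ℤ →₀ g) ℂ ∘ₗ Finsupp.lsingle (m + n)) +
        (if m + n = 0 then (m : ℂ) else 0) • B.compr₂ (LinearMap.inr ℂ (ℤ →₀ g) ℂ))))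
    (LinearMap.fst ℂ (ℤ →₀ g) ℂ) (LinearMap.fst ℂ (ℤ →₀ g) ℂ)

theorem affBracket_mode (br : g →ₗ[ℂ] g →ₗ[ℂ] g) (B : g →ₗ[ℂ] g →ₗ[ℂ] ℂ) (X Y : g) (m n : ℤ) :
    affBracket br B (Affine.mode X m) (Affine.mode Y n) =
      Affine.mode (br X Y) (m + n) + ((if m + n = 0 then (m : ℂ) else 0) * B X Y) • Affine.K := by
  by_cases h : m + n = 0 <;> simp [affBracket, Affine.mode, Affine.K, h]

theorem affBracket_K (br : g →ₗ[ℂ] g →ₗ[ℂ] g) (B : g →ₗ[ℂ] g →ₗ[ℂ] ℂ) (x : Affine g) :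
    affBracket br B Affine.K x = 0 ∧ affBracket br B x Affine.K = 0 := by
  constructor <;> simp [affBracket, Affine.K]

end Affinization

/-! ### The general linear superalgebra -/

/-- Indices `1, …, M` (left) and `M + 1, …, M + N` (right). -/
abbrev Idx (M N : ℕ) : Type := Fin M ⊕ Fin N

/-- The parity of an index. -/
def par {M N : ℕ} : Idx M N → ZMod 2 := Sum.elim (fun _ => 0) (fun _ => 1)

/-- `gl(M|N)` as a space of matrices. -/
abbrev Gl (M N : ℕ) : Type := Matrix (Idx M N) (Idx M N) ℂ

/-- The component of parity `i` of a matrix. -/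
def glPart (M N : ℕ) (i : ZMod 2) : Gl M N →ₗ[ℂ] Gl M N where
  toFun f := Matrix.of fun a b => if par a + par b = i then f a b else 0
  map_add' f g := by ext a b; by_cases h : par a + par b = i <;> simp [h]
  map_smul' c f := by ext a b; by_cases h : par a + par b = i <;> simp [h]

/-- The matrices homogeneous of parity `i`. -/
def glGrading (M N : ℕ) (i : ZMod 2) : Submodule ℂ (Gl M N) := LinearMap.range (glPart M N i)

/-- The bilinear extension of `[f, g] = f g - (-1)^{ij} g f` for `f`, `g` of parity `i`, `j`. -/
def glBracket (M N : ℕ) : Gl M N →ₗ[ℂ] Gl M N →ₗ[ℂ] Gl M N :=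
  ∑ i : ZMod 2, ∑ j : ZMod 2,
    ((LinearMap.mul ℂ (Gl M N)).compl₁₂ (glPart M N i) (glPart M N j) -
      koszul i j • (LinearMap.mul ℂ (Gl M N)).flip.compl₁₂ (glPart M N i) (glPart M N j))

/-- The supertrace. -/
def str (M N : ℕ) : Gl M N →ₗ[ℂ] ℂ where
  toFun f := (∑ i : Fin M, f (Sum.inl i) (Sum.inl i)) - ∑ i : Fin N, f (Sum.inr i) (Sum.inr i)
  map_add' f g := by simp [Finset.sum_add_distrib]; ring
  map_smul' c f := by simp [Finset.mul_sum, mul_sub]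

/-- The form `str (f g)`. -/
def glForm (M N : ℕ) : Gl M N →ₗ[ℂ] Gl M N →ₗ[ℂ] ℂ := (LinearMap.mul ℂ (Gl M N)).compr₂ (str M N)

/-! ### The lattice and the cocycle -/

/-- The lattice `Γ = ⊕ ℤ e_i`. -/
abbrev Lat (M : ℕ) : Type := Fin M → ℤ

/-- The basis vector `e_i`. -/
def e {M : ℕ} (i : Fin M) : Lat M := Pi.single i 1

/-- The bilinear form with `(e_i, e_j) = δ_{ij}`. -/
def ip {M : ℕ} (α β : Lat M) : ℤ := ∑ i, α i * β i

/-- The parity of a lattice vector, that is `(α, α)` modulo 2. -/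
def latPar {M : ℕ} (α : Lat M) : ZMod 2 := (ip α α : ℤ)

/-- The cocycle: the bimultiplicative map with `F(e_i, e_j) = 1` for `i ≤ j` and
`F(e_i, e_j) = -1` for `i > j`. -/
def F {M : ℕ} (α β : Lat M) : ℤˣ :=
  ∏ i, ∏ j, (if i ≤ j then (1 : ℤˣ) else -1) ^ (α i * β j)

/-- The value of the cocycle as a complex number. -/
def Fc {M : ℕ} (α β : Lat M) : ℂ := ((F α β : ℤ) : ℂ)

/-! ### The superalgebra `T` -/

/-- The space with basis `T_{ij}`. -/
abbrev T (M N : ℕ) : Type := (Idx M N × Idx M N) →₀ ℂ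

/-- The basis vector `T_{ij}`. -/
def tb {M N : ℕ} (i j : Idx M N) : T M N := Finsupp.single (i, j) 1

/-- Kronecker's delta. -/
def kd {κ : Type} [DecidableEq κ] (i j : κ) : ℂ := if i = j then 1 else 0

open Sum in
/-- The superbracket of `T` on basis vectors. -/
def tBracketBasis {M N : ℕ} : Idx M N → Idx M N → Idx M N → Idx M N → T M N
  | inl i, inl j, inl k, inl l =>
      if i ≠ j ∧ k ≠ l then
        if 0 ≤ ip (e i - e j) (e k - e l) then 0
        else if j = k ∧ l ≠ i then Fc (e i - e j) (e k - e l) • tb (inl i) (inl l)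
        else if l = i ∧ j ≠ k then Fc (e i - e j) (e k - e l) • tb (inl k) (inl j)
        else Fc (e i - e j) (e k - e l) • (tb (inl i) (inl i) - tb (inl j) (inl j))
      else if i = j ∧ k ≠ l then (ip (e i) (e k - e l) : ℂ) • tb (inl k) (inl l)
      else if i ≠ j ∧ k = l then -((ip (e k) (e i - e j) : ℂ) • tb (inl i) (inl j))
      else 0
  | inr i, inr j, inr k, inr l =>
      kd j k • tb (inr i) (inr l) - kd i l • tb (inr k) (inr j)
  | inl i, inl j, inr k, inl l =>
      if i = j then -(kd i l • tb (inr k) (inl l)) else (kd i l * Fc (e j) (e i)) • tb (inr k) (inl j)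
  | inr k, inl l, inl i, inl j =>
      if i = j then kd i l • tb (inr k) (inl l) else (kd i l * Fc (e i) (e j)) • tb (inr k) (inl j)
  | inl i, inl j, inl k, inr l => (kd j k * Fc (e i) (e j)) • tb (inl i) (inr l)
  | inl k, inr l, inl i, inl j => -((kd j k * Fc (e i) (e j)) • tb (inl i) (inr l))
  | inr i, inr j, inr k, inl l => kd j k • tb (inr i) (inl l)
  | inr k, inl l, inr i, inr j => -(kd j k • tb (inr i) (inl l))
  | inr i, inr j, inl k, inr l => -(kd l i • tb (inl k) (inr j))
  | inl k, inr l, inr i, inr j => kd l i • tb (inl k) (inr j)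
  | inr i, inl j, inl k, inr l =>
      kd j k • tb (inr i) (inr l) + (Fc (e k) (e j) * kd l i) • tb (inl k) (inl j)
  | inl k, inr l, inr i, inl j =>
      kd j k • tb (inr i) (inr l) + (Fc (e k) (e j) * kd l i) • tb (inl k) (inl j)
  | inl _, inl _, inr _, inr _ => 0
  | inr _, inr _, inl _, inl _ => 0
  | inr _, inl _, inr _, inl _ => 0
  | inl _, inr _, inl _, inr _ => 0

/-- The superbracket of `T`. -/
def tBracket (M N : ℕ) : T M N →ₗ[ℂ] T M N →ₗ[ℂ] T M N :=
  Finsupp.linearCombination ℂ fun p => Finsupp.linearCombination ℂ fun q =>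
    tBracketBasis p.1 p.2 q.1 q.2

open Sum in
/-- The bilinear form of `T` on basis vectors. -/
def tFormBasis {M N : ℕ} : Idx M N → Idx M N → Idx M N → Idx M N → ℂ
  | inl i, inl j, inl k, inl l => Fc (e i - e j) (e k - e l) * kd j k * kd l i
  | inr i, inl j, inl k, inr l => -(kd j k * kd l i)
  | inl k, inr l, inr i, inl j => kd j k * kd l i
  | inr i, inr j, inr k, inr l => -(kd j k * kd l i)
  | _, _, _, _ => 0

/-- The bilinear form of `T`. -/
def tForm (M N : ℕ) : T M N →ₗ[ℂ] T M N →ₗ[ℂ] ℂ :=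
  Finsupp.linearCombination ℂ fun p => Finsupp.linearCombination ℂ fun q =>
    tFormBasis p.1 p.2 q.1 q.2

/-- `T_{ij}` has the parity of `i` plus that of `j`. -/
def tGrading (M N : ℕ) (i : ZMod 2) : Submodule ℂ (T M N) :=
  Finsupp.supported ℂ ℂ {p | par p.1 + par p.2 = i}

/-! ### Locally finite sums of operators -/

section LocallyFinite

variable {κ V W : Type} [AddCommMonoid V] [Module ℂ V] [AddCommMonoid W] [Module ℂ W]

/-- Only finitely many members of the family are non-zero on any given vector. -/
def LocFinite (f : κ → V →ₗ[ℂ] W) : Prop := ∀ v, (Function.support fun k => f k v).Finite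

open Classical in
/-- The sum of a locally finite family of operators (zero if it is not locally finite). -/
def locSum (f : κ → V →ₗ[ℂ] W) : V →ₗ[ℂ] W :=
  if h : LocFinite f then
    { toFun := fun v => ∑ᶠ k, f k v
      map_add' := fun v w => by
        simp only [map_add]
        exact finsum_add_distrib (h v) (h w)
      map_smul' := fun c v => by
        simp only [map_smul, RingHom.id_apply]
        exact (smul_finsum' c (h v)).symm }
  else 0

end LocallyFinite

/-! ### The space `V[Γ]` and the vertex operators -/

/-- The symmetric algebra of `𝔥₋ = ⊕_{k < 0} 𝔥(k)`: polynomials in the variables `e_i(k)`,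
`k < 0`. -/
abbrev SymH (M : ℕ) : Type := MvPolynomial (Fin M × {k : ℤ // k < 0}) ℂ

/-- `V[Γ] = ℂ[Γ] ⊗ S(𝔥₋)`; the vector `e^γ ⊗ u` is `Finsupp.single γ u`. -/
abbrev VG (M : ℕ) : Type := Lat M →₀ SymH M

/-- The vector `e^γ ⊗ u` has the parity of `γ`. -/
def vGrading (M : ℕ) (i : ZMod 2) : Submodule ℂ (VG M) :=
  Finsupp.supported (SymH M) ℂ {γ | latPar γ = i}

/-- The operator `α(m)`, `m ≠ 0`, on `S(𝔥₋)`: multiplication by `α(m)` for `m < 0`, and for `m > 0`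
the derivation with `β(-n) ↦ δ_{m,n} m (α, β)`. -/
def heisS {M : ℕ} (α : Lat M) (m : ℤ) : Module.End ℂ (SymH M) :=
  if h : m < 0 then
    LinearMap.mulLeft ℂ (∑ i, (α i : ℂ) • MvPolynomial.X (i, ⟨m, h⟩))
  else
    (MvPolynomial.mkDerivation ℂ fun x : Fin M × {k : ℤ // k < 0} =>
      if (x.2 : ℤ) = -m then (MvPolynomial.C ((m : ℂ) * (ip α (e x.1) : ℂ)) : SymH M)
      else 0).toLinearMap

/-- The operator `α(m)` on `V[Γ]`. -/
def heis {M : ℕ} (α : Lat M) (m : ℤ) : Module.End ℂ (VG M) :=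
  Finsupp.lsum ℂ fun γ : Lat M =>
    Finsupp.lsingle γ ∘ₗ (if m = 0 then (ip α γ : ℂ) • LinearMap.id else heisS α m)

/-- Multiplication by `e^α` in the twisted group algebra: `e^γ ⊗ u ↦ F(α, γ) e^{α + γ} ⊗ u`. -/
def expLat {M : ℕ} (α : Lat M) : Module.End ℂ (VG M) :=
  Finsupp.lsum ℂ fun γ : Lat M => Fc α γ • Finsupp.lsingle (α + γ)

/-- The coefficient of `z^k` in `z^{α(0)}`: the projection to the span of the `e^γ ⊗ u` with
`(α, γ) = k`. -/
def zPow {M : ℕ} (α : Lat M) (k : ℤ) : Module.End ℂ (VG M) :=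
  Finsupp.lsum ℂ fun γ : Lat M => if ip α γ = k then Finsupp.lsingle γ else 0

/-- The coefficient of `x^k` in `exp f = ∑ f^l / l!`, for a power series `f` without constant term
(so that the terms with `l > k` do not contribute). -/
def expCoeff {A : Type} [Ring A] [Algebra ℂ A] (f : PowerSeries A) (k : ℕ) : A :=
  ∑ l ∈ Finset.range (k + 1), ((l.factorial : ℂ)⁻¹) • PowerSeries.coeff k (f ^ l)

/-- `T₋(α, z) = -∑_{n < 0} α(n) z^{-n} / n`, as a power series in `z`. -/
def Tminus {M : ℕ} (α : Lat M) : PowerSeries (Module.End ℂ (VG M)) :=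
  PowerSeries.mk fun n => if n = 0 then 0 else ((n : ℂ)⁻¹) • heis α (-(n : ℤ))

/-- `T₊(α, z) = -∑_{n > 0} α(n) z^{-n} / n`, as a power series in `z⁻¹`. -/
def Tplus {M : ℕ} (α : Lat M) : PowerSeries (Module.End ℂ (VG M)) :=
  PowerSeries.mk fun n => if n = 0 then 0 else -(((n : ℂ)⁻¹) • heis α (n : ℤ))

/-- The contributions to the coefficient of `z^p` in
`Y(α, z) = e^α z^{α(0)} exp T₋(α, z) exp T₊(α, z)`: the term `(a, b)` takes `z^a` from the first
exponential, `z^{-b}` from the second and `z^{p - a + b}` from `z^{α(0)}`. -/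
def vertexTerm {M : ℕ} (α : Lat M) (p : ℤ) (ab : ℕ × ℕ) : Module.End ℂ (VG M) :=
  expLat α * zPow α (p - ab.1 + ab.2) * expCoeff (Tminus α) ab.1 * expCoeff (Tplus α) ab.2

/-- The coefficient of `z^p` in `Y(α, z)`. -/
def vertexCoeff {M : ℕ} (α : Lat M) (p : ℤ) : Module.End ℂ (VG M) := locSum (vertexTerm α p)

/-- For `(α, α)` even: `X_n(α)`, the coefficient of `z^{-n}` in `X(α, z) = z^{(α,α)/2} Y(α, z)`. -/
def Xeven {M : ℕ} (α : Lat M) (n : ℤ) : Module.End ℂ (VG M) :=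
  vertexCoeff α (-n - ip α α / 2)

/-- For `(α, α)` odd: `X_{n - 1/2}(α)`, the coefficient of `z^{-n}` in `X(α, z) = Y(α, z)`. -/
def Xodd {M : ℕ} (α : Lat M) (n : ℤ) : Module.End ℂ (VG M) := vertexCoeff α (-n)

/-- For `(α, α)` and `(β, β)` odd: the normally ordered product `:X_{r - 1/2}(α) X_{s - 1/2}(β):`. -/
def XXnormal {M : ℕ} (α β : Lat M) (r s : ℤ) : Module.End ℂ (VG M) :=
  if r ≤ s then Xodd α r * Xodd β s else -(Xodd β s * Xodd α r)

/-! ### Bosons and their Fock space -/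

/-- The bosonic Fock space: polynomials in the creation operators `φ^i_{r - 1/2}` (left) and
`φ^{i*}_{r - 1/2}` (right), `r ≤ 0`. The vacuum is `1`. -/
abbrev Fock (N : ℕ) : Type :=
  MvPolynomial ((Fin N × {r : ℤ // r ≤ 0}) ⊕ (Fin N × {r : ℤ // r ≤ 0})) ℂ

/-- The operator `φ^i_{r - 1/2}`: a multiplication for `r ≤ 0`, and for `r > 0` minus the derivative
in the variable `φ^{i*}_{(1 - r) - 1/2}`. -/
def phi {N : ℕ} (i : Fin N) (r : ℤ) : Module.End ℂ (Fock N) :=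
  if h : r ≤ 0 then LinearMap.mulLeft ℂ (MvPolynomial.X (Sum.inl (i, ⟨r, h⟩)))
  else -(MvPolynomial.pderiv (Sum.inr (i, ⟨1 - r, by omega⟩))).toLinearMap

/-- The operator `φ^{i*}_{r - 1/2}`: a multiplication for `r ≤ 0`, and for `r > 0` the derivative in
the variable `φ^i_{(1 - r) - 1/2}`. -/
def phiStar {N : ℕ} (i : Fin N) (r : ℤ) : Module.End ℂ (Fock N) :=
  if h : r ≤ 0 then LinearMap.mulLeft ℂ (MvPolynomial.X (Sum.inr (i, ⟨r, h⟩)))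
  else (MvPolynomial.pderiv (Sum.inl (i, ⟨1 - r, by omega⟩))).toLinearMap

/-- The normally ordered product `:φ^i_{r - 1/2} φ^{j*}_{s - 1/2}:`. -/
def phiNormal {N : ℕ} (i j : Fin N) (r s : ℤ) : Module.End ℂ (Fock N) :=
  if r ≤ s then phi i r * phiStar j s else phiStar j s * phi i r

/-! ### The operators on `V[Γ] ⊗ 𝔉` -/

/-- The space `V[Γ] ⊗ 𝔉`. -/
abbrev VF (M N : ℕ) : Type := VG M ⊗[ℂ] Fock N

/-- `e^γ ⊗ u ⊗ v` has the parity of `γ`. -/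
def vfGrading (M N : ℕ) (i : ZMod 2) : Submodule ℂ (VF M N) :=
  Submodule.span ℂ {x | ∃ v ∈ vGrading M i, ∃ f : Fock N, x = v ⊗ₜ[ℂ] f}

/-- The terms of `S_{i, j+M}(m) = ∑_r X_{r - 1/2}(e_i) φ^{j*}_{m - r + 1/2}`. -/
def upperTerm {M N : ℕ} (i : Fin M) (j : Fin N) (m r : ℤ) : Module.End ℂ (VF M N) :=
  TensorProduct.map (Xodd (e i) r) (phiStar j (m - r + 1))

/-- The terms of `S_{j+M, i}(m) = ∑_r X_{r - 1/2}(-e_i) φ^j_{m - r + 1/2}`. -/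
def lowerTerm {M N : ℕ} (j : Fin N) (i : Fin M) (m r : ℤ) : Module.End ℂ (VF M N) :=
  TensorProduct.map (Xodd (-e i) r) (phi j (m - r + 1))

/-- The terms of `S_{i+M, j+M}(m) = ∑_r :φ^i_{r - 1/2} φ^{j*}_{m - r + 1/2}:`. -/
def bosonTerm {M N : ℕ} (i j : Fin N) (m r : ℤ) : Module.End ℂ (VF M N) :=
  LinearMap.lTensor (VG M) (phiNormal i j r (m - r + 1))

open Sum in
/-- The operator on `V[Γ] ⊗ 𝔉` that represents `T_{ij}(m)`. -/
def modeOp {M N : ℕ} (m : ℤ) : Idx M N → Idx M N → Module.End ℂ (VF M N)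
  | inl i, inl j => LinearMap.rTensor (Fock N) (if i = j then heis (e i) m else Xeven (e i - e j) m)
  | inl i, inr j => locSum (upperTerm i j m)
  | inr j, inl i => locSum (lowerTerm j i m)
  | inr i, inr j => locSum (bosonTerm i j m)

/-- The linear map with `T_{ij}(m) ↦ modeOp m i j` and `K ↦ 1`. -/
def rho (M N : ℕ) : Affine (T M N) →ₗ[ℂ] Module.End ℂ (VF M N) :=
  LinearMap.coprod
    (Finsupp.lsum ℂ fun m : ℤ => Finsupp.linearCombination ℂ fun p : Idx M N × Idx M N =>
      modeOp m p.1 p.2)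
    (LinearMap.toSpanSingleton ℂ (Module.End ℂ (VF M N)) 1)

theorem rho_mode {M N : ℕ} (i j : Idx M N) (m : ℤ) :
    rho M N (Affine.mode (tb i j) m) = modeOp m i j := by
  simp [rho, Affine.mode, tb]

theorem rho_K (M N : ℕ) : rho M N Affine.K = 1 := by
  simp [rho, Affine.K]

end AffineGlSuper

end

open AffineGlSuper

/-!
The proof is a free field realization of the affinization of `gl(M|N)`.

*The algebras.* Up to signs, the vectors `T_{AB}` are the elementary matrices: with the sign
`tSign A B`, equal to `F(e_i, e_j)` when `A = i` and `B = j` are at most `M` and to `1` otherwise,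
`T_{AB} ↦ tSign A B • E_{AB}` carries the bracket and the form of `T` to the supercommutator and the
supertrace form of `gl(M|N)` (`tBracketBasis_eq`, `tFormBasis_eq`). The affinization of a Lie
superalgebra by an even, supersymmetric, invariant form is a Lie superalgebra
(`IsLieSuperalgebra.affine`), and for `T` this is transported along the isomorphism.

*Boson-fermion correspondence.* In the product of the modes of two vertex operators `Y(α, z)` and
`Y(β, w)`, moving the annihilating exponential of the first past the creating exponential of the
second costs the factor `(1 - w/z)^{(α, β)}` (`expSeries_mul_shift`, `finSum_vop_vop`). For
exponents `0`, `1` and `-1` this shows that the modes of `X(e_i)` and `X(-e_i)` satisfy the canonical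
anticommutation relations, that `X(e_i - e_j)` is up to a sign the product of `X(e_i)` and `X(-e_j)`
for `i ≠ j`, and that `e_i(z)` is the normally ordered product of `X(e_i)` and `X(-e_i)`
(`finSum_Xodd_mul`, `finSum_XXnormal`). All identities between the infinite sums involved are
handled through the predicate `FinSum` on the vectors of the space.

*Wick's theorem.* Hence there are, for every index `A`, fields `a_A` and `b_A`, fermions for `A ≤ M`
and bosons for `A > M`, such that every operator of the representation is up to the sign `tSign A B`
a mode of the normally ordered product of `a_A` and `b_B` (`isFreeFieldSystem`, `modeOp_eq`). For
any free fields, the supercommutators of such quadratic expressions are those of the affinization of a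
general linear Lie superalgebra with `K = 1`; the central term counts the products whose normal
ordering is affected by a shift of the summation index (`IsFreeFieldSystem.current_mul_current`).
-/

noncomputable section

namespace AffineGlSuper

/-! ### Finite sums over arbitrary index types -/

set_option linter.unusedSectionVars false

section FinSum

variable {κ ι V W : Type*} [AddCommGroup V] [Module ℂ V] [AddCommGroup W] [Module ℂ W]

/-- The family `f` has finite support and sum `x`. This is `HasSum` for the discrete topology. -/
def FinSum (f : κ → V) (x : V) : Prop := (Function.support f).Finite ∧ ∑ᶠ k, f k = x

theorem FinSum.unique {f : κ → V} {x y : V} (h : FinSum f x) (h' : FinSum f y) : x = y :=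
  h.2.symm.trans h'.2

theorem FinSum.congr {f g : κ → V} {x y : V} (h : FinSum f x) (hf : ∀ k, f k = g k)
    (hx : x = y) : FinSum g y := by
  obtain rfl : f = g := funext hf
  exact hx ▸ h

theorem finSum_of_finite {f : κ → V} (h : (Function.support f).Finite) : FinSum f (∑ᶠ k, f k) :=
  ⟨h, rfl⟩

theorem finSum_finset {f : κ → V} (s : Finset κ) (h : ∀ k ∉ s, f k = 0) :
    FinSum f (∑ k ∈ s, f k) := by
  have hs : Function.support f ⊆ s := fun k hk => by
    by_contra hks
    exact hk (h k hks)
  exact ⟨s.finite_toSet.subset hs, finsum_eq_sum_of_support_subset f hs⟩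

theorem finSum_single {f : κ → V} (a : κ) (h : ∀ k, k ≠ a → f k = 0) : FinSum f (f a) := by
  refine (finSum_finset {a} fun k hk => h k (by simpa using hk)).congr (fun _ => rfl) (by simp)

theorem finSum_zero : FinSum (fun _ : κ => (0 : V)) 0 := by
  simpa using finSum_finset (f := fun _ : κ => (0 : V)) ∅ (by simp)

theorem FinSum.add {f g : κ → V} {x y : V} (h : FinSum f x) (h' : FinSum g y) :
    FinSum (fun k => f k + g k) (x + y) :=
  ⟨(h.1.union h'.1).subset (Function.support_add f g), by
    rw [finsum_add_distrib h.1 h'.1, h.2, h'.2]⟩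

theorem FinSum.map {f : κ → V} {x : V} (h : FinSum f x) (L : V →ₗ[ℂ] W) :
    FinSum (fun k => L (f k)) (L x) :=
  ⟨h.1.subset fun k hk hf => hk (by simp only [hf, map_zero]), by
    rw [← h.2]; exact (L.toAddMonoidHom.map_finsum h.1).symm⟩

theorem FinSum.smul {f : κ → V} {x : V} (h : FinSum f x) (c : ℂ) :
    FinSum (fun k => c • f k) (c • x) := h.map (c • LinearMap.id)

theorem FinSum.neg {f : κ → V} {x : V} (h : FinSum f x) :
    FinSum (fun k => -f k) (-x) := h.map (-LinearMap.id)

theorem FinSum.sub {f g : κ → V} {x y : V} (h : FinSum f x) (h' : FinSum g y) :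
    FinSum (fun k => f k - g k) (x - y) := by
  simpa only [sub_eq_add_neg] using h.add h'.neg

theorem FinSum.smul_const {f : κ → ℂ} {c : ℂ} (h : FinSum f c) (x : V) :
    FinSum (fun k => f k • x) (c • x) := h.map (LinearMap.toSpanSingleton ℂ V x)

theorem FinSum.apply {f : κ → Module.End ℂ V} {T : Module.End ℂ V} (h : FinSum f T) (x : V) :
    FinSum (fun k => f k x) (T x) := h.map (LinearMap.applyₗ x)

theorem FinSum.equiv {f : κ → V} {x : V} (h : FinSum f x) (ε : ι ≃ κ) :
    FinSum (fun k => f (ε k)) x :=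
  ⟨h.1.preimage ε.injective.injOn, (finsum_comp_equiv ε).trans h.2⟩

theorem finSum_comp_injective_iff {f : κ → V} {x : V} {i : ι → κ} (hi : Function.Injective i)
    (h : ∀ k ∉ Set.range i, f k = 0) : FinSum (fun n => f (i n)) x ↔ FinSum f x := by
  have hsum : ∑ᶠ n, f (i n) = ∑ᶠ k, f k := by
    rw [← finsum_mem_range hi, finsum_mem_def]
    refine finsum_congr fun k => ?_
    by_cases hk : k ∈ Set.range i
    · rw [Set.indicator_of_mem hk]
    · rw [Set.indicator_of_notMem hk, h k hk]
  refine ⟨fun hx => ⟨(hx.1.image i).subset fun k hk => ?_, hsum ▸ hx.2⟩,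
    fun hx => ⟨hx.1.preimage hi.injOn, hsum.trans hx.2⟩⟩
  by_cases hkr : k ∈ Set.range i
  · obtain ⟨n, rfl⟩ := hkr
    exact ⟨n, hk, rfl⟩
  · exact absurd (h k hkr) hk

theorem FinSum.fiberwise {f : κ × ι → V} {x : V} (h : FinSum f x) {g : κ → V}
    (hg : ∀ a, FinSum (fun b => f (a, b)) (g a)) : FinSum g x := by
  have hgf : ∀ a, g a = ∑ᶠ b, f (a, b) := fun a => (hg a).2.symm
  refine ⟨(h.1.image Prod.fst).subset fun a ha => ?_, ?_⟩
  · by_contra hn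
    apply ha
    rw [hgf]
    apply finsum_eq_zero_of_forall_eq_zero
    intro b
    by_contra hb
    exact hn ⟨(a, b), hb, rfl⟩
  · rw [← h.2, finsum_curry f h.1]
    exact finsum_congr hgf

theorem exists_finSum_prod {f : κ × ι → V} {g : κ → V} {s : Set κ} (hs : s.Finite)
    (h0 : ∀ a ∉ s, ∀ b, f (a, b) = 0) (hg : ∀ a, FinSum (fun b => f (a, b)) (g a)) :
    ∃ x, FinSum f x ∧ FinSum g x := by
  have hf : (Function.support f).Finite := by
    refine (hs.biUnion fun a _ => (hg a).1.image fun b => (a, b)).subset fun p hp => ?_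
    have hps : p.1 ∈ s := by
      by_contra hn
      exact hp (h0 _ hn _)
    exact Set.mem_biUnion hps ⟨p.2, hp, rfl⟩
  exact ⟨_, finSum_of_finite hf, (finSum_of_finite hf).fiberwise hg⟩

/-- Fubini: the iterated sums of `f` in the two orders agree, as soon as the inner index `b` and
the outer index `a` are confined to finite sets in the sense of `h0` and `hg`. -/
theorem FinSum.swap {f : κ → ι → V} {g : κ → V} {g' : ι → V} {x : V} {s : Set κ} (hs : s.Finite)
    (h0 : ∀ a ∉ s, ∀ b, f a b = 0) (hg : ∀ a, FinSum (fun b => f a b) (g a))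
    (hg' : ∀ b, FinSum (fun a => f a b) (g' b)) (h : FinSum g x) : FinSum g' x := by
  obtain ⟨y, hy, hy'⟩ := exists_finSum_prod (f := fun p : κ × ι => f p.1 p.2) hs h0 hg
  obtain rfl := h.unique hy'
  exact (hy.equiv (Equiv.prodComm ι κ)).fiberwise hg'

theorem FinSum.mem {f : κ → V} {x : V} (h : FinSum f x) {p : Submodule ℂ V}
    (hf : ∀ k, f k ∈ p) : x ∈ p := by
  rw [← h.2]
  exact finsum_induction (· ∈ p) p.zero_mem (fun _ _ => p.add_mem) hf

/-- `∑_r ([r ≤ 0] - [r + k ≤ 0]) = k`. -/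
theorem finSum_step_sub_step (k : ℤ) :
    FinSum (fun r : ℤ => (if r ≤ 0 then (1 : ℂ) else 0) - if r + k ≤ 0 then 1 else 0) (k : ℂ) := by
  have one : ∀ k : ℤ, FinSum (fun r : ℤ =>
      (if r + k ≤ 0 then (1 : ℂ) else 0) - if r + (k + 1) ≤ 0 then 1 else 0) 1 := fun k =>
    (finSum_single (-k) fun r hr => by
      have : r + k ≤ 0 ↔ r + (k + 1) ≤ 0 := by omega
      simp [this]).congr (fun _ => rfl) (by simp)
  induction k with
  | zero => simpa using finSum_zero (κ := ℤ) (V := ℂ)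
  | succ n ih => exact (ih.add (one n)).congr (fun r => by ring) (by push_cast; ring)
  | pred n ih =>
    refine (ih.sub (one (-n - 1))).congr (fun r => ?_) (by push_cast; ring)
    rw [sub_add_cancel]; ring

end FinSum

section LocSum

variable {κ V W : Type} [AddCommGroup V] [Module ℂ V] [AddCommGroup W] [Module ℂ W]

theorem LocFinite.finSum {f : κ → V →ₗ[ℂ] W} (h : LocFinite f) (v : V) :
    FinSum (fun k => f k v) (locSum f v) := by
  refine ⟨h v, ?_⟩
  rw [locSum, dif_pos h]
  rfl

theorem locFinite_of_finSum {f : κ → V →ₗ[ℂ] W} {T : V → W}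
    (h : ∀ v, FinSum (fun k => f k v) (T v)) : LocFinite f := fun v => (h v).1

theorem locSum_eq {f : κ → V →ₗ[ℂ] W} {T : V →ₗ[ℂ] W}
    (h : ∀ v, FinSum (fun k => f k v) (T v)) : locSum f = T :=
  LinearMap.ext fun v => ((locFinite_of_finSum h).finSum v).unique (h v)

end LocSum

/-! ### Exponentials of power series over a noncommutative algebra -/

section Exp

variable {A B : Type} [Ring A] [Algebra ℂ A] [Ring B] [Algebra ℂ B]

open PowerSeries in
/-- The operator `x d/dx` on power series. -/
def theta : PowerSeries A →ₗ[ℂ] PowerSeries A where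
  toFun f := mk fun n => (n : ℂ) • coeff n f
  map_add' f g := by ext n; simp
  map_smul' c f := by
    ext n
    rw [RingHom.id_apply, coeff_mk, LinearMap.map_smul_of_tower, LinearMap.map_smul_of_tower,
      coeff_mk, smul_comm]

open PowerSeries

@[simp] theorem coeff_theta (f : PowerSeries A) (n : ℕ) :
    coeff n (theta f) = (n : ℂ) • coeff n f := by simp [theta]

theorem theta_mul (f g : PowerSeries A) : theta (f * g) = theta f * g + f * theta g := by
  ext n
  simp only [coeff_theta, coeff_mul, map_add, Finset.smul_sum, ← Finset.sum_add_distrib]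
  refine Finset.sum_congr rfl fun p hp => ?_
  rw [← Finset.HasAntidiagonal.mem_antidiagonal.1 hp]
  simp [add_smul]

theorem theta_C (x : A) : theta (C x) = 0 := by
  ext n
  rw [coeff_theta, coeff_C]
  by_cases h : n = 0 <;> simp [h]

theorem commute_of_coeff {f g : PowerSeries A} (h : ∀ m n, Commute (coeff m f) (coeff n g)) :
    Commute f g := by
  ext n
  rw [coeff_mul, coeff_mul, ← Finset.Nat.sum_antidiagonal_swap]
  exact Finset.sum_congr rfl fun p _ => h _ _

theorem theta_pow_succ {f : PowerSeries A} (h : Commute (theta f) f) (l : ℕ) :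
    theta (f ^ (l + 1)) = ((l + 1 : ℕ) : ℂ) • (theta f * f ^ l) := by
  induction l with
  | zero => simp
  | succ l ih =>
    rw [pow_succ, theta_mul, ih, ← (h.pow_right (l + 1)).eq, smul_mul_assoc, mul_assoc, ← pow_succ]
    push_cast
    module

theorem coeff_pow_eq_zero {f : PowerSeries A} (h0 : coeff 0 f = 0) {k l : ℕ} (h : k < l) :
    coeff k (f ^ l) = 0 := by
  induction l generalizing k with
  | zero => omega
  | succ l ih =>
    rw [pow_succ', coeff_mul]
    refine Finset.sum_eq_zero fun p hp => ?_
    rw [Finset.HasAntidiagonal.mem_antidiagonal] at hp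
    rcases Nat.eq_zero_or_pos p.1 with h1 | h1
    · rw [h1, h0, zero_mul]
    · rw [ih (by omega), mul_zero]

theorem expCoeff_eq_sum {f : PowerSeries A} (h0 : coeff 0 f = 0) {k n : ℕ} (h : k < n) :
    expCoeff f k = ∑ l ∈ Finset.range n, ((l.factorial : ℂ)⁻¹) • coeff k (f ^ l) := by
  refine Finset.sum_subset (fun l hl => ?_) fun l _ hl => ?_
  · simp only [Finset.mem_range] at *; omega
  · simp only [Finset.mem_range] at hl
    rw [coeff_pow_eq_zero h0 (by omega), smul_zero]

theorem expCoeff_zero (f : PowerSeries A) : expCoeff f 0 = 1 := by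
  simp [expCoeff]

/-- The power series `exp f`, for `f` without constant term. -/
def expSeries (f : PowerSeries A) : PowerSeries A := mk (expCoeff f)

@[simp] theorem coeff_expSeries (f : PowerSeries A) (k : ℕ) :
    coeff k (expSeries f) = expCoeff f k := coeff_mk _ _

/-- If the coefficients of `f` commute with each other, then `exp f` solves the differential
equation `E' = f' E`. -/
theorem theta_expSeries {f : PowerSeries A} (h0 : coeff 0 f = 0)
    (hf : ∀ m n, Commute (coeff m f) (coeff n f)) :
    theta (expSeries f) = theta f * expSeries f := by
  have hc : Commute (theta f) f := commute_of_coeff fun m n => by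
    rw [coeff_theta]; exact (hf m n).smul_left _
  ext k
  rw [coeff_theta, coeff_expSeries, expCoeff_eq_sum h0 (n := k + 2) (by omega),
    Finset.sum_range_succ', smul_add, Finset.smul_sum]
  have h1 : (k : ℂ) • (((0 : ℕ).factorial : ℂ)⁻¹ • coeff k (f ^ 0)) = 0 := by
    rcases Nat.eq_zero_or_pos k with h | h
    · simp [h]
    · simp [coeff_one, h.ne']
  rw [h1, add_zero]
  have h2 : ∀ l : ℕ, (k : ℂ) • (((l + 1).factorial : ℂ)⁻¹ • coeff k (f ^ (l + 1))) =
      ((l.factorial : ℂ)⁻¹) • coeff k (theta f * f ^ l) := fun l => by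
    rw [smul_comm, ← coeff_theta, theta_pow_succ hc, LinearMap.map_smul_of_tower, smul_smul,
      Nat.factorial_succ]
    congr 1
    have : ((l + 1 : ℕ) : ℂ) ≠ 0 := by exact_mod_cast l.succ_ne_zero
    have : (l.factorial : ℂ) ≠ 0 := by exact_mod_cast l.factorial_ne_zero
    push_cast at *
    field_simp
  simp only [h2, coeff_mul, Finset.smul_sum]
  rw [Finset.sum_comm]
  refine Finset.sum_congr rfl fun p hp => ?_
  rw [Finset.HasAntidiagonal.mem_antidiagonal] at hp
  rw [coeff_expSeries, expCoeff_eq_sum h0 (n := k + 1) (by omega), Finset.mul_sum]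
  simp

/-- A solution of `E' = g E` is determined by its constant term. -/
theorem eq_of_theta_eq {g E E' : PowerSeries A} (h0 : coeff 0 g = 0)
    (hE : theta E = g * E) (hE' : theta E' = g * E') (h : coeff 0 E = coeff 0 E') : E = E' := by
  ext k
  induction k using Nat.strong_induction_on with
  | _ k ih =>
    rcases Nat.eq_zero_or_pos k with rfl | hk
    · exact h
    · have e : (k : ℂ) • coeff k E = (k : ℂ) • coeff k E' := by
        rw [← coeff_theta, ← coeff_theta, hE, hE', coeff_mul, coeff_mul]
        refine Finset.sum_congr rfl fun p hp => ?_
        rw [Finset.HasAntidiagonal.mem_antidiagonal] at hp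
        rcases Nat.eq_zero_or_pos p.1 with h1 | h1
        · rw [h1, h0, zero_mul, zero_mul]
        · rw [ih _ (by omega)]
      have hk' : (k : ℂ) ≠ 0 := by exact_mod_cast hk.ne'
      exact smul_right_injective _ hk' e

theorem coeff_zero_mul_eq (f g : PowerSeries A) : coeff 0 (f * g) = coeff 0 f * coeff 0 g := by
  simp

theorem coeff_zero_theta (f : PowerSeries A) : coeff 0 (theta f) = 0 := by simp

theorem commute_expCoeff {x : A} {f : PowerSeries A} (h : ∀ n, Commute x (coeff n f)) (k : ℕ) :
    Commute x (expCoeff f k) := by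
  have hC : Commute (C x) f := by
    ext n; simpa [coeff_C_mul, coeff_mul_C] using (h n).eq
  refine Commute.sum_right _ _ _ fun l _ => Commute.smul_right ?_ _
  have := congrArg (coeff k) (hC.pow_right l).eq
  rwa [coeff_C_mul, coeff_mul_C] at this

theorem commute_expSeries {f g : PowerSeries A} (h : ∀ m n, Commute (coeff m f) (coeff n g)) :
    Commute f (expSeries g) :=
  commute_of_coeff fun m n => by
    rw [coeff_expSeries]; exact commute_expCoeff (h m) n

theorem expSeries_add {f g : PowerSeries A} (hf0 : coeff 0 f = 0) (hg0 : coeff 0 g = 0)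
    (hf : ∀ m n, Commute (coeff m f) (coeff n f)) (hg : ∀ m n, Commute (coeff m g) (coeff n g))
    (hfg : ∀ m n, Commute (coeff m f) (coeff n g)) :
    expSeries (f + g) = expSeries f * expSeries g := by
  refine eq_of_theta_eq (coeff_zero_theta _)
    (theta_expSeries (by rw [map_add, hf0, hg0, add_zero]) ?_) ?_ ?_
  · intro m n
    simp only [map_add]
    exact ((hf m n).add_right (hfg m n)).add_left (((hfg n m).symm).add_right (hg m n))
  · have hc : Commute (theta g) (expSeries f) := commute_expSeries fun m n => by
      rw [coeff_theta]; exact ((hfg n m).symm).smul_left _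
    rw [theta_mul, theta_expSeries hf0 hf, theta_expSeries hg0 hg, map_add, add_mul,
      ← mul_assoc (expSeries f), ← hc.eq, mul_assoc, mul_assoc]
  · simp only [coeff_zero_mul_eq, coeff_expSeries, expCoeff_zero, mul_one]

theorem expCoeff_map (φ : A →ₐ[ℂ] B) (f : PowerSeries A) (k : ℕ) :
    expCoeff (PowerSeries.map φ.toRingHom f) k = φ (expCoeff f k) := by
  simp only [expCoeff, map_sum, map_smul]
  refine Finset.sum_congr rfl fun l _ => ?_
  rw [← map_pow, PowerSeries.coeff_map]
  rfl

/-- If `x` has scalar commutators `c_k` with the coefficients of `f`, then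
`[x, exp f] = c · exp f`. -/
theorem commutator_expSeries {x : A} {f : PowerSeries A} (h0 : coeff 0 f = 0)
    (hf : ∀ m n, Commute (coeff m f) (coeff n f)) (c : ℕ → ℂ)
    (h : ∀ n, x * coeff n f - coeff n f * x = algebraMap ℂ A (c n)) :
    C x * expSeries f - expSeries f * C x =
      (mk fun n => algebraMap ℂ A (c n)) * expSeries f := by
  -- the difference of the two sides solves `E' = f' E` and has constant term zero
  set γ : PowerSeries A := mk fun n => algebraMap ℂ A (c n) with hγ
  have hcent : ∀ g : PowerSeries A, Commute γ g := fun g => commute_of_coeff fun m n => by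
    rw [hγ, coeff_mk]; exact Algebra.commutes _ _
  have hx : C x * theta f - theta f * C x = theta γ := by
    ext n
    rw [map_sub, coeff_C_mul, coeff_mul_C, coeff_theta, coeff_theta, hγ, coeff_mk, ← h n,
      mul_smul_comm, smul_mul_assoc, smul_sub]
  have hE := theta_expSeries h0 hf
  have key : C x * expSeries f - expSeries f * C x - γ * expSeries f = 0 := by
    refine eq_of_theta_eq (coeff_zero_theta f) ?_ (by rw [mul_zero, map_zero]) ?_
    · simp only [map_sub, theta_mul, theta_C, hE, zero_mul, mul_zero, zero_add, add_zero]
      rw [← hx, ← mul_assoc γ, (hcent _).eq]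
      noncomm_ring
    · have hc0 : algebraMap ℂ A (c 0) = 0 := by rw [← h 0, h0]; simp
      simp only [map_sub, coeff_zero_mul_eq, coeff_expSeries, expCoeff_zero, hγ, coeff_mk, hc0,
        mul_one, one_mul, sub_self, map_zero]
  exact sub_eq_zero.1 key

/-- Let `[q_a, n f_n] = s q_{a-n}` for all `n ≥ 1`. Then moving `q_a` from the right of `exp f` to
its left costs the factor `(1 - x)^s`, whose coefficients are the `c_j`: the recursion `hc` is the
coefficientwise form of `x c' = -s x (1 - x)⁻¹ c`. -/
theorem expSeries_mul_shift {f : PowerSeries A} (h0 : coeff 0 f = 0)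
    (hf : ∀ m n, Commute (coeff m f) (coeff n f)) (q : ℤ → A) (s : ℂ)
    (h : ∀ (a : ℤ) (n : ℕ), n ≠ 0 →
      q a * (n : ℂ) • coeff n f - ((n : ℂ) • coeff n f) * q a = s • q (a - n))
    (c : ℕ → ℂ) (c0 : c 0 = 1)
    (hc : ∀ k : ℕ, (k : ℂ) * c k = -(s * ∑ j ∈ Finset.range k, c j)) (a : ℤ) :
    expSeries f * C (q a) = (mk fun j : ℕ => c j • q (a - j)) * expSeries f := by
  have hE := theta_expSeries h0 hf
  -- both sides solve `E' = f' E` and have constant term `q a`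
  refine eq_of_theta_eq (coeff_zero_theta f) ?_ ?_ ?_
  · rw [theta_mul, theta_C, hE]; noncomm_ring
  · have key : theta (mk fun j : ℕ => c j • q (a - j)) + (mk fun j : ℕ => c j • q (a - j)) * theta f
        = theta f * (mk fun j : ℕ => c j • q (a - j)) := by
      ext k
      rw [map_add, coeff_theta, coeff_mk, coeff_mul, coeff_mul, ← Finset.Nat.sum_antidiagonal_swap,
        ← sub_eq_zero, add_sub_assoc, ← Finset.sum_sub_distrib,
        Finset.Nat.sum_antidiagonal_eq_sum_range_succ_mk, Finset.sum_range_succ']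
      have e : ∀ n ∈ Finset.range k, _ = _ := fun n hn => by
        exact show (coeff (k - (n + 1)) (mk fun j : ℕ => c j • q (a - j))) * coeff (n + 1) (theta f)
          - coeff (n + 1) (theta f) * (coeff (k - (n + 1)) (mk fun j : ℕ => c j • q (a - j)))
          = (s * c (k - 1 - n)) • q (a - k) from by
            have hnk : n + 1 ≤ k := Finset.mem_range.1 hn
            rw [coeff_mk, coeff_theta, smul_mul_assoc, mul_smul_comm (c _), ← smul_sub,
              h _ _ n.succ_ne_zero, smul_smul, mul_comm, show k - 1 - n = k - (n + 1) by omega]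
            congr 2
            push_cast [hnk]
            ring
      simp only [Prod.swap_prod_mk]
      rw [Finset.sum_congr rfl e, ← Finset.sum_smul, ← Finset.mul_sum, Finset.sum_range_reflect c k]
      simp only [coeff_zero_theta, mul_zero, zero_mul, sub_self, add_zero, smul_smul]
      rw [← add_smul, hc]
      simp
    rw [theta_mul, hE, ← mul_assoc, ← mul_assoc, ← add_mul, key]
  · simp [-coeff_zero_eq_constantCoeff, coeff_zero_mul_eq, expCoeff_zero, c0]

/-- The coefficient of `x^k` for an arbitrary integer `k`. -/
def zcoeff (k : ℤ) (f : PowerSeries A) : A := if 0 ≤ k then coeff k.toNat f else 0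

theorem zcoeff_natCast (n : ℕ) (f : PowerSeries A) : zcoeff n f = coeff n f := by
  simp [zcoeff]

theorem zcoeff_of_neg {k : ℤ} (h : k < 0) (f : PowerSeries A) : zcoeff k f = 0 :=
  if_neg (by omega)

theorem zcoeff_theta (k : ℤ) (f : PowerSeries A) : zcoeff k (theta f) = (k : ℂ) • zcoeff k f := by
  rcases lt_or_ge k 0 with h | h
  · simp [zcoeff_of_neg h]
  · lift k to ℕ using h
    simp only [zcoeff_natCast, coeff_theta, Int.cast_natCast]

theorem finSum_zcoeff_mul (n : ℤ) (f g : PowerSeries A) :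
    FinSum (fun x : ℤ => zcoeff x f * zcoeff (n - x) g) (zcoeff n (f * g)) := by
  rcases lt_or_ge n 0 with h | h
  · rw [zcoeff_of_neg h]
    refine finSum_zero.congr (fun x => ?_) rfl
    rcases lt_or_ge x 0 with hx | hx
    · rw [zcoeff_of_neg hx, zero_mul]
    · rw [zcoeff_of_neg (show n - x < 0 by omega), mul_zero]
  · lift n to ℕ using h
    rw [← finSum_comp_injective_iff Nat.cast_injective]
    · rw [zcoeff_natCast, coeff_mul, Finset.Nat.sum_antidiagonal_eq_sum_range_succ_mk]
      refine (finSum_finset (f := fun m : ℕ => zcoeff (m : ℤ) f * zcoeff (n - m : ℤ) g)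
        (Finset.range n.succ) fun m hm => ?_).congr (fun _ => rfl) ?_
      · rw [Finset.mem_range] at hm
        rw [zcoeff_of_neg (show (n : ℤ) - m < 0 by omega), mul_zero]
      · refine Finset.sum_congr rfl fun m hm => ?_
        rw [Finset.mem_range] at hm
        rw [zcoeff_natCast, ← Nat.cast_sub (by omega), zcoeff_natCast]
    · intro x hx
      rw [zcoeff_of_neg, zero_mul]
      by_contra hn
      exact hx ⟨x.toNat, by omega⟩

theorem zcoeff_C_mul (n : ℤ) (x : A) (f : PowerSeries A) :
    zcoeff n (C x * f) = x * zcoeff n f := by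
  by_cases h : 0 ≤ n <;> simp [zcoeff, h, coeff_C_mul]

theorem zcoeff_mul_C (n : ℤ) (x : A) (f : PowerSeries A) :
    zcoeff n (f * C x) = zcoeff n f * x := by
  by_cases h : 0 ≤ n <;> simp [zcoeff, h, coeff_mul_C]

end Exp

/-! ### The Heisenberg algebra on the symmetric algebra -/

section Heisenberg

variable {M : ℕ}

theorem ip_add_left (α β γ : Lat M) : ip (α + β) γ = ip α γ + ip β γ := by
  simp [ip, add_mul, Finset.sum_add_distrib]

theorem ip_add_right (α β γ : Lat M) : ip α (β + γ) = ip α β + ip α γ := by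
  simp [ip, mul_add, Finset.sum_add_distrib]

theorem ip_neg_left (α β : Lat M) : ip (-α) β = -ip α β := by simp [ip]

theorem ip_neg_right (α β : Lat M) : ip α (-β) = -ip α β := by simp [ip]

theorem ip_comm (α β : Lat M) : ip α β = ip β α := by simp [ip, mul_comm]

theorem ip_sub_left (α β γ : Lat M) : ip (α - β) γ = ip α γ - ip β γ := by
  rw [sub_eq_add_neg, ip_add_left, ip_neg_left, sub_eq_add_neg]

theorem ip_sub_right (α β γ : Lat M) : ip α (β - γ) = ip α β - ip α γ := by
  rw [sub_eq_add_neg, ip_add_right, ip_neg_right, sub_eq_add_neg]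

theorem ip_e_right (α : Lat M) (j : Fin M) : ip α (e j) = α j := by
  simp [ip, e, Pi.single_apply]

theorem ip_e_e (i j : Fin M) : ip (e i) (e j) = if i = j then 1 else 0 := by
  rw [ip_e_right]; simp [e, Pi.single_apply, eq_comm]

theorem heisS_of_neg (α : Lat M) {m : ℤ} (h : m < 0) :
    heisS α m = LinearMap.mulLeft ℂ (∑ i, (α i : ℂ) • MvPolynomial.X (i, ⟨m, h⟩)) := dif_pos h

/-- For `m > 0`, the derivation `α(m)` of the symmetric algebra. -/
def heisD (α : Lat M) (m : ℤ) : Derivation ℂ (SymH M) (SymH M) :=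
  MvPolynomial.mkDerivation ℂ fun x : Fin M × {k : ℤ // k < 0} =>
    if (x.2 : ℤ) = -m then (MvPolynomial.C ((m : ℂ) * (ip α (e x.1) : ℂ)) : SymH M) else 0

theorem heisS_of_nonneg (α : Lat M) {m : ℤ} (h : 0 ≤ m) :
    heisS α m = (heisD α m).toLinearMap := dif_neg (by omega)

theorem heisS_apply_of_nonneg (α : Lat M) {m : ℤ} (h : 0 ≤ m) (u : SymH M) :
    heisS α m u = heisD α m u := by rw [heisS_of_nonneg α h]; rfl

theorem heisD_X (α : Lat M) (m : ℤ) (x : Fin M × {k : ℤ // k < 0}) :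
    heisD α m (MvPolynomial.X x) =
      if (x.2 : ℤ) = -m then MvPolynomial.C ((m : ℂ) * (ip α (e x.1) : ℂ)) else 0 :=
  MvPolynomial.mkDerivation_X _ _ _

theorem heisS_commute_neg (α β : Lat M) {m n : ℤ} (hm : m < 0) (hn : n < 0) :
    Commute (heisS α m) (heisS β n) := by
  rw [heisS_of_neg α hm, heisS_of_neg β hn]
  refine LinearMap.ext fun u => ?_
  simp only [Module.End.mul_apply, LinearMap.mulLeft_apply]
  ring

theorem heisS_commute_nonneg (α β : Lat M) {m n : ℤ} (hm : 0 ≤ m) (hn : 0 ≤ n) :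
    Commute (heisS α m) (heisS β n) := by
  have h : ⁅heisD α m, heisD β n⁆ = 0 := by
    refine MvPolynomial.derivation_ext fun x => ?_
    rw [Derivation.commutator_apply, heisD_X, heisD_X]
    split_ifs <;> simp
  refine LinearMap.ext fun u => ?_
  have hu := congrArg (fun D : Derivation ℂ (SymH M) (SymH M) => D u) h
  simp only [Derivation.commutator_apply, Derivation.zero_apply, sub_eq_zero] at hu
  simp only [Module.End.mul_apply, heisS_apply_of_nonneg _ hm, heisS_apply_of_nonneg _ hn, hu]

theorem heisS_commutator (α β : Lat M) {m n : ℤ} (hm : 0 ≤ m) (hn : n < 0) :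
    heisS α m * heisS β n - heisS β n * heisS α m =
      algebraMap ℂ _ (if n = -m then (m : ℂ) * (ip α β : ℂ) else 0) := by
  refine LinearMap.ext fun u => ?_
  rw [heisS_of_neg β hn]
  simp only [LinearMap.sub_apply, Module.End.mul_apply, LinearMap.mulLeft_apply,
    heisS_apply_of_nonneg _ hm, Derivation.leibniz, smul_eq_mul, map_sum, Derivation.map_smul,
    heisD_X, Module.algebraMap_end_apply]
  rw [add_sub_cancel_left]
  split_ifs with h
  · have : (ip α β : ℂ) = ∑ i, (β i : ℂ) * (ip α (e i) : ℂ) := by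
      simp only [ip_e_right]
      simp [ip, mul_comm]
    rw [this, Finset.mul_sum, Finset.mul_sum, Finset.sum_smul]
    refine Finset.sum_congr rfl fun i _ => ?_
    rw [MvPolynomial.smul_eq_C_mul, MvPolynomial.smul_eq_C_mul, ← MvPolynomial.C_mul, mul_comm]
    congr 2
    ring
  · simp

theorem heisS_add (α β : Lat M) (m : ℤ) : heisS (α + β) m = heisS α m + heisS β m := by
  rcases lt_or_ge m 0 with h | h
  · refine LinearMap.ext fun u => ?_
    simp [heisS_of_neg _ h, add_smul, Finset.sum_add_distrib, add_mul]
  · have hD : heisD (α + β) m = heisD α m + heisD β m := by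
      refine MvPolynomial.derivation_ext fun x => ?_
      rw [Derivation.add_apply, heisD_X, heisD_X, heisD_X]
      split_ifs
      · rw [← MvPolynomial.C_add, ip_add_left]
        push_cast
        rw [mul_add]
      · simp
    refine LinearMap.ext fun u => ?_
    simp only [LinearMap.add_apply, heisS_apply_of_nonneg _ h, hD, Derivation.add_apply]

theorem heisS_zero (m : ℤ) : heisS (0 : Lat M) m = 0 := by
  have := heisS_add (0 : Lat M) 0 m
  rwa [add_zero, left_eq_add] at this

end Heisenberg

/-! ### The two exponentials -/

section Exponentials

theorem smul_commutator {A : Type} [Ring A] [Algebra ℂ A] (c : ℂ) (x y : A) :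
    x * c • y - c • y * x = c • (x * y - y * x) := by
  rw [mul_smul_comm, smul_mul_assoc, smul_sub]

theorem neg_commutator {A : Type} [Ring A] (x y : A) : y * -x - -x * y = x * y - y * x := by
  noncomm_ring

variable {M : ℕ}

open PowerSeries

/-- `T₋(α, z)` with coefficients acting on the symmetric algebra. -/
def TminusS (α : Lat M) : PowerSeries (Module.End ℂ (SymH M)) :=
  mk fun n => if n = 0 then 0 else ((n : ℂ)⁻¹) • heisS α (-(n : ℤ))

/-- `T₊(α, z)` with coefficients acting on the symmetric algebra. -/
def TplusS (α : Lat M) : PowerSeries (Module.End ℂ (SymH M)) :=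
  mk fun n => if n = 0 then 0 else -(((n : ℂ)⁻¹) • heisS α (n : ℤ))

/-- The coefficient of `z^k` in `exp T₋(α, z)`. -/
def expMinus (α : Lat M) (k : ℤ) : Module.End ℂ (SymH M) := zcoeff k (expSeries (TminusS α))

/-- The coefficient of `z^{-k}` in `exp T₊(α, z)`. -/
def expPlus (α : Lat M) (k : ℤ) : Module.End ℂ (SymH M) := zcoeff k (expSeries (TplusS α))

theorem coeff_zero_TminusS (α : Lat M) : coeff 0 (TminusS α) = 0 := by
  rw [TminusS, coeff_mk, if_pos rfl]

theorem coeff_zero_TplusS (α : Lat M) : coeff 0 (TplusS α) = 0 := by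
  rw [TplusS, coeff_mk, if_pos rfl]

theorem commute_TminusS (α β : Lat M) (m n : ℕ) :
    Commute (coeff m (TminusS α)) (coeff n (TminusS β)) := by
  rw [TminusS, TminusS, coeff_mk, coeff_mk]
  split_ifs
  · exact Commute.zero_left _
  · exact Commute.zero_left _
  · exact Commute.zero_right _
  · exact ((heisS_commute_neg α β (by omega) (by omega)).smul_left _).smul_right _

theorem commute_TplusS (α β : Lat M) (m n : ℕ) :
    Commute (coeff m (TplusS α)) (coeff n (TplusS β)) := by
  rw [TplusS, TplusS, coeff_mk, coeff_mk]
  split_ifs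
  · exact Commute.zero_left _
  · exact Commute.zero_left _
  · exact Commute.zero_right _
  · exact (((heisS_commute_nonneg α β (by omega) (by omega)).smul_left _).smul_right
      _).neg_left.neg_right

theorem zcoeff_theta_TminusS (α : Lat M) (k : ℤ) :
    zcoeff k (theta (TminusS α)) = if 0 < k then heisS α (-k) else 0 := by
  rcases lt_or_ge k 0 with h | h
  · rw [zcoeff_of_neg h, if_neg (by omega)]
  · lift k to ℕ using h
    rw [zcoeff_natCast, coeff_theta, TminusS, coeff_mk]
    rcases Nat.eq_zero_or_pos k with h | h
    · simp [h]
    · have : (k : ℂ) ≠ 0 := by exact_mod_cast h.ne'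
      rw [if_neg h.ne', if_pos (by omega), smul_smul, mul_inv_cancel₀ this, one_smul]

theorem zcoeff_theta_TplusS (α : Lat M) (k : ℤ) :
    zcoeff k (theta (TplusS α)) = if 0 < k then -heisS α k else 0 := by
  rcases lt_or_ge k 0 with h | h
  · rw [zcoeff_of_neg h, if_neg (by omega)]
  · lift k to ℕ using h
    rw [zcoeff_natCast, coeff_theta, TplusS, coeff_mk]
    rcases Nat.eq_zero_or_pos k with h | h
    · simp [h]
    · have : (k : ℂ) ≠ 0 := by exact_mod_cast h.ne'
      rw [if_neg h.ne', if_pos (by omega), smul_neg, smul_smul, mul_inv_cancel₀ this, one_smul]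

theorem TminusS_add (α β : Lat M) : TminusS (α + β) = TminusS α + TminusS β := by
  ext1 n
  rw [map_add, TminusS, TminusS, TminusS, coeff_mk, coeff_mk, coeff_mk, heisS_add]
  split_ifs
  · simp
  · rw [smul_add]

theorem TplusS_add (α β : Lat M) : TplusS (α + β) = TplusS α + TplusS β := by
  ext1 n
  rw [map_add, TplusS, TplusS, TplusS, coeff_mk, coeff_mk, coeff_mk, heisS_add]
  split_ifs
  · simp
  · rw [smul_add, neg_add]

theorem expSeries_TminusS_mul (α β : Lat M) :
    expSeries (TminusS α) * expSeries (TminusS β) = expSeries (TminusS (α + β)) := by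
  rw [TminusS_add, expSeries_add (coeff_zero_TminusS α) (coeff_zero_TminusS β)
    (commute_TminusS α α) (commute_TminusS β β) (commute_TminusS α β)]

theorem expSeries_TplusS_mul (α β : Lat M) :
    expSeries (TplusS α) * expSeries (TplusS β) = expSeries (TplusS (α + β)) := by
  rw [TplusS_add, expSeries_add (coeff_zero_TplusS α) (coeff_zero_TplusS β)
    (commute_TplusS α α) (commute_TplusS β β) (commute_TplusS α β)]

theorem expSeries_zero {A : Type} [Ring A] [Algebra ℂ A] :
    expSeries (0 : PowerSeries A) = 1 := by
  refine eq_of_theta_eq (g := theta 0) (coeff_zero_theta _)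
    (theta_expSeries (map_zero _) fun m n => by simp) ?_ ?_
  · rw [← map_one (C (R := A)), theta_C, map_zero, zero_mul]
  · rw [coeff_expSeries, expCoeff_zero, coeff_zero_one]

theorem zcoeff_one {A : Type} [Ring A] [Algebra ℂ A] (k : ℤ) :
    zcoeff k (1 : PowerSeries A) = if k = 0 then 1 else 0 := by
  rcases lt_or_ge k 0 with h | h
  · rw [zcoeff_of_neg h, if_neg (by omega)]
  · lift k to ℕ using h
    rw [zcoeff_natCast, coeff_one]
    simp

theorem expMinus_zero_left (k : ℤ) :
    expMinus (0 : Lat M) k = if k = 0 then 1 else 0 := by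
  have : TminusS (0 : Lat M) = 0 := by
    ext1 n; simp [TminusS, heisS_zero]
  rw [expMinus, this, expSeries_zero, zcoeff_one]

theorem expPlus_zero_left (k : ℤ) :
    expPlus (0 : Lat M) k = if k = 0 then 1 else 0 := by
  have : TplusS (0 : Lat M) = 0 := by
    ext1 n; simp [TplusS, heisS_zero]
  rw [expPlus, this, expSeries_zero, zcoeff_one]

theorem expMinus_of_neg (α : Lat M) {k : ℤ} (h : k < 0) : expMinus α k = 0 := zcoeff_of_neg h _

theorem expPlus_of_neg (α : Lat M) {k : ℤ} (h : k < 0) : expPlus α k = 0 := zcoeff_of_neg h _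

theorem finSum_expMinus (α β : Lat M) (n : ℤ) :
    FinSum (fun x => expMinus α x * expMinus β (n - x)) (expMinus (α + β) n) := by
  rw [expMinus, ← expSeries_TminusS_mul]
  exact finSum_zcoeff_mul _ _ _

theorem finSum_expPlus (α β : Lat M) (n : ℤ) :
    FinSum (fun x => expPlus α x * expPlus β (n - x)) (expPlus (α + β) n) := by
  rw [expPlus, ← expSeries_TplusS_mul]
  exact finSum_zcoeff_mul _ _ _

/-- The coefficients of `(z d/dz exp T₋(α, z)) exp T₋(-α, z) = ∑_{k > 0} α(-k) z^k`. -/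
theorem finSum_smul_expMinus (α : Lat M) (n : ℤ) :
    FinSum (fun x : ℤ => (x : ℂ) • (expMinus α x * expMinus (-α) (n - x)))
      (if 0 < n then heisS α (-n) else 0) := by
  rw [← zcoeff_theta_TminusS]
  have h : theta (expSeries (TminusS α)) * expSeries (TminusS (-α)) = theta (TminusS α) := by
    rw [theta_expSeries (coeff_zero_TminusS α) (commute_TminusS α α), mul_assoc,
      expSeries_TminusS_mul, add_neg_cancel, show TminusS (0 : Lat M) = 0 by
        ext1 n; simp [TminusS, heisS_zero], expSeries_zero, mul_one]
  rw [← h]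
  exact (finSum_zcoeff_mul _ _ _).congr (fun x => by
    rw [zcoeff_theta, smul_mul_assoc]; rfl) rfl

theorem finSum_smul_expPlus (α : Lat M) (n : ℤ) :
    FinSum (fun x : ℤ => (x : ℂ) • (expPlus α x * expPlus (-α) (n - x)))
      (if 0 < n then -heisS α n else 0) := by
  rw [← zcoeff_theta_TplusS]
  have h : theta (expSeries (TplusS α)) * expSeries (TplusS (-α)) = theta (TplusS α) := by
    rw [theta_expSeries (coeff_zero_TplusS α) (commute_TplusS α α), mul_assoc,
      expSeries_TplusS_mul, add_neg_cancel, show TplusS (0 : Lat M) = 0 by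
        ext1 n; simp [TplusS, heisS_zero], expSeries_zero, mul_one]
  rw [← h]
  exact (finSum_zcoeff_mul _ _ _).congr (fun x => by
    rw [zcoeff_theta, smul_mul_assoc]; rfl) rfl

theorem commute_zcoeff_expSeries {A : Type} [Ring A] [Algebra ℂ A] {f g : PowerSeries A}
    (h : ∀ m n, Commute (coeff m f) (coeff n g)) (k l : ℤ) :
    Commute (zcoeff k (expSeries f)) (zcoeff l (expSeries g)) := by
  rw [zcoeff, zcoeff]
  split_ifs
  · rw [coeff_expSeries, coeff_expSeries]
    exact commute_expCoeff (fun n => (commute_expCoeff (fun m => (h m n).symm) _).symm) _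
  all_goals simp

theorem commute_expMinus (α β : Lat M) (k l : ℤ) : Commute (expMinus α k) (expMinus β l) :=
  commute_zcoeff_expSeries (commute_TminusS α β) k l

theorem commute_expPlus (α β : Lat M) (k l : ℤ) : Commute (expPlus α k) (expPlus β l) :=
  commute_zcoeff_expSeries (commute_TplusS α β) k l

theorem finSum_single_mul {A : Type} [Ring A] [Algebra ℂ A] (c : ℂ) (n : ℕ) (k : ℤ)
    (f : PowerSeries A) :
    zcoeff k ((mk fun m => algebraMap ℂ A (if m = n then c else 0)) * f) =
      c • zcoeff (k - n) f := by
  refine (finSum_zcoeff_mul _ _ _).unique ((finSum_single (n : ℤ) fun x hx => ?_).congr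
    (fun _ => rfl) ?_)
  · rcases lt_or_ge x 0 with h | h
    · rw [zcoeff_of_neg h, zero_mul]
    · lift x to ℕ using h
      rw [zcoeff_natCast, coeff_mk, if_neg (by exact_mod_cast hx), map_zero, zero_mul]
  · rw [zcoeff_natCast, coeff_mk, if_pos rfl, Algebra.algebraMap_eq_smul_one, smul_mul_assoc,
      one_mul]

/-- `[α(n), exp T₋(β, z)] = (α, β) z^n exp T₋(β, z)` for `n > 0`. -/
theorem heisS_mul_expMinus (α β : Lat M) {n : ℕ} (hn : n ≠ 0) (k : ℤ) :
    heisS α n * expMinus β k - expMinus β k * heisS α n =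
      (ip α β : ℂ) • expMinus β (k - n) := by
  have h := commutator_expSeries (x := heisS α n) (coeff_zero_TminusS β) (commute_TminusS β β)
    (fun m => if m = n then (ip α β : ℂ) else 0) fun m => by
      rw [TminusS, coeff_mk]
      rcases Nat.eq_zero_or_pos m with hm | hm
      · rw [if_pos hm, if_neg (by omega)]; simp
      · rw [if_neg hm.ne']
        refine (smul_commutator _ _ _).trans ?_
        rw [heisS_commutator _ _ (by omega) (by omega)]
        have hm' : (m : ℂ) ≠ 0 := by exact_mod_cast hm.ne'
        by_cases hmn : m = n
        · subst hmn
          rw [if_pos rfl, if_pos rfl, Algebra.smul_def, ← map_mul]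
          congr 1
          push_cast
          field_simp
        · rw [if_neg (by omega), if_neg hmn]; simp
  have h' := congrArg (zcoeff k) h
  rw [finSum_single_mul] at h'
  rw [expMinus, expMinus, ← h', ← zcoeff_C_mul, ← zcoeff_mul_C]
  simp only [zcoeff]
  split_ifs <;> simp

/-- `[β(-n), exp T₊(α, z)] = (α, β) z^{-n} exp T₊(α, z)` for `n > 0`. -/
theorem heisS_mul_expPlus (α β : Lat M) {n : ℕ} (hn : n ≠ 0) (k : ℤ) :
    heisS β (-n) * expPlus α k - expPlus α k * heisS β (-n) =
      (ip α β : ℂ) • expPlus α (k - n) := by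
  have h := commutator_expSeries (x := heisS β (-n)) (coeff_zero_TplusS α) (commute_TplusS α α)
    (fun m => if m = n then (ip α β : ℂ) else 0) fun m => by
      rw [TplusS, coeff_mk]
      rcases Nat.eq_zero_or_pos m with hm | hm
      · rw [if_pos hm, if_neg (by omega)]; simp
      · rw [if_neg hm.ne']
        refine (neg_commutator _ _).trans ?_
        rw [← neg_sub]
        refine (congrArg Neg.neg (smul_commutator _ _ _)).trans ?_
        rw [← smul_neg, neg_sub, heisS_commutator _ _ (by omega) (by omega)]
        have hm' : (m : ℂ) ≠ 0 := by exact_mod_cast hm.ne'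
        by_cases hmn : m = n
        · subst hmn
          rw [if_pos rfl, if_pos rfl, Algebra.smul_def, ← map_mul]
          congr 1
          push_cast
          field_simp
        · rw [if_neg (by omega), if_neg hmn]; simp
  have h' := congrArg (zcoeff k) h
  rw [finSum_single_mul] at h'
  rw [expPlus, expPlus, ← h', ← zcoeff_C_mul, ← zcoeff_mul_C]
  simp only [zcoeff]
  split_ifs <;> simp

/-- The vacuum is fixed by `exp T₊(α, z)`, since the derivations `α(n)` kill constants. -/
theorem expPlus_C (α : Lat M) {k : ℤ} (hk : k ≠ 0) (a : ℂ) :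
    expPlus α k (MvPolynomial.C a) = 0 := by
  have h : theta (expSeries (TplusS α)) = expSeries (TplusS α) * theta (TplusS α) := by
    rw [theta_expSeries (coeff_zero_TplusS α) (commute_TplusS α α)]
    refine (commute_expSeries fun m n => ?_).eq
    rw [coeff_theta]
    exact (commute_TplusS α α m n).smul_left _
  have h1 := (finSum_zcoeff_mul k (expSeries (TplusS α)) (theta (TplusS α))).apply
    (MvPolynomial.C a)
  rw [← h, zcoeff_theta] at h1
  have h2 : ((k : ℂ) • expPlus α k) (MvPolynomial.C a) = 0 := h1.unique
    (finSum_zero.congr (fun x => ?_) rfl)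
  · rw [LinearMap.smul_apply] at h2
    exact (smul_eq_zero.1 h2).resolve_left (Int.cast_ne_zero.2 hk)
  · rw [zcoeff_theta_TplusS, Module.End.mul_apply]
    split_ifs with hx
    · rw [LinearMap.neg_apply, heisS_apply_of_nonneg _ hx.le, heisD, MvPolynomial.derivation_C,
        neg_zero, map_zero]
    · simp

/-- The operators `exp T₊(α, z)` are polynomial in `z⁻¹` on each vector. -/
theorem expPlus_finite (α : Lat M) (u : SymH M) :
    (Function.support fun k : ℤ => expPlus α k u).Finite := by
  induction u using MvPolynomial.induction_on with
  | C a =>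
    refine (Set.finite_singleton 0).subset fun k hk => ?_
    by_contra h
    exact hk (expPlus_C α h a)
  | add p q hp hq =>
    simp only [map_add]
    exact (hp.union hq).subset (Function.support_add _ _)
  | mul_X p x hp =>
    obtain ⟨i, n, hn⟩ := x
    have hX : ∀ u : SymH M, u * MvPolynomial.X (i, ⟨n, hn⟩) = heisS (e i) (-(n.natAbs : ℤ)) u :=
      fun u => by
        have : -(n.natAbs : ℤ) = n := by omega
        simp only [this, heisS_of_neg _ hn, LinearMap.mulLeft_apply]
        rw [mul_comm, Finset.sum_eq_single i] <;> simp +contextual [e]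
    have key : ∀ k, expPlus α k (p * MvPolynomial.X (i, ⟨n, hn⟩)) =
        heisS (e i) (-(n.natAbs : ℤ)) (expPlus α k p) -
          (ip α (e i) : ℂ) • expPlus α (k - n.natAbs) p := fun k => by
      have := congrArg (fun T : Module.End ℂ (SymH M) => T p)
        (heisS_mul_expPlus α (e i) (n := n.natAbs) (by omega) k)
      simp only [LinearMap.sub_apply, Module.End.mul_apply, LinearMap.smul_apply] at this
      rw [hX, ← this, sub_sub_cancel]
    have hfin : FinSum (fun k : ℤ => expPlus α k p) _ := finSum_of_finite hp
    simp only [key]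
    exact ((hfin.map (heisS (e i) (-(n.natAbs : ℤ)))).sub
      ((hfin.equiv (Equiv.subRight (n.natAbs : ℤ))).smul (ip α (e i) : ℂ))).1

theorem expPlus_finite₂ (α β : Lat M) (u : SymH M) :
    (Function.support fun p : ℤ × ℤ => expPlus α p.1 (expPlus β p.2 u)).Finite := by
  refine ((expPlus_finite β u).biUnion fun b _ =>
    (expPlus_finite α (expPlus β b u)).image fun a => (a, b)).subset fun p hp => ?_
  refine Set.mem_biUnion (x := p.2) (fun h => hp ?_) ⟨p.1, hp, rfl⟩
  have h : expPlus β p.2 u = 0 := h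
  change expPlus α p.1 (expPlus β p.2 u) = 0
  rw [h, map_zero]

/-- If the `c_j` are the coefficients of `(1 - x)^{(α, β)}`, then they are the structure constants
for moving `exp T₊(α, z)` past `exp T₋(β, w)`. -/
theorem finSum_expPlus_mul_expMinus (α β : Lat M) (c : ℕ → ℂ) (c0 : c 0 = 1)
    (hc : ∀ k : ℕ, (k : ℂ) * c k = -((ip α β : ℂ) * ∑ j ∈ Finset.range k, c j)) (a b : ℤ) :
    FinSum (fun j : ℤ => (if 0 ≤ j then c j.toNat else 0) •
      (expMinus β (a - j) * expPlus α (b - j))) (expPlus α b * expMinus β a) := by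
  have h := expSeries_mul_shift (coeff_zero_TplusS α) (commute_TplusS α α) (expMinus β)
    (ip α β : ℂ) (fun a n hn => by
      rw [← coeff_theta, ← zcoeff_natCast, zcoeff_theta_TplusS, if_pos (by omega)]
      exact (neg_commutator _ _).trans (heisS_mul_expMinus α β hn a)) c c0 hc a
  rw [expPlus, ← zcoeff_mul_C, h]
  refine (finSum_zcoeff_mul _ _ _).congr (fun j => ?_) rfl
  rw [zcoeff]
  split_ifs with hj
  · rw [coeff_mk, smul_mul_assoc, Int.toNat_of_nonneg hj]; rfl
  · simp

end Exponentials

/-! ### Products of the modes of vertex operators on the symmetric algebra -/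

section Modes

variable {M : ℕ}

/-- The coefficient of `z^k` in `exp T₋(α, z) exp T₊(α, z)`, acting on the symmetric algebra. -/
def vop (α : Lat M) (k : ℤ) : Module.End ℂ (SymH M) :=
  locSum fun b : ℤ => expMinus α (k + b) * expPlus α b

theorem finSum_vop (α : Lat M) (k : ℤ) (u : SymH M) :
    FinSum (fun b : ℤ => expMinus α (k + b) (expPlus α b u)) (vop α k u) := by
  have h : LocFinite fun b : ℤ => expMinus α (k + b) * expPlus α b := fun u =>
    (expPlus_finite α u).subset fun b hb h => hb (by
      simp only [Module.End.mul_apply, show expPlus α b u = 0 from h, map_zero])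
  exact h.finSum u

/-- The modes of `α` of high degree kill a given vector. -/
theorem exists_vop_eq_zero (α : Lat M) (u : SymH M) : ∃ K : ℤ, ∀ k < K, vop α k u = 0 := by
  obtain ⟨B, hB⟩ := (expPlus_finite α u).bddAbove
  refine ⟨-B, fun k hk => (finSum_vop α k u).unique (finSum_zero.congr (fun b => ?_) rfl)⟩
  by_cases hb : expPlus α b u = 0
  · rw [hb, map_zero]
  · have : b ≤ B := hB hb
    rw [expMinus_of_neg _ (by omega), LinearMap.zero_apply]

theorem vop_zero_left (k : ℤ) (u : SymH M) :
    vop (0 : Lat M) k u = if k = 0 then u else 0 := by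
  refine (finSum_vop _ k u).unique ((finSum_single 0 fun b hb => ?_).congr (fun _ => rfl) ?_)
  · rw [expPlus_zero_left, if_neg hb]; simp
  · rw [expPlus_zero_left, if_pos rfl, add_zero, expMinus_zero_left]
    split_ifs <;> simp

/-- The product of the modes of `α` and `β` brought to the order in which all annihilators stand to
the right. Here `c` stands for the coefficients of `(1 - x)^{(α, β)}`. -/
theorem finSum_vop_vop (α β : Lat M) (c : ℕ → ℂ) (c0 : c 0 = 1)
    (hc : ∀ k : ℕ, (k : ℂ) * c k = -((ip α β : ℂ) * ∑ j ∈ Finset.range k, c j))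
    {R : ℤ → ℤ → Module.End ℂ (SymH M)}
    (hR : ∀ k l, FinSum (fun j : ℤ => (if 0 ≤ j then c j.toNat else 0) •
      (expMinus α (k + j) * expMinus β (l - j))) (R k l)) (k l : ℤ) (u : SymH M) :
    FinSum (fun p : ℤ × ℤ => R (k + p.1) (l + p.2) (expPlus α p.1 (expPlus β p.2 u)))
      (vop α k (vop β l u)) := by
  -- one mode of `α` against one coefficient of `exp T₋(β, w)`
  have step : ∀ (l : ℤ) (x : SymH M), FinSum (fun a : ℤ => R (k + a) l (expPlus α a x))
      (vop α k (expMinus β l x)) := fun l x => by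
    set f : ℤ × ℤ → SymH M := fun p => (if 0 ≤ p.2 then c p.2.toNat else 0 : ℂ) •
      expMinus α (k + p.1 + p.2) (expMinus β (l - p.2) (expPlus α p.1 x)) with hf
    obtain ⟨y, hy, hy'⟩ := exists_finSum_prod (s := Function.support fun a => expPlus α a x)
      (f := f) (g := fun a => R (k + a) l (expPlus α a x)) (expPlus_finite α x)
      (fun a ha b => by
        simp only [hf, show expPlus α a x = 0 by simpa using ha, map_zero, smul_zero])
      (fun a => ((hR (k + a) l).apply (expPlus α a x)).congr (fun j => by
        rw [LinearMap.smul_apply, Module.End.mul_apply]) rfl)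
    -- moving `exp T₊` of degree `a` past `exp T₋` lowers its degree to `a - j`
    let ε : ℤ × ℤ ≃ ℤ × ℤ :=
      { toFun := fun p => (p.1 - p.2, p.2)
        invFun := fun p => (p.1 + p.2, p.2)
        left_inv := fun p => by simp
        right_inv := fun p => by simp }
    have h1 : ∀ a, FinSum (fun j => f (ε (a, j)))
        (expMinus α (k + a) (expPlus α a (expMinus β l x))) := fun a => by
      have := ((finSum_expPlus_mul_expMinus α β c c0 hc l a).apply x).map (expMinus α (k + a))
      refine this.congr (fun j => ?_) rfl
      rw [LinearMap.smul_apply, map_smul]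
      simp only [ε, hf, Equiv.coe_fn_mk]
      rw [show k + (a - j) + j = k + a by ring]
      rfl
    have h2 := (hy.equiv ε).fiberwise h1
    rwa [h2.unique (finSum_vop α k _)] at hy'
  obtain ⟨y, hy, hy'⟩ := exists_finSum_prod (s := Function.support fun b => expPlus β b u)
    (f := fun p : ℤ × ℤ => R (k + p.2) (l + p.1) (expPlus α p.2 (expPlus β p.1 u)))
    (g := fun b => vop α k (expMinus β (l + b) (expPlus β b u))) (expPlus_finite β u)
    (fun b hb a => by rw [show expPlus β b u = 0 by simpa using hb, map_zero, map_zero])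
    (fun b => step (l + b) (expPlus β b u))
  rw [hy'.unique ((finSum_vop β l u).map (vop α k))] at hy
  exact hy.equiv (Equiv.prodComm ℤ ℤ)

/-- A sum over the degrees in `exp T₊(α, z)` and `exp T₊(β, z)` that only depends on the total degree
is a sum over the degree in `exp T₊(α + β, z)`. -/
theorem finSum_expPlus_collapse (α β : Lat M) (G : ℤ → Module.End ℂ (SymH M)) (u : SymH M)
    {y : SymH M} (h : FinSum (fun c => G c (expPlus (α + β) c u)) y) :
    FinSum (fun p : ℤ × ℤ => G (p.1 + p.2) (expPlus α p.1 (expPlus β p.2 u))) y := by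
  have hf := finSum_of_finite (f := fun p : ℤ × ℤ =>
    G (p.1 + p.2) (expPlus α p.1 (expPlus β p.2 u)))
    ((expPlus_finite₂ α β u).subset fun p hp h => hp (by
      simp only [show expPlus α p.1 (expPlus β p.2 u) = 0 from h, map_zero]))
  let ε : ℤ × ℤ ≃ ℤ × ℤ :=
    { toFun := fun p => (p.2, p.1 - p.2)
      invFun := fun p => (p.1 + p.2, p.1)
      left_inv := fun p => by simp
      right_inv := fun p => by simp }
  have h2 := (hf.equiv ε).fiberwise (g := fun c => G c (expPlus (α + β) c u)) fun c =>
    (((finSum_expPlus α β c).apply u).map (G c)).congr (fun a => by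
      simp only [ε, Equiv.coe_fn_mk, Module.End.mul_apply, add_sub_cancel]) rfl
  rwa [h2.unique h] at hf

theorem finSum_swap_expPlus {α β : Lat M} {f : ℤ → ℤ → Module.End ℂ (SymH M)} {u y : SymH M}
    (h : FinSum (fun p : ℤ × ℤ => f p.1 p.2 (expPlus β p.1 (expPlus α p.2 u))) y) :
    FinSum (fun p : ℤ × ℤ => f p.2 p.1 (expPlus α p.1 (expPlus β p.2 u))) y :=
  (h.equiv (Equiv.prodComm ℤ ℤ)).congr (fun p => by
    have := congrArg (fun T : Module.End ℂ (SymH M) => T u) (commute_expPlus β α p.2 p.1).eq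
    simp only [Module.End.mul_apply] at this
    simp [this]) rfl

/-- The reordering factor for `(α, β) = 0` is `(1 - x)^0 = 1`. -/
theorem finSum_reorder_zero (α β : Lat M) (k l : ℤ) :
    FinSum (fun j : ℤ => (if 0 ≤ j then (if j.toNat = 0 then (1 : ℂ) else 0) else 0) •
      (expMinus α (k + j) * expMinus β (l - j))) (expMinus α k * expMinus β l) := by
  refine (finSum_single 0 fun j hj => ?_).congr (fun _ => rfl) (by simp)
  rcases lt_or_ge j 0 with h | h
  · rw [if_neg (by omega), zero_smul]
  · rw [if_pos h, if_neg (by omega), zero_smul]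

theorem finSum_vop_vop_of_ip_eq_zero {α β : Lat M} (h : ip α β = 0) (k l : ℤ) (u : SymH M) :
    FinSum (fun p : ℤ × ℤ => (expMinus α (k + p.1) * expMinus β (l + p.2))
      (expPlus α p.1 (expPlus β p.2 u))) (vop α k (vop β l u)) :=
  finSum_vop_vop α β (fun j => if j = 0 then 1 else 0) rfl (fun k => by simp [h])
    (finSum_reorder_zero α β) k l u

theorem vop_comm_of_ip_eq_zero {α β : Lat M} (h : ip α β = 0) (k l : ℤ) (u : SymH M) :
    vop α k (vop β l u) = vop β l (vop α k u) := by
  refine (finSum_vop_vop_of_ip_eq_zero h k l u).unique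
    ((finSum_swap_expPlus (f := fun a b => expMinus β (l + a) * expMinus α (k + b))
      (finSum_vop_vop_of_ip_eq_zero (by rw [ip_comm, h]) l k u)).congr (fun p => ?_) rfl)
  rw [(commute_expMinus β α _ _).eq]

/-- If `(α, β) = 0`, then `Y(α + β, z)` is up to the cocycle the product of `Y(α, z)` and
`Y(β, z)`. -/
theorem finSum_vop_add {α β : Lat M} (h : ip α β = 0) (n : ℤ) (u : SymH M) :
    FinSum (fun k : ℤ => vop α k (vop β (n - k) u)) (vop (α + β) n u) := by
  refine FinSum.swap (expPlus_finite₂ α β u)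
    (f := fun (p : ℤ × ℤ) k => (expMinus α (k + p.1) * expMinus β (n - k + p.2))
      (expPlus α p.1 (expPlus β p.2 u)))
    (g := fun p => expMinus (α + β) (n + (p.1 + p.2)) (expPlus α p.1 (expPlus β p.2 u)))
    (fun p hp k => ?_) (fun p => ?_) (fun k => finSum_vop_vop_of_ip_eq_zero h k (n - k) u)
    (finSum_expPlus_collapse α β (fun c => expMinus (α + β) (n + c)) u (finSum_vop _ n u))
  · rw [show expPlus α p.1 (expPlus β p.2 u) = 0 by simpa using hp, map_zero]
  · refine (((finSum_expMinus α β (n + (p.1 + p.2))).apply _).equiv (Equiv.addRight p.1)).congr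
      (fun k => ?_) rfl
    rw [Equiv.coe_addRight, show n + (p.1 + p.2) - (k + p.1) = n - k + p.2 by ring]

/-- The reordering factor for `(α, β) = 1` is `1 - x`. -/
theorem finSum_vop_vop_of_ip_eq_one {α β : Lat M} (h : ip α β = 1) (k l : ℤ) (u : SymH M) :
    FinSum (fun p : ℤ × ℤ => (expMinus α (k + p.1) * expMinus β (l + p.2) -
      expMinus α (k + p.1 + 1) * expMinus β (l + p.2 - 1))
      (expPlus α p.1 (expPlus β p.2 u))) (vop α k (vop β l u)) := by
  refine finSum_vop_vop α β (fun j => if j = 0 then 1 else if j = 1 then -1 else 0) rfl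
    (fun k => ?_) (R := fun k l => expMinus α k * expMinus β l -
      expMinus α (k + 1) * expMinus β (l - 1)) (fun k l => ?_) k l u
  · rcases k with _ | _ | k
    · simp
    · simp [h]
    · rw [Finset.sum_range_succ', Finset.sum_range_succ']
      simp
  · refine (finSum_finset {0, 1} fun j hj => ?_).congr (fun _ => rfl) ?_
    · simp only [Finset.mem_insert, Finset.mem_singleton, not_or] at hj
      rcases lt_or_ge j 0 with h | h
      · rw [if_neg (by omega), zero_smul]
      · rw [if_pos h, if_neg (by omega), if_neg (by omega), zero_smul]
    · rw [Finset.sum_pair (by omega)]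
      simp [sub_eq_add_neg]
      refine LinearMap.ext fun x => ?_
      simp

/-- The modes of `α` anticommute with each other: in `Y(α, z) Y(α, w)` the factor `z - w` is
antisymmetric, and the remaining factors are symmetric. -/
theorem vop_anticomm_self {α : Lat M} (h : ip α α = 1) (k l : ℤ) (u : SymH M) :
    vop α (k - 1) (vop α l u) + vop α (l - 1) (vop α k u) = 0 := by
  refine ((finSum_vop_vop_of_ip_eq_one h (k - 1) l u).add
    (finSum_swap_expPlus (f := fun a b => expMinus α (l - 1 + a) * expMinus α (k + b) -
      expMinus α (l - 1 + a + 1) * expMinus α (k + b - 1))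
    (finSum_vop_vop_of_ip_eq_one h (l - 1) k u))).unique (finSum_zero.congr (fun p => ?_) rfl)
  rw [← LinearMap.add_apply, (commute_expMinus α α (l - 1 + p.2) (k + p.1)).eq,
    (commute_expMinus α α (l - 1 + p.2 + 1) (k + p.1 - 1)).eq,
    show k - 1 + p.1 = k + p.1 - 1 by ring, show l - 1 + p.2 = l + p.2 - 1 by ring,
    sub_add_cancel, sub_add_cancel, sub_add_sub_cancel, sub_self, LinearMap.zero_apply]

/-- The sum `∑_{j ≥ 0} Q_{k+j}(α) Q_{l-j}(β)` for `Q = exp T₋`, where the reordering factor is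
`(1 - x)⁻¹ = ∑_{j ≥ 0} x^j`. -/
def halfConv (α β : Lat M) (k l : ℤ) : Module.End ℂ (SymH M) :=
  ∑ᶠ j : ℤ, (if 0 ≤ j then (1 : ℂ) else 0) • (expMinus α (k + j) * expMinus β (l - j))

theorem finSum_halfConv (α β : Lat M) (k l : ℤ) :
    FinSum (fun j : ℤ => (if 0 ≤ j then (1 : ℂ) else 0) •
      (expMinus α (k + j) * expMinus β (l - j))) (halfConv α β k l) := by
  refine finSum_of_finite ((Set.finite_Icc 0 l).subset fun j hj => ?_)
  by_contra hn
  refine hj ?_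
  rw [Set.mem_Icc, not_and_or] at hn
  rcases hn with hn | hn
  · simp only [if_neg hn, zero_smul]
  · simp only [expMinus_of_neg β (show l - j < 0 by omega), mul_zero, smul_zero]

/-- The half-convolution with the roles of `α` and `β` exchanged supplies the terms with `j < 0`. -/
theorem finSum_halfConv_symm (α β : Lat M) (k l : ℤ) :
    FinSum (fun j : ℤ => (if j < 0 then (1 : ℂ) else 0) •
      (expMinus α (k + 1 + j) * expMinus β (l - j))) (halfConv β α (l + 1) k) := by
  refine ((finSum_halfConv β α (l + 1) k).equiv (Equiv.subLeft (-1))).congr (fun j => ?_) rfl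
  rw [Equiv.subLeft_apply, (commute_expMinus β α _ _).eq,
    show k - (-1 - j) = k + 1 + j by ring, show l + 1 + (-1 - j) = l - j by ring]
  congr 1
  split_ifs <;> first | rfl | omega

theorem halfConv_add (α β : Lat M) (k l : ℤ) :
    halfConv α β (k + 1) l + halfConv β α (l + 1) k = expMinus (α + β) (k + l + 1) := by
  refine ((finSum_halfConv α β (k + 1) l).add (finSum_halfConv_symm α β k l)).unique
    (((finSum_expMinus α β (k + l + 1)).equiv (Equiv.addLeft (k + 1))).congr (fun j => ?_) rfl)
  rw [Equiv.coe_addLeft, show k + l + 1 - (k + 1 + j) = l - j by ring, ← add_smul]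
  rcases lt_or_ge j 0 with h | h
  · rw [if_neg (by omega), if_pos h, zero_add, one_smul]
  · rw [if_pos h, if_neg (by omega), add_zero, one_smul]

theorem finSum_vop_vop_of_ip_eq_neg_one {α β : Lat M} (h : ip α β = -1) (k l : ℤ) (u : SymH M) :
    FinSum (fun p : ℤ × ℤ => halfConv α β (k + p.1) (l + p.2)
      (expPlus α p.1 (expPlus β p.2 u))) (vop α k (vop β l u)) :=
  finSum_vop_vop α β (fun _ => 1) rfl (fun k => by simp [h]) (finSum_halfConv α β) k l u

/-- For `(α, β) = -1`, the expansions of `(z - w)⁻¹` in the two regions add up to the delta function,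
so that the anticommutator of the modes of `α` and `β` is a mode of `α + β`. -/
theorem vop_anticomm_of_ip_eq_neg_one {α β : Lat M} (h : ip α β = -1) (k l : ℤ) (u : SymH M) :
    vop α (k + 1) (vop β l u) + vop β (l + 1) (vop α k u) = vop (α + β) (k + l + 1) u := by
  refine ((finSum_vop_vop_of_ip_eq_neg_one h (k + 1) l u).add
    (finSum_swap_expPlus (f := fun a b => halfConv β α (l + 1 + a) (k + b))
    (finSum_vop_vop_of_ip_eq_neg_one (by rw [ip_comm, h]) (l + 1) k u))).unique
    ((finSum_expPlus_collapse α β (fun c => expMinus (α + β) (k + l + 1 + c)) u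
      (finSum_vop _ _ u)).congr (fun p => ?_) rfl)
  rw [← LinearMap.add_apply, show k + 1 + p.1 = k + p.1 + 1 by ring,
    show l + 1 + p.2 = l + p.2 + 1 by ring, halfConv_add]
  congr 2
  ring

theorem vop_anticomm_neg {α : Lat M} (h : ip α α = 1) (k l : ℤ) (u : SymH M) :
    vop α (k + 1) (vop (-α) l u) + vop (-α) (l + 1) (vop α k u) =
      if k + l + 1 = 0 then u else 0 := by
  rw [vop_anticomm_of_ip_eq_neg_one (by rw [ip_neg_right, h]), add_neg_cancel, vop_zero_left]

/-- The `r`-th normally ordered product, after the creation parts have been separated: it weighs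
the terms of the convolution `exp T₋(α, z) exp T₋(-α, z)` with `[r ≤ 0][j ≥ 0] - [r > 0][j < 0]`.
Summing over `r` with `t = j - r` fixed leaves the weight `t + 1`, hence a derivative of `exp T₋`. -/
theorem finSum_halfConv_normal (α : Lat M) (g m : ℤ) (a b : ℤ) :
    FinSum (fun r : ℤ => if r ≤ 0 then halfConv α (-α) (1 - g - r + a) (r + g - m - 1 + b)
        else -halfConv (-α) α (r + g - m + b) (-g - r + a))
      ((if 0 < a + b - m then heisS α (-(a + b - m)) else 0) +
        ((g - a : ℤ) : ℂ) • if a + b - m = 0 then (1 : Module.End ℂ (SymH M)) else 0) := by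
  have h1 := finSum_smul_expMinus α (a + b - m)
  have h2 := (finSum_expMinus α (-α) (a + b - m)).smul ((g - a : ℤ) : ℂ)
  rw [add_neg_cancel, expMinus_zero_left] at h2
  have h3 := ((h1.add h2).equiv (Equiv.addRight (1 - g + a))).congr
    (g := fun t : ℤ => ((t + 1 : ℤ) : ℂ) •
      (expMinus α (1 - g + a + t) * expMinus (-α) (g - m - 1 + b - t)))
    (fun t => by
      simp only [Equiv.coe_addRight]
      rw [← add_smul, show a + b - m - (t + (1 - g + a)) = g - m - 1 + b - t by ring,
        show t + (1 - g + a) = 1 - g + a + t by ring]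
      congr 1
      push_cast
      ring) rfl
  have hfin := ((finSum_expMinus α (-α) (a + b - m)).equiv (Equiv.addRight (1 - g + a))).1
  refine FinSum.swap hfin (f := fun t r =>
    ((if r ≤ 0 then (1 : ℂ) else 0) - if r + (t + 1) ≤ 0 then 1 else 0) •
      (expMinus α (1 - g + a + t) * expMinus (-α) (g - m - 1 + b - t)))
    (fun t ht r => ?_) (fun t => (finSum_step_sub_step (t + 1)).smul_const _) (fun r => ?_) h3
  · rw [Function.mem_support, not_not] at ht
    simp only [Equiv.coe_addRight] at ht
    rw [show a + b - m - (t + (1 - g + a)) = g - m - 1 + b - t by ring,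
      show t + (1 - g + a) = 1 - g + a + t by ring] at ht
    rw [ht, smul_zero]
  · rcases le_or_gt r 0 with hr | hr
    · rw [if_pos hr]
      have h4 : FinSum (fun t : ℤ => (if 0 ≤ r + t then (1 : ℂ) else 0) •
          (expMinus α (1 - g - r + a + (r + t)) *
            expMinus (-α) (r + g - m - 1 + b - (r + t)))) _ :=
        (finSum_halfConv α (-α) (1 - g - r + a) (r + g - m - 1 + b)).equiv (Equiv.addLeft r)
      refine h4.congr (fun t => ?_) (if_pos hr).symm
      rw [show 1 - g - r + a + (r + t) = 1 - g + a + t by ring,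
        show r + g - m - 1 + b - (r + t) = g - m - 1 + b - t by ring]
      congr 1
      split_ifs <;> first | omega | simp
    · rw [if_neg (by omega)]
      have h4 : FinSum (fun t : ℤ => (if r + t < 0 then (1 : ℂ) else 0) •
          (expMinus α (-g - r + a + 1 + (r + t)) *
            expMinus (-α) (r + g - m - 1 + b - (r + t)))) _ :=
        (finSum_halfConv_symm α (-α) (-g - r + a) (r + g - m - 1 + b)).equiv (Equiv.addLeft r)
      refine h4.neg.congr (fun t => ?_) (by
          rw [if_neg (by omega), show r + g - m - 1 + b + 1 = r + g - m + b by ring])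
      rw [show -g - r + a + 1 + (r + t) = 1 - g + a + t by ring,
        show r + g - m - 1 + b - (r + t) = g - m - 1 + b - t by ring]
      refine (neg_smul _ _).symm.trans ?_
      congr 1
      split_ifs <;> first | omega | simp

/-- Bosonization: the current `α(z)` is the normally ordered product of `Y(α, z)` and `Y(-α, z)`.
The number `g` is the eigenvalue of `α(0)`. -/
theorem finSum_vop_normal {α : Lat M} (h : ip α α = 1) (g m : ℤ) (u : SymH M) :
    FinSum (fun r : ℤ => if r ≤ 0 then vop α (1 - g - r) (vop (-α) (r + g - m - 1) u)
        else -vop (-α) (r + g - m) (vop α (-g - r) u))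
      (if m = 0 then (g : ℂ) • u else heisS α m u) := by
  have hneg : ip α (-α) = -1 := by rw [ip_neg_right, h]
  have hneg' : ip (-α) α = -1 := by rw [ip_neg_left, h]
  set δ : ℤ → Module.End ℂ (SymH M) := fun c => if c - m = 0 then 1 else 0 with hδ
  refine FinSum.swap (expPlus_finite₂ α (-α) u) (f := fun (p : ℤ × ℤ) r =>
      (if r ≤ 0 then halfConv α (-α) (1 - g - r + p.1) (r + g - m - 1 + p.2)
        else -halfConv (-α) α (r + g - m + p.2) (-g - r + p.1))
      (expPlus α p.1 (expPlus (-α) p.2 u)))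
    (fun p hp r => ?_) (fun p => (finSum_halfConv_normal α g m p.1 p.2).apply _) (fun r => ?_) ?_
  · rw [show expPlus α p.1 (expPlus (-α) p.2 u) = 0 by simpa using hp, map_zero]
  · rcases le_or_gt r 0 with hr | hr
    · simp only [if_pos hr]
      exact finSum_vop_vop_of_ip_eq_neg_one hneg _ _ u
    · simp only [if_neg (not_le.2 hr), LinearMap.neg_apply]
      exact (finSum_swap_expPlus (f := fun a b => halfConv (-α) α (r + g - m + a) (-g - r + b))
        (finSum_vop_vop_of_ip_eq_neg_one hneg' _ _ u)).neg
  · -- the creation part, the part from `α(0)`, and the annihilation part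
    have s1 := finSum_expPlus_collapse α (-α)
      (fun c => if 0 < c - m then heisS α (-(c - m)) else 0) u (finSum_single 0 fun c hc => by
        rw [add_neg_cancel, expPlus_zero_left, if_neg hc, LinearMap.zero_apply, map_zero])
    have s2 := (finSum_expPlus_collapse α (-α) δ u (finSum_single 0 fun c hc => by
        rw [add_neg_cancel, expPlus_zero_left, if_neg hc, LinearMap.zero_apply, map_zero])).smul
          (g : ℂ)
    have s3 : FinSum (fun p : ℤ × ℤ => (p.1 : ℂ) • δ (p.1 + p.2) (expPlus α p.1
        (expPlus (-α) p.2 u))) ((if 0 < m then -heisS α m else 0 : Module.End ℂ (SymH M)) u) := by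
      have hf := finSum_of_finite (f := fun p : ℤ × ℤ => (p.1 : ℂ) • δ (p.1 + p.2)
        (expPlus α p.1 (expPlus (-α) p.2 u)))
        ((expPlus_finite₂ α (-α) u).subset fun p hp h => hp (by
          simp only [show expPlus α p.1 (expPlus (-α) p.2 u) = 0 from h, map_zero, smul_zero]))
      rw [← (hf.fiberwise fun a => finSum_single (m - a) fun b hb => by
        rw [hδ]; dsimp only; rw [if_neg (by omega), LinearMap.zero_apply, smul_zero]).unique
          (((finSum_smul_expPlus α m).apply u).congr (fun a => by
            simp [hδ]) rfl)]
      exact hf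
    refine ((s1.add s2).sub s3).congr (fun p => ?_) ?_
    · simp only [hδ, LinearMap.add_apply, LinearMap.smul_apply]
      push_cast
      rw [sub_smul, add_sub_assoc]
    · rw [add_neg_cancel, expPlus_zero_left, if_pos rfl]
      rcases lt_trichotomy m 0 with hm | hm | hm
      · simp [hδ, hm.ne, hm, hm.not_gt]
      · simp [hδ, hm]
      · simp [hδ, hm.ne', hm, hm.not_gt]

end Modes

/-! ### The cocycle -/

section Cocycle

variable {M : ℕ}

theorem F_add_left (α β γ : Lat M) : F (α + β) γ = F α γ * F β γ := by
  simp only [F, Pi.add_apply, add_mul, zpow_add, Finset.prod_mul_distrib]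

theorem F_add_right (α β γ : Lat M) : F γ (α + β) = F γ α * F γ β := by
  simp only [F, Pi.add_apply, mul_add, zpow_add, Finset.prod_mul_distrib]

theorem F_neg_left (α β : Lat M) : F (-α) β = F α β := by
  have h : F (-α) β * F α β = 1 := by rw [← F_add_left, neg_add_cancel]; simp [F]
  rw [mul_eq_one_iff_eq_inv.1 h, Int.units_inv_eq_self]

theorem F_neg_right (α β : Lat M) : F α (-β) = F α β := by
  have h : F α (-β) * F α β = 1 := by rw [← F_add_right, neg_add_cancel]; simp [F]
  rw [mul_eq_one_iff_eq_inv.1 h, Int.units_inv_eq_self]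

theorem F_e_e (i j : Fin M) : F (e i) (e j) = if i ≤ j then 1 else -1 := by
  rw [F, Finset.prod_eq_single i, Finset.prod_eq_single j]
  · simp [e]
  · intro l _ hl; simp [e, hl]
  · simp
  · intro k _ hk
    exact Finset.prod_eq_one fun l _ => by simp [e, hk]
  · simp

theorem Fc_add_left (α β γ : Lat M) : Fc (α + β) γ = Fc α γ * Fc β γ := by
  simp [Fc, F_add_left]

theorem Fc_add_right (α β γ : Lat M) : Fc γ (α + β) = Fc γ α * Fc γ β := by
  simp [Fc, F_add_right]

theorem Fc_neg_left (α β : Lat M) : Fc (-α) β = Fc α β := by rw [Fc, F_neg_left, Fc]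

theorem Fc_neg_right (α β : Lat M) : Fc α (-β) = Fc α β := by rw [Fc, F_neg_right, Fc]

theorem Fc_sub_left (α β γ : Lat M) : Fc (α - β) γ = Fc α γ * Fc β γ := by
  rw [sub_eq_add_neg, Fc_add_left, Fc_neg_left]

theorem Fc_sub_right (α β γ : Lat M) : Fc γ (α - β) = Fc γ α * Fc γ β := by
  rw [sub_eq_add_neg, Fc_add_right, Fc_neg_right]

theorem Fc_mul_self (α β : Lat M) : Fc α β * Fc α β = 1 := by
  rcases Int.units_eq_one_or (F α β) with h | h <;> simp [Fc, h]

theorem Fc_e_e (i j : Fin M) : Fc (e i) (e j) = if i ≤ j then 1 else -1 := by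
  rw [Fc, F_e_e]
  split_ifs <;> simp

theorem Fc_e_self (i : Fin M) : Fc (e i) (e i) = 1 := by simp [Fc_e_e]

theorem Fc_e_symm {i j : Fin M} (h : i ≠ j) : Fc (e j) (e i) = -Fc (e i) (e j) := by
  rw [Fc_e_e, Fc_e_e]
  rcases lt_or_gt_of_ne h with h | h
  · simp [h.le, h.not_ge]
  · simp [h.le, h.not_ge]

end Cocycle

/-! ### Vertex operators on the lattice space -/

section Vertex

variable {M : ℕ}

/-- Operators on the symmetric algebra act on `V[Γ]` through the second factor. -/
def liftVG : Module.End ℂ (SymH M) →ₐ[ℂ] Module.End ℂ (VG M) where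
  toFun f := Finsupp.mapRange.linearMap f
  map_one' := by refine Finsupp.lhom_ext fun γ u => ?_; simp
  map_mul' f g := by refine Finsupp.lhom_ext fun γ u => ?_; simp
  map_zero' := by refine Finsupp.lhom_ext fun γ u => ?_; simp
  map_add' f g := by refine Finsupp.lhom_ext fun γ u => ?_; simp
  commutes' c := by
    refine Finsupp.lhom_ext fun γ u => ?_
    simp [Module.algebraMap_end_apply]

theorem liftVG_single (f : Module.End ℂ (SymH M)) (γ : Lat M) (u : SymH M) :
    liftVG f (Finsupp.single γ u) = Finsupp.single γ (f u) :=
  Finsupp.mapRange_single (hf := map_zero f)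

theorem heis_single (α : Lat M) (m : ℤ) (γ : Lat M) (u : SymH M) :
    heis α m (Finsupp.single γ u) =
      Finsupp.single γ (if m = 0 then (ip α γ : ℂ) • u else heisS α m u) := by
  rw [heis, Finsupp.lsum_single]
  split_ifs <;> simp

theorem heis_of_ne_zero (α : Lat M) {m : ℤ} (h : m ≠ 0) : heis α m = liftVG (heisS α m) := by
  refine Finsupp.lhom_ext fun γ u => ?_
  rw [heis_single, liftVG_single, if_neg h]

theorem Tminus_eq_map (α : Lat M) :
    Tminus α = PowerSeries.map liftVG.toRingHom (TminusS α) := by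
  ext1 n
  rw [PowerSeries.coeff_map, Tminus, TminusS, PowerSeries.coeff_mk, PowerSeries.coeff_mk]
  split_ifs with h
  · exact (map_zero _).symm
  · rw [heis_of_ne_zero _ (by omega)]
    exact (map_smul liftVG _ _).symm

theorem Tplus_eq_map (α : Lat M) :
    Tplus α = PowerSeries.map liftVG.toRingHom (TplusS α) := by
  ext1 n
  rw [PowerSeries.coeff_map, Tplus, TplusS, PowerSeries.coeff_mk, PowerSeries.coeff_mk]
  split_ifs with h
  · exact (map_zero _).symm
  · rw [heis_of_ne_zero _ (by omega)]
    exact ((map_neg liftVG _).trans (congrArg _ (map_smul liftVG _ _))).symm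

theorem vertexTerm_single (α : Lat M) (p : ℤ) (ab : ℕ × ℕ) (γ : Lat M) (u : SymH M) :
    vertexTerm α p ab (Finsupp.single γ u) =
      if ip α γ = p - ab.1 + ab.2 then
        Fc α γ • Finsupp.single (α + γ) (expMinus α ab.1 (expPlus α ab.2 u)) else 0 := by
  rw [vertexTerm, Tminus_eq_map, Tplus_eq_map, expCoeff_map, expCoeff_map, Module.End.mul_apply,
    Module.End.mul_apply, Module.End.mul_apply, liftVG_single, liftVG_single, zPow,
    Finsupp.lsum_single]
  split_ifs with h
  · rw [Finsupp.lsingle_apply, expLat, Finsupp.lsum_single, LinearMap.smul_apply,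
      Finsupp.lsingle_apply, expMinus, expPlus, zcoeff_natCast, zcoeff_natCast, coeff_expSeries,
      coeff_expSeries]
  · simp

theorem finSum_vertexTerm_single (α : Lat M) (p : ℤ) (γ : Lat M) (u : SymH M) :
    FinSum (fun ab => vertexTerm α p ab (Finsupp.single γ u))
      (Fc α γ • Finsupp.single (α + γ) (vop α (p - ip α γ) u)) := by
  have h1 := (finSum_comp_injective_iff (i := ((↑) : ℕ → ℤ)) Nat.cast_injective fun b hb => by
    rw [expPlus_of_neg, LinearMap.zero_apply, map_zero]
    by_contra hn
    exact hb ⟨b.toNat, by omega⟩).2 (finSum_vop α (p - ip α γ) u)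
  have h2 := (h1.map (Finsupp.lsingle (α + γ))).smul (Fc α γ)
  obtain ⟨y, hy, hy'⟩ := exists_finSum_prod
    (f := fun ba : ℕ × ℕ => vertexTerm α p (ba.2, ba.1) (Finsupp.single γ u))
    (s := Function.support fun b : ℕ => expPlus α b u)
    ((expPlus_finite α u).preimage Nat.cast_injective.injOn) (fun b hb a => by
      rw [vertexTerm_single, show expPlus α b u = 0 by simpa using hb]
      simp) (g := fun b : ℕ => Fc α γ • Finsupp.lsingle (R := ℂ) (α + γ)
        (expMinus α (p - ip α γ + b) (expPlus α b u))) (fun b => by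
      rcases lt_or_ge (p - ip α γ + b) 0 with h | h
      · rw [expMinus_of_neg _ h]
        refine finSum_zero.congr (fun a => ?_) (by simp)
        rw [vertexTerm_single, if_neg (by simp only; omega)]
      · refine (finSum_single (p - ip α γ + b).toNat fun a ha => ?_).congr (fun _ => rfl) ?_
        · rw [vertexTerm_single, if_neg (by simp only; omega)]
        · rw [vertexTerm_single, if_pos (by simp only; omega)]
          simp only [Int.toNat_of_nonneg h, Finsupp.lsingle_apply])
  rw [hy'.unique h2] at hy
  exact hy.equiv (Equiv.prodComm ℕ ℕ)

theorem vertexTerm_locFinite (α : Lat M) (p : ℤ) : LocFinite (vertexTerm α p) := by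
  intro v
  induction v using Finsupp.induction_linear with
  | zero => simp [Function.support]
  | add v w hv hw =>
    simp only [map_add]
    exact (hv.union hw).subset (Function.support_add _ _)
  | single γ u => exact (finSum_vertexTerm_single α p γ u).1

theorem vertexCoeff_single (α : Lat M) (p : ℤ) (γ : Lat M) (u : SymH M) :
    vertexCoeff α p (Finsupp.single γ u) =
      Fc α γ • Finsupp.single (α + γ) (vop α (p - ip α γ) u) :=
  ((vertexTerm_locFinite α p).finSum _).unique (finSum_vertexTerm_single α p γ u)

theorem Xodd_single (α : Lat M) (r : ℤ) (γ : Lat M) (u : SymH M) :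
    Xodd α r (Finsupp.single γ u) =
      Fc α γ • Finsupp.single (α + γ) (vop α (-r - ip α γ) u) :=
  vertexCoeff_single _ _ _ _

theorem Xodd_Xodd_single (α β : Lat M) (r s : ℤ) (γ : Lat M) (u : SymH M) :
    Xodd α r (Xodd β s (Finsupp.single γ u)) =
      (Fc α β * (Fc α γ * Fc β γ)) • Finsupp.single (α + β + γ)
        (vop α (-r - ip α γ - ip α β) (vop β (-s - ip β γ) u)) := by
  rw [Xodd_single, map_smul, Xodd_single, smul_smul, Fc_add_right, ip_add_right, add_assoc,
    sub_add_eq_sub_sub_swap]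
  congr 1
  ring

/-- The modes of a given vector of odd norm eventually kill each vector. -/
theorem exists_Xodd_eq_zero (α : Lat M) (v : VG M) : ∃ R : ℤ, ∀ r > R, Xodd α r v = 0 := by
  induction v using Finsupp.induction_linear with
  | zero => exact ⟨0, fun r _ => map_zero _⟩
  | add v w hv hw =>
    obtain ⟨R, hR⟩ := hv
    obtain ⟨R', hR'⟩ := hw
    exact ⟨max R R', fun r hr => by
      rw [map_add, hR r ((le_max_left _ _).trans_lt hr), hR' r ((le_max_right _ _).trans_lt hr),
        add_zero]⟩
  | single γ u =>
    obtain ⟨K, hK⟩ := exists_vop_eq_zero α u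
    refine ⟨-K - ip α γ, fun r hr => ?_⟩
    rw [Xodd_single, hK _ (by omega)]
    simp

/-- For orthogonal `α` and `β` the exponentials commute, and the cocycle provides the sign. -/
theorem Xodd_anticomm_of_ip_eq_zero {α β : Lat M} (h : ip α β = 0) (hF : Fc β α = -Fc α β)
    (r s : ℤ) : Xodd α r * Xodd β s = -(Xodd β s * Xodd α r) := by
  refine Finsupp.lhom_ext fun γ u => ?_
  rw [LinearMap.neg_apply, Module.End.mul_apply, Module.End.mul_apply, Xodd_Xodd_single,
    Xodd_Xodd_single, ip_comm β α, h, sub_zero, sub_zero, vop_comm_of_ip_eq_zero h, hF,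
    add_comm β α, mul_comm (Fc β γ), neg_mul, neg_smul, neg_neg]

theorem Xodd_anticomm_self {α : Lat M} (h : ip α α = 1) (r s : ℤ) :
    Xodd α r * Xodd α s = -(Xodd α s * Xodd α r) := by
  refine Finsupp.lhom_ext fun γ u => ?_
  rw [LinearMap.neg_apply, Module.End.mul_apply, Module.End.mul_apply, Xodd_Xodd_single,
    Xodd_Xodd_single, h, ← smul_neg, ← Finsupp.single_neg,
    eq_neg_of_add_eq_zero_left (vop_anticomm_self h (-r - ip α γ) (-s - ip α γ) u)]

/-- The modes of `α` and `-α` satisfy the relations of a Clifford algebra. -/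
theorem Xodd_anticomm_neg {α : Lat M} (h : ip α α = 1) (hF : Fc α α = 1) (r s : ℤ) :
    Xodd α r * Xodd (-α) s + Xodd (-α) s * Xodd α r = if r + s = 1 then 1 else 0 := by
  refine Finsupp.lhom_ext fun γ u => ?_
  rw [LinearMap.add_apply, Module.End.mul_apply, Module.End.mul_apply, Xodd_Xodd_single,
    Xodd_Xodd_single, ip_neg_right, ip_neg_left, ip_neg_left, h, Fc_neg_right, Fc_neg_left,
    Fc_neg_left, hF, Fc_mul_self, mul_one, one_smul, one_smul, add_neg_cancel, neg_add_cancel,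
    zero_add, ← Finsupp.single_add, sub_neg_eq_add, sub_neg_eq_add, sub_neg_eq_add,
    vop_anticomm_neg h]
  by_cases hrs : r + s = 1
  · rw [if_pos hrs, if_pos (by omega)]; rfl
  · rw [if_neg hrs, if_neg (by omega)]; simp

/-- For orthogonal `α` and `β` with `(α + β, α + β) = 2`, no normal ordering is needed to multiply
the fields of `α` and `β`, and the product is, up to the cocycle, the field of `α + β`. -/
theorem finSum_Xodd_mul {α β : Lat M} (h : ip α β = 0) (hα : ip (α + β) (α + β) / 2 = 1)
    (m : ℤ) (v : VG M) :
    FinSum (fun r : ℤ => Fc α β • (Xodd α r * Xodd β (m - r + 1)) v) (Xeven (α + β) m v) := by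
  induction v using Finsupp.induction_linear with
  | zero => simpa using finSum_zero
  | add v w hv hw =>
    simp only [map_add, smul_add]
    exact hv.add hw
  | single γ u =>
    rw [Xeven, vertexCoeff_single, Fc_add_left, hα]
    refine ((((finSum_vop_add h (-m - 1 - ip (α + β) γ) u).equiv
      (Equiv.subLeft (-ip α γ))).map (Finsupp.lsingle (α + β + γ))).smul
      (Fc α γ * Fc β γ)).congr (fun r => ?_) rfl
    rw [Module.End.mul_apply, Xodd_Xodd_single, smul_smul, ← mul_assoc, Fc_mul_self, one_mul, h,
      sub_zero, Finsupp.lsingle_apply, Equiv.subLeft_apply, ip_add_left]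
    rw [show -ip α γ - r = -r - ip α γ by ring,
      show -m - 1 - (ip α γ + ip β γ) - (-r - ip α γ) = -(m - r + 1) - ip β γ by ring]

/-- Bosonization on `V[Γ]`, for the normal ordering that switches at `r = 0`. -/
theorem finSum_XXnormal {α : Lat M} (h : ip α α = 1) (hF : Fc α α = 1) (m : ℤ) (v : VG M) :
    FinSum (fun r : ℤ => (if r ≤ 0 then Xodd α r * Xodd (-α) (m - r + 1)
      else -(Xodd (-α) (m - r + 1) * Xodd α r)) v) (heis α m v) := by
  induction v using Finsupp.induction_linear with
  | zero => simpa using finSum_zero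
  | add v w hv hw =>
    simp only [map_add]
    exact hv.add hw
  | single γ u =>
    rw [heis_single]
    refine ((finSum_vop_normal h (ip α γ) m u).map (Finsupp.lsingle γ)).congr (fun r => ?_) rfl
    rw [Finsupp.lsingle_apply]
    split_ifs with hr
    · rw [Module.End.mul_apply, Xodd_Xodd_single, ip_neg_right, ip_neg_left, h, Fc_neg_right,
        Fc_neg_left, hF, Fc_mul_self, mul_one, one_smul, add_neg_cancel, zero_add]
      congr 3 <;> ring_nf
    · rw [LinearMap.neg_apply, Module.End.mul_apply, Xodd_Xodd_single, ip_neg_left, ip_neg_left, h,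
        Fc_neg_left, Fc_neg_left, hF, Fc_mul_self, mul_one, one_smul, neg_add_cancel, zero_add,
        Finsupp.single_neg]
      congr 4 <;> ring_nf

/-- The normal orderings that switch at `2 r = m + 1` and at `r = 0` agree: for `m = 0` the
conditions are the same, and for `m ≠ 0` the two factors anticommute. -/
theorem XXnormal_eq {α : Lat M} (h : ip α α = 1) (hF : Fc α α = 1) (m r : ℤ) :
    XXnormal α (-α) r (m - r + 1) = if r ≤ 0 then Xodd α r * Xodd (-α) (m - r + 1)
      else -(Xodd (-α) (m - r + 1) * Xodd α r) := by
  rw [XXnormal]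
  rcases eq_or_ne m 0 with hm | hm
  · exact if_congr (by omega) rfl rfl
  · have := Xodd_anticomm_neg h hF r (m - r + 1)
    rw [if_neg (by omega)] at this
    have h2 : Xodd α r * Xodd (-α) (m - r + 1) = -(Xodd (-α) (m - r + 1) * Xodd α r) :=
      LinearMap.ext fun v => eq_neg_of_add_eq_zero_left (LinearMap.congr_fun this v)
    rw [h2]
    split_ifs <;> rfl

theorem latPar_add (α β : Lat M) : latPar (α + β) = latPar α + latPar β := by
  rw [latPar, ip_add_left, ip_add_right, ip_add_right, ip_comm β α]
  have : (2 : ZMod 2) = 0 := rfl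
  push_cast [latPar]
  linear_combination (ip α β : ZMod 2) * this

theorem single_mem_vGrading {γ : Lat M} {i : ZMod 2} (h : latPar γ = i) (u : SymH M) :
    Finsupp.single γ u ∈ vGrading M i := Finsupp.single_mem_supported ℂ u h

theorem map_mem_vGrading {f : Module.End ℂ (VG M)} {i j : ZMod 2}
    (h : ∀ γ u, latPar γ = i → f (Finsupp.single γ u) ∈ vGrading M j) {v : VG M}
    (hv : v ∈ vGrading M i) : f v ∈ vGrading M j := by
  rw [← Finsupp.sum_single v, Finsupp.sum, map_sum]
  exact Submodule.sum_mem _ fun γ hγ => h _ _ (hv hγ)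

theorem vertexCoeff_mem (α : Lat M) (p : ℤ) {i : ZMod 2} {v : VG M} (hv : v ∈ vGrading M i) :
    vertexCoeff α p v ∈ vGrading M (latPar α + i) :=
  map_mem_vGrading (fun γ u hγ => by
    rw [vertexCoeff_single]
    exact Submodule.smul_mem _ _ (single_mem_vGrading (by rw [latPar_add, hγ]) _)) hv

end Vertex

/-! ### Normally ordered quadratic expressions in free fields -/

section Wick

section Algebra

variable {A : Type} [Ring A] [Algebra ℂ A] {x y z : A} {p q d : ℂ}

theorem mul_mul_comm_right (hx : x * z = p • (z * x)) (hy : y * z = q • (z * y) + d • (1 : A)) :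
    x * y * z = (p * q) • (z * (x * y)) + d • x := by
  rw [mul_assoc, hy, mul_add, mul_smul_comm, mul_smul_comm, mul_one, ← mul_assoc, hx,
    smul_mul_assoc, smul_smul, mul_assoc, mul_comm q]

theorem mul_mul_comm_left (hx : x * z = p • (z * x) + d • (1 : A)) (hy : y * z = q • (z * y)) :
    x * y * z = (p * q) • (z * (x * y)) + (q * d) • y := by
  rw [mul_assoc, hy, mul_smul_comm, ← mul_assoc, hx, add_mul, smul_add, smul_mul_assoc,
    smul_mul_assoc, one_mul, smul_smul, smul_smul, mul_assoc, mul_comm q p]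

theorem mul_mul_derivation {u v : A} (hx : z * x = p • (x * z) + u) (hy : z * y = q • (y * z) + v) :
    z * (x * y) = (p * q) • (x * y * z) + (u * y + p • (x * v)) := by
  rw [← mul_assoc, hx, add_mul, smul_mul_assoc, mul_assoc, hy, mul_add, mul_smul_comm, smul_add,
    smul_smul, ← mul_assoc, add_assoc, add_comm (p • (x * v))]

end Algebra

variable {I W : Type} [DecidableEq I] [AddCommGroup W] [Module ℂ W]

/-- Free fields `a_A(r)`, `b_A(r)` with the supercommutation relations
`b_B(s) a_A(r) - ε_{AB} a_A(r) b_B(s) = δ_{AB} δ_{r+s,1}`, all other pairs of fields commuting up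
to `ε`, whose modes of high degree kill each vector. -/
structure IsFreeFieldSystem (ε : I → I → ℂ) (a b : I → ℤ → Module.End ℂ W) : Prop where
  symm : ∀ A B, ε A B = ε B A
  sq : ∀ A B, ε A B * ε A B = 1
  aa : ∀ A C r s, a A r * a C s = ε A C • (a C s * a A r)
  bb : ∀ A C r s, b A r * b C s = ε A C • (b C s * b A r)
  ba : ∀ A B r s, b B s * a A r = ε A B • (a A r * b B s) +
    (if A = B ∧ r + s = 1 then (1 : ℂ) else 0) • (1 : Module.End ℂ W)
  a_zero : ∀ A w, ∃ R : ℤ, ∀ r > R, a A r w = 0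
  b_zero : ∀ A w, ∃ R : ℤ, ∀ r > R, b A r w = 0

/-- The product of `a_A(r)` and `b_B(s)`, normally ordered according to the sign of `c`. The case
`c = r` is the usual normal ordering; other values of `c` occur after a shift of `r`. -/
def orderedProd (ε : I → I → ℂ) (a b : I → ℤ → Module.End ℂ W) (A B : I) (c r s : ℤ) :
    Module.End ℂ W :=
  if c ≤ 0 then a A r * b B s else ε A B • (b B s * a A r)

/-- The modes `∑_r :a_A(r) b_B(m - r + 1):` of the normally ordered product of two fields. -/
def current (ε : I → I → ℂ) (a b : I → ℤ → Module.End ℂ W) (A B : I) (m : ℤ) : Module.End ℂ W :=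
  locSum fun r : ℤ => orderedProd ε a b A B r r (m - r + 1)

namespace IsFreeFieldSystem

variable {ε : I → I → ℂ} {a b : I → ℤ → Module.End ℂ W} (h : IsFreeFieldSystem ε a b)
include h

theorem ab (A B : I) (r s : ℤ) : a A r * b B s = ε A B • (b B s * a A r) +
    (-(ε A B * if A = B ∧ r + s = 1 then (1 : ℂ) else 0)) • (1 : Module.End ℂ W) := by
  rw [h.ba, smul_add, smul_smul, h.sq, one_smul, smul_smul, add_assoc, ← add_smul]
  simp

theorem locFinite (A B : I) (m : ℤ) :
    LocFinite fun r : ℤ => orderedProd ε a b A B r r (m - r + 1) := by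
  intro w
  obtain ⟨R, hR⟩ := h.a_zero A w
  obtain ⟨R', hR'⟩ := h.b_zero B w
  refine (Set.finite_Icc (min (m + 1 - R') 0) (max R 0)).subset fun r hr => ?_
  by_contra hn
  refine hr ?_
  dsimp only
  rw [orderedProd]
  rw [Set.mem_Icc, not_and_or, not_le, not_le] at hn
  split_ifs with h0
  · rw [Module.End.mul_apply, hR' _ (by omega), map_zero]
  · rw [LinearMap.smul_apply, Module.End.mul_apply, hR _ (by omega), map_zero, smul_zero]

theorem finSum_current (A B : I) (m : ℤ) (w : W) :
    FinSum (fun r : ℤ => orderedProd ε a b A B r r (m - r + 1) w) (current ε a b A B m w) :=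
  (h.locFinite A B m).finSum w

theorem orderedProd_mul_a (A B C : I) (c r t s : ℤ) :
    orderedProd ε a b A B c r t * a C s =
      (ε A C * ε B C) • (a C s * orderedProd ε a b A B c r t) +
        (if B = C ∧ t + s = 1 then (1 : ℂ) else 0) • a A r := by
  have hb : b B t * a C s = ε B C • (a C s * b B t) +
      (if B = C ∧ t + s = 1 then (1 : ℂ) else 0) • (1 : Module.End ℂ W) := by
    rw [h.ba, h.symm C B, add_comm s t]
    simp only [eq_comm]
  rw [orderedProd]
  split_ifs with h0 h1 h1
  · exact (mul_mul_comm_right (h.aa A C r s) hb).trans (by rw [if_pos h1])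
  · exact (mul_mul_comm_right (h.aa A C r s) hb).trans (by rw [if_neg h1])
  · rw [smul_mul_assoc, mul_mul_comm_left hb (h.aa A C r s), if_pos h1, mul_smul_comm, smul_add,
      smul_smul, smul_smul, smul_smul, ← h1.1, mul_one, h.sq]
    congr 2
    ring
  · rw [smul_mul_assoc, mul_mul_comm_left hb (h.aa A C r s), if_neg h1, mul_smul_comm, smul_add,
      smul_smul, smul_smul, smul_smul, mul_zero, mul_zero]
    congr 2
    ring

theorem orderedProd_mul_b (A B D : I) (c r t s : ℤ) :
    orderedProd ε a b A B c r t * b D s =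
      (ε A D * ε B D) • (b D s * orderedProd ε a b A B c r t) +
        (-(ε A D * ε B D) * if A = D ∧ r + s = 1 then (1 : ℂ) else 0) • b B t := by
  rw [orderedProd]
  split_ifs with h0 h1 h1
  · rw [mul_mul_comm_left (h.ab A D r s) (h.bb B D t s), if_pos h1]
    congr 2
    ring
  · rw [mul_mul_comm_left (h.ab A D r s) (h.bb B D t s), if_neg h1]
    congr 2
    ring
  · rw [smul_mul_assoc, mul_mul_comm_right (h.bb B D t s) (h.ab A D r s), if_pos h1, mul_smul_comm,
      smul_add, smul_smul, smul_smul, smul_smul, ← h1.1, h.symm B A]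
    congr 2 <;> ring
  · rw [smul_mul_assoc, mul_mul_comm_right (h.bb B D t s) (h.ab A D r s), if_neg h1, mul_smul_comm,
      smul_add, smul_smul, smul_smul, smul_smul]
    congr 2 <;> ring

/-- The supercommutator of a current with a field is a field. -/
theorem current_mul_a (A B C : I) (m s : ℤ) :
    current ε a b A B m * a C s = (ε A C * ε B C) • (a C s * current ε a b A B m) +
      (if B = C then (1 : ℂ) else 0) • a A (m + s) := by
  refine LinearMap.ext fun w => (h.finSum_current A B m (a C s w)).unique
    ((((h.finSum_current A B m w).map (a C s)).smul (ε A C * ε B C)).add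
      ((finSum_single (f := fun r : ℤ => (if B = C ∧ m - r + 1 + s = 1 then (1 : ℂ) else 0) •
        a A r w) (m + s) fun r hr => ?_).congr (fun _ => rfl) ?_) |>.congr (fun r => ?_) rfl)
  · rw [if_neg (by omega), zero_smul]
  · congr 1
    exact if_congr (and_iff_left (by ring)) rfl rfl
  · exact (LinearMap.congr_fun (h.orderedProd_mul_a A B C r r (m - r + 1) s) w).symm

theorem current_mul_b (A B D : I) (m s : ℤ) :
    current ε a b A B m * b D s = (ε A D * ε B D) • (b D s * current ε a b A B m) +
      (-(ε A D * ε B D) * if A = D then (1 : ℂ) else 0) • b B (m + s) := by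
  refine LinearMap.ext fun w => (h.finSum_current A B m (b D s w)).unique
    ((((h.finSum_current A B m w).map (b D s)).smul (ε A D * ε B D)).add
      ((finSum_single (f := fun r : ℤ => (-(ε A D * ε B D) *
        if A = D ∧ r + s = 1 then (1 : ℂ) else 0) • b B (m - r + 1) w) (1 - s)
          fun r hr => ?_).congr (fun _ => rfl) ?_) |>.congr (fun r => ?_) rfl)
  · rw [if_neg (by omega), mul_zero, zero_smul]
  · rw [show m - (1 - s) + 1 = m + s by ring, LinearMap.smul_apply]
    congr 2
    exact if_congr (and_iff_left (by ring)) rfl rfl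
  · exact (LinearMap.congr_fun (h.orderedProd_mul_b A B D r r (m - r + 1) s) w).symm

/-- Moving the point at which the normal ordering switches costs a scalar. -/
theorem orderedProd_shift (A D : I) (m r s : ℤ) :
    orderedProd ε a b A D r (m + r) s = orderedProd ε a b A D (m + r) (m + r) s +
      (((if r ≤ 0 then (1 : ℂ) else 0) - if r + m ≤ 0 then 1 else 0) *
        -(ε A D * if A = D ∧ m + r + s = 1 then (1 : ℂ) else 0)) • (1 : Module.End ℂ W) := by
  rw [orderedProd, orderedProd, h.ab, add_comm r m]
  by_cases h1 : r ≤ 0 <;> by_cases h2 : m + r ≤ 0 <;> simp only [h1, h2, if_true, if_false]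
  · simp
  · simp
  · rw [add_assoc, ← add_smul]
    split_ifs <;> simp
  · simp

theorem current_mul_orderedProd (A B C D : I) (m r s : ℤ) :
    current ε a b A B m * orderedProd ε a b C D r r s =
      (ε A C * ε B C * (ε A D * ε B D)) • (orderedProd ε a b C D r r s * current ε a b A B m) +
      ((if B = C then (1 : ℂ) else 0) • orderedProd ε a b A D r (m + r) s -
        (ε A C * ε B C * (ε A D * ε B D) * if A = D then (1 : ℂ) else 0) •
          orderedProd ε a b C B r r (m + s)) := by
  have ha := h.current_mul_a A B C m r
  have hb := h.current_mul_b A B D m s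
  simp only [orderedProd]
  by_cases h1 : r ≤ 0
  · simp only [if_pos h1]
    rw [mul_mul_derivation ha hb, smul_mul_assoc, mul_smul_comm, smul_smul, sub_eq_add_neg,
      ← neg_smul]
    congr 3
    ring
  · simp only [if_neg h1]
    rw [mul_smul_comm, mul_mul_derivation hb ha, smul_mul_assoc (_ * _), mul_smul_comm,
      smul_mul_assoc, smul_add, smul_add, sub_eq_add_neg, ← neg_smul,
      add_comm (_ • _ • (b B (m + s) * a C r))]
    simp only [smul_smul]
    congr 2
    · ring_nf
    · congr 1
      by_cases hBC : B = C
      · subst hBC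
        simp only [if_true, mul_one, one_mul]
        rw [h.symm B D, mul_left_comm, h.sq, mul_one]
      · simp [hBC]
    · congr 1
      by_cases hAD : A = D
      · subst hAD
        simp only [if_true, mul_one]
        rw [h.symm A C]
        have := h.sq B C
        rw [h.symm C B]
        linear_combination ε C A * ε A A * ε B A * this
      · simp [hAD]

/-- Wick's theorem for quadratic expressions: the currents span an affine Lie superalgebra of
general linear type, with central term `-ε_{AA} m δ_{m+n,0}`. -/
theorem current_mul_current (A B C D : I) (m n : ℤ) :
    current ε a b A B m * current ε a b C D n =
      (ε A C * ε B C * (ε A D * ε B D)) • (current ε a b C D n * current ε a b A B m) +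
      (((if B = C then (1 : ℂ) else 0) • current ε a b A D (m + n) -
        (ε A C * ε B C * (ε A D * ε B D) * if A = D then (1 : ℂ) else 0) •
          current ε a b C B (m + n)) -
        ((if B = C then (1 : ℂ) else 0) * (if A = D then (1 : ℂ) else 0) * ε A A *
          if m + n = 0 then (m : ℂ) else 0) • (1 : Module.End ℂ W)) := by
  refine LinearMap.ext fun w => ((h.finSum_current C D n w).map (current ε a b A B m)).unique ?_
  have s1 := (h.finSum_current C D n (current ε a b A B m w)).smul
    (ε A C * ε B C * (ε A D * ε B D))
  have s2 := ((h.finSum_current A D (m + n) w).equiv (Equiv.addLeft m)).smul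
    (if B = C then (1 : ℂ) else 0)
  have s3 := (h.finSum_current C B (m + n) w).smul
    (ε A C * ε B C * (ε A D * ε B D) * if A = D then (1 : ℂ) else 0)
  -- after the shift `r ↦ m + r`, the normal ordering switches at the wrong place; correcting the
  -- `|m|` affected terms gives the central term
  have s4 := ((finSum_step_sub_step m).smul_const w).smul ((if B = C then (1 : ℂ) else 0) *
    (ε A D * if A = D ∧ m + n + 1 = 1 then (1 : ℂ) else 0))
  refine (s1.add ((s2.sub s3).sub s4)).congr (fun r => ?_) ?_
  · have e := LinearMap.congr_fun (h.current_mul_orderedProd A B C D m r (n - r + 1)) w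
    rw [Module.End.mul_apply] at e
    rw [e, orderedProd_shift h]
    simp only [LinearMap.add_apply, LinearMap.sub_apply, LinearMap.smul_apply,
      Module.End.mul_apply, Module.End.one_apply, Equiv.coe_addLeft]
    rw [show m + n - (m + r) + 1 = n - r + 1 by ring, show m + r + (n - r + 1) = m + n + 1 by ring,
      show m + (n - r + 1) = m + n - r + 1 by ring]
    module
  · simp only [LinearMap.add_apply, LinearMap.sub_apply, LinearMap.smul_apply,
      Module.End.mul_apply, Module.End.one_apply, smul_smul]
    congr 3
    by_cases hAD : A = D <;> by_cases hmn : m + n = 0 <;> simp [hAD, hmn]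

end IsFreeFieldSystem

end Wick

/-! ### Lie superalgebras and their affinizations -/

section Super

variable {V L L' g : Type} [AddCommGroup V] [Module ℂ V] [AddCommGroup L] [Module ℂ L]
  [AddCommGroup L'] [Module ℂ L'] [AddCommGroup g] [Module ℂ g]

theorem koszul_comm (i j : ZMod 2) : koszul i j = koszul j i := by
  rw [koszul, koszul, mul_comm]

theorem koszul_eq_one_or (i j : ZMod 2) : koszul i j = 1 ∨ koszul i j = -1 := by
  rw [koszul]; exact neg_one_pow_eq_or ℂ _

theorem koszul_mul_self (i j : ZMod 2) : koszul i j * koszul i j = 1 := by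
  rcases koszul_eq_one_or i j with h | h <;> simp [h]

theorem koszul_zero_left (j : ZMod 2) : koszul 0 j = 1 := by simp [koszul]

theorem koszul_zero_right (j : ZMod 2) : koszul j 0 = 1 := by simp [koszul]

theorem koszul_one_one : koszul 1 1 = -1 := by simp [koszul, ZMod.val_one]

theorem zmod_two_cases (i : ZMod 2) : i = 0 ∨ i = 1 := by
  fin_cases i
  · exact Or.inl rfl
  · exact Or.inr rfl

theorem koszul_add_left (i j k : ZMod 2) : koszul (i + j) k = koszul i k * koszul j k := by
  have h2 : (1 + 1 : ZMod 2) = 0 := rfl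
  rcases zmod_two_cases i with rfl | rfl <;> rcases zmod_two_cases j with rfl | rfl <;>
    rcases zmod_two_cases k with rfl | rfl <;>
    simp [h2, koszul_zero_left, koszul_zero_right, koszul_one_one]

theorem koszul_add_right (i j k : ZMod 2) : koszul i (j + k) = koszul i j * koszul i k := by
  rw [koszul_comm, koszul_add_left, koszul_comm j, koszul_comm k]

/-- The maps `π i` are the projections of `V` to the components `gr i` of a `ℤ/2`-grading. -/
structure IsParityProjection (gr : ZMod 2 → Submodule ℂ V) (π : ZMod 2 → V →ₗ[ℂ] V) : Prop where
  add : ∀ x, π 0 x + π 1 x = x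
  mem : ∀ i x, π i x ∈ gr i
  self : ∀ i, ∀ x ∈ gr i, π i x = x

theorem IsParityProjection.isInternal {gr : ZMod 2 → Submodule ℂ V} {π : ZMod 2 → V →ₗ[ℂ] V}
    (h : IsParityProjection gr π) : DirectSum.IsInternal gr := by
  refine (DirectSum.isInternal_submodule_iff_isCompl gr (i := 0) (j := 1) (by decide)
    (by ext i; rcases zmod_two_cases i with rfl | rfl <;> simp)).2 ⟨?_, ?_⟩
  · rw [Submodule.disjoint_def]
    intro x h0 h1
    have := h.add x
    rw [h.self 0 x h0, h.self 1 x h1] at this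
    simpa using this
  · rw [codisjoint_iff, eq_top_iff]
    intro x _
    rw [← h.add x]
    exact Submodule.add_mem_sup (h.mem 0 x) (h.mem 1 x)

theorem IsParityProjection.apply_of_ne {gr : ZMod 2 → Submodule ℂ V} {π : ZMod 2 → V →ₗ[ℂ] V}
    (h : IsParityProjection gr π) {i j : ZMod 2} (hij : i ≠ j) {x : V} (hx : x ∈ gr j) :
    π i x = 0 := by
  have h1 := h.add x
  have h2 := h.self j x hx
  rcases zmod_two_cases i with rfl | rfl <;> rcases zmod_two_cases j with rfl | rfl
  · exact absurd rfl hij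
  · rw [h2] at h1; simpa using h1
  · rw [h2] at h1; simpa using h1
  · exact absurd rfl hij

theorem IsSuperIso.isLieSuperalgebra {gr : ZMod 2 → Submodule ℂ L} {br : L →ₗ[ℂ] L →ₗ[ℂ] L}
    {gr' : ZMod 2 → Submodule ℂ L'} {br' : L' →ₗ[ℂ] L' →ₗ[ℂ] L'} {Φ : L ≃ₗ[ℂ] L'}
    (h : IsSuperIso gr br gr' br' Φ) (h' : IsLieSuperalgebra gr' br') :
    IsLieSuperalgebra gr br := by
  have hm : ∀ {i x}, x ∈ gr i ↔ Φ x ∈ gr' i := fun {i x} => by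
    rw [← h.map_grading i]
    exact (Φ.injective.mem_set_image (s := (gr i : Set L))).symm
  have huniv : (Set.univ : Set (ZMod 2)) = {0, 1} := by
    ext i; rcases zmod_two_cases i with rfl | rfl <;> simp
  refine ⟨?_, fun i j x hx y hy => ?_, fun i j x hx y hy => ?_, fun i j x hx y hy z => ?_⟩
  · have hc := (DirectSum.isInternal_submodule_iff_isCompl gr' (i := 0) (j := 1) (by decide)
      huniv).1 h'.isInternal
    refine (DirectSum.isInternal_submodule_iff_isCompl gr (i := 0) (j := 1) (by decide) huniv).2 ?_
    rw [← h.map_grading, ← h.map_grading] at hc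
    exact (OrderIso.isCompl_iff (Submodule.orderIsoMapComap Φ)).2 hc
  · rw [hm, h.map_bracket]
    exact h'.bracket_mem i j _ (hm.1 hx) _ (hm.1 hy)
  · apply Φ.injective
    rw [h.map_bracket, map_neg, map_smul, h.map_bracket]
    exact h'.skew i j _ (hm.1 hx) _ (hm.1 hy)
  · apply Φ.injective
    simp only [h.map_bracket, map_sub, map_smul]
    exact h'.jacobi i j _ (hm.1 hx) _ (hm.1 hy) _

theorem mem_affGrading {gr : ZMod 2 → Submodule ℂ g} {i : ZMod 2} {x : Affine g} :
    x ∈ affGrading gr i ↔ (∀ m, x.1 m ∈ gr i) ∧ (i ≠ 0 → x.2 = 0) := by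
  rw [affGrading, Submodule.mem_prod, Submodule.mem_iInf]
  refine and_congr Iff.rfl ?_
  by_cases h : i = 0 <;> simp [h]

theorem mode_mem_affGrading {gr : ZMod 2 → Submodule ℂ g} {i : ZMod 2} {X : g} (h : X ∈ gr i)
    (m : ℤ) : Affine.mode X m ∈ affGrading gr i := by
  refine mem_affGrading.2 ⟨fun n => ?_, fun _ => rfl⟩
  rw [Affine.mode, Finsupp.single_apply]
  split_ifs
  · exact h
  · exact zero_mem _

theorem smul_K_mem_affGrading {gr : ZMod 2 → Submodule ℂ g} {i : ZMod 2} {c : ℂ}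
    (h : i ≠ 0 → c = 0) : c • (Affine.K : Affine g) ∈ affGrading gr i := by
  refine mem_affGrading.2 ⟨fun n => ?_, fun hi => ?_⟩
  · simp [Affine.K]
  · simp [Affine.K, h hi]

/-- A property that is additive holds on a component of the affinization as soon as it holds for
the homogeneous `X(m)` and the multiples of `K` in it. -/
theorem affGrading_induction {gr : ZMod 2 → Submodule ℂ g} {i : ZMod 2} {p : Affine g → Prop}
    (hadd : ∀ x y, p x → p y → p (x + y)) (hmode : ∀ X ∈ gr i, ∀ m, p (Affine.mode X m))
    (hK : ∀ c : ℂ, (i ≠ 0 → c = 0) → p (c • Affine.K)) {x : Affine g}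
    (hx : x ∈ affGrading gr i) : p x := by
  obtain ⟨f, c⟩ := x
  obtain ⟨h1, h2⟩ := mem_affGrading.1 hx
  have e : (f, c) = (f, (0 : ℂ)) + c • (Affine.K : Affine g) := by simp [Affine.K]
  rw [e]
  refine hadd _ _ ?_ (hK c h2)
  have h0 : p ((0 : ℤ →₀ g), (0 : ℂ)) := by
    have := hmode 0 (zero_mem _) 0
    simpa [Affine.mode] using this
  clear hx e h2
  change ∀ m, f m ∈ gr i at h1
  induction f using Finsupp.induction with
  | zero => exact h0
  | single_add m X f hm hX ih =>
    have hf : f m = 0 := by simpa using hm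
    have e : (Finsupp.single m X + f, (0 : ℂ)) = Affine.mode X m + (f, (0 : ℂ)) := by
      simp [Affine.mode]
    rw [e]
    refine hadd _ _ (hmode X ?_ m) (ih fun n => ?_)
    · simpa [hf] using h1 m
    · by_cases hn : m = n
      · rw [← hn, hf]; exact zero_mem _
      · simpa [Finsupp.single_apply, hn] using h1 n

theorem affine_induction {p : Affine g → Prop}
    (hadd : ∀ x y, p x → p y → p (x + y)) (hmode : ∀ X m, p (Affine.mode X m))
    (hK : ∀ c : ℂ, p (c • Affine.K)) (x : Affine g) : p x :=
  affGrading_induction (gr := fun _ => ⊤) (i := 0) hadd (fun X _ m => hmode X m)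
    (fun c _ => hK c) (mem_affGrading.2 ⟨fun _ => Submodule.mem_top, fun h => absurd rfl h⟩)

/-- The projections of the affinization to its even and odd parts. -/
def affProj (π : ZMod 2 → g →ₗ[ℂ] g) (i : ZMod 2) : Affine g →ₗ[ℂ] Affine g :=
  LinearMap.prodMap (Finsupp.mapRange.linearMap (π i)) (if i = 0 then LinearMap.id else 0)

theorem IsParityProjection.affine {gr : ZMod 2 → Submodule ℂ g} {π : ZMod 2 → g →ₗ[ℂ] g}
    (h : IsParityProjection gr π) : IsParityProjection (affGrading gr) (affProj π) where
  add x := by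
    ext m
    · simpa [affProj] using h.add (x.1 m)
    · simp [affProj]
  mem i x := by
    refine mem_affGrading.2 ⟨fun m => ?_, fun hi => ?_⟩
    · simpa [affProj] using h.mem i (x.1 m)
    · simp [affProj, hi]
  self i x hx := by
    obtain ⟨h1, h2⟩ := mem_affGrading.1 hx
    ext m
    · simpa [affProj] using h.self i _ (h1 m)
    · by_cases hi : i = 0
      · simp [affProj, hi]
      · simp [affProj, hi, h2 hi]

theorem affBracket_smul_K (br : g →ₗ[ℂ] g →ₗ[ℂ] g) (B : g →ₗ[ℂ] g →ₗ[ℂ] ℂ) (c : ℂ)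
    (x : Affine g) :
    affBracket br B (c • Affine.K) x = 0 ∧ affBracket br B x (c • Affine.K) = 0 := by
  rw [map_smul, map_smul, LinearMap.smul_apply, (affBracket_K br B x).1, (affBracket_K br B x).2,
    smul_zero]
  exact ⟨rfl, rfl⟩

theorem mode_add (X Y : g) (m : ℤ) :
    (Affine.mode (X + Y) m : Affine g) = Affine.mode X m + Affine.mode Y m := by
  simp [Affine.mode]

theorem mode_smul (c : ℂ) (X : g) (m : ℤ) :
    (Affine.mode (c • X) m : Affine g) = c • Affine.mode X m := by
  simp [Affine.mode]

/-- The affinization of a Lie superalgebra with respect to an even, supersymmetric, invariant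
form is a Lie superalgebra. -/
theorem IsLieSuperalgebra.affine {gr : ZMod 2 → Submodule ℂ g} {π : ZMod 2 → g →ₗ[ℂ] g}
    {br : g →ₗ[ℂ] g →ₗ[ℂ] g} {B : g →ₗ[ℂ] g →ₗ[ℂ] ℂ} (h : IsLieSuperalgebra gr br)
    (hπ : IsParityProjection gr π)
    (heven : ∀ i j, i ≠ j → ∀ x ∈ gr i, ∀ y ∈ gr j, B x y = 0)
    (hsymm : ∀ i j, ∀ x ∈ gr i, ∀ y ∈ gr j, B x y = koszul i j * B y x)
    (hinv : ∀ i j, ∀ x ∈ gr i, ∀ y ∈ gr j, ∀ z, B (br x y) z = B x (br y z)) :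
    IsLieSuperalgebra (affGrading gr) (affBracket br B) := by
  refine ⟨hπ.affine.isInternal, fun i j x hx y hy => ?_, fun i j x hx y hy => ?_,
    fun i j x hx y hy z => ?_⟩
  · refine affGrading_induction (p := fun x => affBracket br B x y ∈ affGrading gr (i + j))
      (fun x x' h1 h2 => ?_) (fun X hX m => ?_) (fun c _ => ?_) hx
    · rw [map_add, LinearMap.add_apply]; exact add_mem h1 h2
    · refine affGrading_induction
        (p := fun y => affBracket br B (Affine.mode X m) y ∈ affGrading gr (i + j))
        (fun y y' h1 h2 => ?_) (fun Y hY n => ?_) (fun c _ => ?_) hy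
      · rw [map_add]; exact add_mem h1 h2
      · rw [affBracket_mode]
        refine add_mem (mode_mem_affGrading (h.bracket_mem i j X hX Y hY) _)
          (smul_K_mem_affGrading fun hij => ?_)
        rw [heven i j _ X hX Y hY, mul_zero]
        rintro rfl
        exact hij (CharTwo.add_self_eq_zero i)
      · rw [(affBracket_smul_K br B c _).2]; exact zero_mem _
    · rw [(affBracket_smul_K br B c _).1]; exact zero_mem _
  · refine affGrading_induction
      (p := fun x => affBracket br B x y = -(koszul i j • affBracket br B y x))
      (fun x x' h1 h2 => ?_) (fun X hX m => ?_) (fun c _ => ?_) hx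
    · rw [map_add, LinearMap.add_apply, h1, h2, map_add, smul_add, neg_add]
    · refine affGrading_induction (p := fun y => affBracket br B (Affine.mode X m) y =
          -(koszul i j • affBracket br B y (Affine.mode X m)))
        (fun y y' h1 h2 => ?_) (fun Y hY n => ?_) (fun c _ => ?_) hy
      · rw [map_add, h1, h2, map_add, LinearMap.add_apply, smul_add, neg_add]
      · rw [affBracket_mode, affBracket_mode, h.skew i j X hX Y hY, hsymm i j X hX Y hY,
          ← neg_smul, mode_smul, smul_add, neg_add, add_comm n m, neg_smul, smul_smul, ← neg_smul]
        congr 2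
        by_cases hmn : m + n = 0
        · have : (m : ℂ) = -n := by exact_mod_cast eq_neg_of_add_eq_zero_left hmn
          simp only [hmn, if_true, this]
          module
        · simp [hmn]
      · rw [(affBracket_smul_K br B c _).1, (affBracket_smul_K br B c _).2, smul_zero, neg_zero]
    · rw [(affBracket_smul_K br B c _).1, (affBracket_smul_K br B c _).2, smul_zero, neg_zero]
  · have hK : ∀ (c : ℂ) (x : Affine g), _ := affBracket_smul_K br B
    refine affGrading_induction (p := fun x => affBracket br B (affBracket br B x y) z =
        affBracket br B x (affBracket br B y z) -
          koszul i j • affBracket br B y (affBracket br B x z))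
      (fun x x' h1 h2 => ?_) (fun X hX m => ?_) (fun c _ => ?_) hx
    · simp only [map_add, LinearMap.add_apply, h1, h2]
      module
    · refine affGrading_induction (p := fun y =>
          affBracket br B (affBracket br B (Affine.mode X m) y) z =
          affBracket br B (Affine.mode X m) (affBracket br B y z) -
          koszul i j • affBracket br B y (affBracket br B (Affine.mode X m) z))
        (fun y y' h1 h2 => ?_) (fun Y hY n => ?_) (fun c _ => ?_) hy
      · simp only [map_add, LinearMap.add_apply, h1, h2]
        module
      · refine affine_induction (p := fun z =>
            affBracket br B (affBracket br B (Affine.mode X m) (Affine.mode Y n)) z =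
            affBracket br B (Affine.mode X m) (affBracket br B (Affine.mode Y n) z) -
            koszul i j • affBracket br B (Affine.mode Y n) (affBracket br B (Affine.mode X m) z))
          (fun z z' h1 h2 => ?_) (fun Z k => ?_) (fun c => ?_) z
        · simp only [map_add, h1, h2]
          module
        · -- the cocycle condition: by invariance all central terms are multiples of `([X, Y], Z)`
          have e : B Y (br X Z) = -(koszul i j * B (br X Y) Z) := by
            rw [← hinv j i Y hY X hX, h.skew j i Y hY X hX, koszul_comm]
            simp
          simp only [affBracket_mode, map_add, LinearMap.add_apply, (hK _ _).1, (hK _ _).2,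
            add_zero, h.jacobi i j X hX Y hY, ← hinv i j X hX Y hY, e]
          rw [sub_eq_add_neg (br X (br Y Z)), ← neg_smul, mode_add, mode_smul,
            show n + (m + k) = m + n + k by ring, ← add_assoc m n k]
          by_cases hmn : m + n + k = 0
          · simp only [hmn, if_true, smul_add, smul_smul]
            have := koszul_mul_self i j
            match_scalars
            · ring
            · ring
            · linear_combination -((n : ℂ) * (B ((br X) Y)) Z) * this
          · simp only [hmn, if_false]
            module
        · simp only [(hK _ _).2, map_zero, smul_zero, sub_zero]
      · simp only [(hK _ _).1, (hK _ _).2, map_zero, LinearMap.zero_apply, smul_zero, sub_zero]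
    · simp only [(hK _ _).1, map_zero, LinearMap.zero_apply, smul_zero, sub_zero]

end Super

/-! ### The Lie superalgebra `gl(M|N)` and the supertrace form -/

section Gl

variable {M N : ℕ}

theorem glPart_apply (i : ZMod 2) (x : Gl M N) (a b : Idx M N) :
    glPart M N i x a b = if par a + par b = i then x a b else 0 := rfl

theorem mem_glGrading {i : ZMod 2} {x : Gl M N} :
    x ∈ glGrading M N i ↔ ∀ a b, par a + par b ≠ i → x a b = 0 := by
  constructor
  · rintro ⟨y, rfl⟩ a b h
    rw [glPart_apply, if_neg h]
  · intro h
    refine ⟨x, ?_⟩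
    ext a b
    rw [glPart_apply]
    split_ifs with h'
    · rfl
    · exact (h a b h').symm

theorem glPart_isParityProjection : IsParityProjection (glGrading M N) (glPart M N) where
  add x := by
    ext a b
    rw [Matrix.add_apply, glPart_apply, glPart_apply]
    rcases zmod_two_cases (par a + par b) with h | h <;> simp [h]
  mem i x := ⟨x, rfl⟩
  self i x hx := by
    ext a b
    rw [glPart_apply]
    split_ifs with h
    · rfl
    · exact (mem_glGrading.1 hx a b h).symm

theorem glBracket_of_mem {i j : ZMod 2} {x y : Gl M N} (hx : x ∈ glGrading M N i)
    (hy : y ∈ glGrading M N j) : glBracket M N x y = x * y - koszul i j • (y * x) := by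
  have e : ∀ k l, glPart M N k x * glPart M N l y - koszul k l • (glPart M N l y * glPart M N k x)
      = if k = i ∧ l = j then x * y - koszul i j • (y * x) else 0 := fun k l => by
    by_cases hk : k = i
    · by_cases hl : l = j
      · rw [hk, hl, glPart_isParityProjection.self i x hx, glPart_isParityProjection.self j y hy,
          if_pos ⟨rfl, rfl⟩]
      · rw [glPart_isParityProjection.apply_of_ne hl hy, if_neg (fun h => hl h.2)]
        simp
    · rw [glPart_isParityProjection.apply_of_ne hk hx, if_neg (fun h => hk h.1)]
      simp
  have : glBracket M N x y = ∑ k, ∑ l, (glPart M N k x * glPart M N l y -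
      koszul k l • (glPart M N l y * glPart M N k x)) := by
    simp [glBracket]
  rw [this]
  simp only [e]
  rw [Finset.sum_eq_single i, Finset.sum_eq_single j]
  · simp
  · intro l _ hl; simp [hl]
  · simp
  · intro k _ hk; simp [hk]
  · simp

theorem glGrading_mul_mem {i j : ZMod 2} {x y : Gl M N} (hx : x ∈ glGrading M N i)
    (hy : y ∈ glGrading M N j) : x * y ∈ glGrading M N (i + j) := by
  rw [mem_glGrading] at *
  intro a c h
  rw [Matrix.mul_apply]
  refine Finset.sum_eq_zero fun b _ => ?_
  by_cases h1 : par a + par b = i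
  · rw [hy b c, mul_zero]
    rintro rfl
    apply h
    rw [← h1]
    linear_combination -(par b) * CharTwo.two_eq_zero (R := ZMod 2)
  · rw [hx a b h1, zero_mul]

theorem glBracket_mem {i j : ZMod 2} {x y : Gl M N} (hx : x ∈ glGrading M N i)
    (hy : y ∈ glGrading M N j) : glBracket M N x y ∈ glGrading M N (i + j) := by
  rw [glBracket_of_mem hx hy]
  refine sub_mem (glGrading_mul_mem hx hy) (Submodule.smul_mem _ _ ?_)
  rw [add_comm]
  exact glGrading_mul_mem hy hx

/-- The sign of an index in the supertrace. -/
def strSign : Idx M N → ℂ := Sum.elim (fun _ => 1) (fun _ => -1)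

theorem str_eq (x : Gl M N) : str M N x = ∑ a, strSign a * x a a := by
  rw [Fintype.sum_sum_type]
  simp [str, strSign, sub_eq_add_neg]

theorem str_mul (x y : Gl M N) :
    str M N (x * y) = ∑ a, ∑ b, strSign a * (x a b * y b a) := by
  simp only [str_eq, Matrix.mul_apply, Finset.mul_sum]

theorem str_mul_eq_zero {i j : ZMod 2} (hij : i ≠ j) {x y : Gl M N} (hx : x ∈ glGrading M N i)
    (hy : y ∈ glGrading M N j) : str M N (x * y) = 0 := by
  rw [mem_glGrading] at *
  rw [str_mul]
  refine Finset.sum_eq_zero fun a _ => Finset.sum_eq_zero fun b _ => ?_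
  by_cases h1 : par a + par b = i
  · rw [hy b a (by rw [add_comm, h1]; exact hij), mul_zero, mul_zero]
  · rw [hx a b h1, zero_mul, mul_zero]

theorem str_mul_comm {i j : ZMod 2} {x y : Gl M N} (hx : x ∈ glGrading M N i)
    (hy : y ∈ glGrading M N j) : str M N (x * y) = koszul i j * str M N (y * x) := by
  by_cases hij : i = j
  · subst hij
    rw [str_mul, str_mul, Finset.sum_comm, Finset.mul_sum]
    refine Finset.sum_congr rfl fun b _ => ?_
    rw [Finset.mul_sum]
    refine Finset.sum_congr rfl fun a _ => ?_
    by_cases h1 : par a + par b = i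
    · have : strSign a = koszul i i * strSign b := by
        subst h1
        rcases a with a | a <;> rcases b with b | b <;>
          simp [strSign, par, koszul_zero_left, koszul_one_one,
            show (1 + 1 : ZMod 2) = 0 from rfl]
      rw [this]
      ring
    · rw [mem_glGrading.1 hx a b h1]
      ring
  · rw [str_mul_eq_zero hij hx hy, str_mul_eq_zero (Ne.symm hij) hy hx, mul_zero]

theorem glForm_apply (x y : Gl M N) : glForm M N x y = str M N (x * y) := rfl

theorem glForm_invariant {i j : ZMod 2} {x y : Gl M N} (hx : x ∈ glGrading M N i)
    (hy : y ∈ glGrading M N j) (z : Gl M N) :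
    glForm M N (glBracket M N x y) z = glForm M N x (glBracket M N y z) := by
  have key : ∀ k, ∀ z ∈ glGrading M N k,
      glForm M N (glBracket M N x y) z = glForm M N x (glBracket M N y z) := fun k z hz => by
    rw [glBracket_of_mem hx hy, glBracket_of_mem hy hz, glForm_apply, glForm_apply, sub_mul,
      mul_sub, map_sub, map_sub, smul_mul_assoc, mul_smul_comm, map_smul, map_smul, mul_assoc,
      mul_assoc y, ← mul_assoc x z y, str_mul_comm (glGrading_mul_mem hx hz) hy, koszul_add_left,
      koszul_comm k j, smul_eq_mul, smul_eq_mul]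
    linear_combination koszul i j * str M N (y * (x * z)) * koszul_mul_self j k
  rw [← glPart_isParityProjection.add z, map_add, map_add, map_add, key 0 _ ⟨z, rfl⟩,
    key 1 _ ⟨z, rfl⟩]

theorem gl_isLieSuperalgebra : IsLieSuperalgebra (glGrading M N) (glBracket M N) := by
  refine ⟨glPart_isParityProjection.isInternal, fun i j x hx y hy => glBracket_mem hx hy,
    fun i j x hx y hy => ?_, fun i j x hx y hy z => ?_⟩
  · rw [glBracket_of_mem hx hy, glBracket_of_mem hy hx, koszul_comm j i, smul_sub, smul_smul,
      koszul_mul_self, one_smul, neg_sub]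
  · have key : ∀ k, ∀ z ∈ glGrading M N k, glBracket M N (glBracket M N x y) z =
        glBracket M N x (glBracket M N y z) - koszul i j • glBracket M N y (glBracket M N x z) :=
        fun k z hz => by
      rw [glBracket_of_mem (glBracket_mem hx hy) hz, glBracket_of_mem hx (glBracket_mem hy hz),
        glBracket_of_mem hy (glBracket_mem hx hz), glBracket_of_mem hx hy, glBracket_of_mem hy hz,
        glBracket_of_mem hx hz, koszul_add_left, koszul_add_right, koszul_add_right,
        koszul_comm j i]
      simp only [mul_sub, sub_mul, smul_mul_assoc, mul_smul_comm, mul_assoc, smul_sub, smul_smul]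
      have h1 := koszul_mul_self i j
      match_scalars <;> try ring1
      · linear_combination koszul i k * koszul j k * h1
      · linear_combination -koszul j k * h1
    rw [← glPart_isParityProjection.add z]
    simp only [map_add, key 0 _ ⟨z, rfl⟩, key 1 _ ⟨z, rfl⟩]
    module

theorem affineGl_isLieSuperalgebra :
    IsLieSuperalgebra (affGrading (glGrading M N)) (affBracket (glBracket M N) (glForm M N)) :=
  gl_isLieSuperalgebra.affine glPart_isParityProjection
    (fun _ _ hij _ hx _ hy => str_mul_eq_zero hij hx hy)
    (fun _ _ _ hx _ hy => str_mul_comm hx hy) (fun _ _ _ hx _ hy z => glForm_invariant hx hy z)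

end Gl

/-! ### The isomorphism between `T` and `gl(M|N)` -/

section TIso

variable {M N : ℕ}

/-- The sign relating `T_{ij}` to the elementary matrix `E_{ij}`: it is `F(e_i, e_j)` for
`i, j ≤ M`, and `1` otherwise. -/
def tSign : Idx M N → Idx M N → ℂ
  | Sum.inl i, Sum.inl j => Fc (e i) (e j)
  | _, _ => 1

theorem tSign_mul_self (A B : Idx M N) : tSign A B * tSign A B = 1 := by
  rcases A with i | i <;> rcases B with j | j <;> simp [tSign, Fc_mul_self]

theorem kd_comm {κ : Type} [DecidableEq κ] (i j : κ) : kd i j = kd j i := by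
  simp [kd, eq_comm]

theorem kd_inl (i j : Fin M) : kd (Sum.inl i : Idx M N) (Sum.inl j) = kd i j := by simp [kd]

theorem kd_inr (i j : Fin N) : kd (Sum.inr i : Idx M N) (Sum.inr j) = kd i j := by simp [kd]

theorem kd_inl_inr (i : Fin M) (j : Fin N) : kd (Sum.inl i : Idx M N) (Sum.inr j) = 0 := by
  simp [kd]

theorem kd_inr_inl (i : Fin N) (j : Fin M) : kd (Sum.inr i : Idx M N) (Sum.inl j) = 0 := by
  simp [kd]

/-- The bracket of `T` in a uniform shape: the signed basis vectors `tSign A B • T_{AB}` multiply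
like elementary matrices. -/
theorem tBracketBasis_eq (A B C D : Idx M N) :
    tBracketBasis A B C D =
      (tSign A B * tSign C D * tSign A D * kd B C) • tb A D -
        (koszul (par A + par B) (par C + par D) * (tSign A B * tSign C D * tSign C B * kd A D)) •
          tb C B := by
  have h11 : (1 + 1 : ZMod 2) = 0 := rfl
  rcases A with i | i <;> rcases B with j | j <;> rcases C with k | k <;> rcases D with l | l
  -- all indices at most `M`: the signs agree because `F` is bimultiplicative, `F(e_a, e_a) = 1`,
  -- and `F(e_a, e_b) = -F(e_b, e_a)` for `a ≠ b`
  · simp only [tBracketBasis, tSign, par, Sum.elim_inl, add_zero, koszul_zero_left, one_mul,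
      kd, ip_sub_left, ip_sub_right, ip_e_e, Fc_sub_left, Fc_sub_right, Sum.inl.injEq]
    have s := fun a b : Fin M => Fc_mul_self (e a) (e b)
    have a := fun (a b : Fin M) (h : a ≠ b) => Fc_e_symm h
    by_cases h1 : i = j
    · subst h1
      by_cases h2 : k = l
      · subst h2
        by_cases h3 : i = k
        · subst h3; simp
        · simp [h3]
      · by_cases h3 : i = k
        · subst h3
          simp [h2, s, Fc_e_self]
        · by_cases h4 : i = l
          · subst h4
            simp [h2, h3, s, Fc_e_self]
          · simp [h2, h3, h4]
    · by_cases h2 : k = l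
      · subst h2
        by_cases h3 : j = k
        · subst h3
          simp [h1, Ne.symm h1, s, Fc_e_self]
        · by_cases h4 : i = k
          · subst h4
            simp [h1, Ne.symm h1, s, Fc_e_self]
          · simp [h1, h3, h4, Ne.symm h3, Ne.symm h4]
      · by_cases h3 : j = k
        · subst h3
          by_cases h4 : i = l
          · subst h4
            simp [h1, Ne.symm h1, s, Fc_e_self, a _ _ h1]
            abel
          · simp [h1, h2, h4, Ne.symm h4, Fc_e_self]
            congr 1
            ring
        · by_cases h4 : i = l
          · subst h4
            simp [h1, h2, h3, Ne.symm h1, Ne.symm h2, Fc_e_self]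
            rw [a i j h1, a i k (Ne.symm h2), a j k h3, ← neg_smul]
            congr 1
            ring
          · simp [h1, h2, h3, h4]
            intro h
            exfalso
            split_ifs at h <;> omega
  all_goals simp only [tBracketBasis, tSign, par, kd_inl, kd_inr, kd_inl_inr, kd_inr_inl,
    koszul_zero_left, koszul_zero_right, koszul_one_one, h11, Sum.elim_inl, Sum.elim_inr, mul_zero,
    zero_smul, sub_zero, zero_sub, add_zero, zero_add, one_mul, mul_one]
  all_goals first | rw [kd_comm l i] | skip
  all_goals try module
  · by_cases h1 : i = j
    · subst h1
      by_cases h2 : i = l <;> simp [kd, h2, Fc_e_self]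
    · by_cases h2 : i = l
      · subst h2
        simp [kd, h1, Fc_e_symm h1]
      · simp [kd, h1, h2]
  · rw [kd_comm k j]
    by_cases h1 : k = l
    · subst h1
      by_cases h2 : j = k <;> simp [kd, h2, Fc_e_self]
    · rw [if_neg h1, mul_comm]

theorem tFormBasis_eq (A B C D : Idx M N) :
    tFormBasis A B C D = tSign A B * tSign C D * kd B C * kd A D * strSign A := by
  rcases A with i | i <;> rcases B with j | j <;> rcases C with k | k <;> rcases D with l | l
  all_goals simp only [tFormBasis, tSign, kd_inl, kd_inr, kd_inl_inr, kd_inr_inl, strSign,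
    Sum.elim_inl, Sum.elim_inr, mul_zero, zero_mul, one_mul, mul_one, mul_neg]
  all_goals first | rw [kd_comm l i] | skip
  · by_cases h1 : j = k
    · subst h1
      by_cases h2 : i = l
      · subst h2
        simp only [Fc_sub_left, Fc_sub_right, Fc_e_self]
        by_cases h3 : i = j
        · subst h3; simp [Fc_e_self]
        · rw [Fc_e_symm h3]
          ring
      · simp [kd, h2]
    · simp [kd, h1]
  all_goals ring

/-- The linear isomorphism `T_{AB} ↦ tSign A B • E_{AB}`. -/
def tIso (M N : ℕ) : T M N ≃ₗ[ℂ] Gl M N where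
  toFun f := Matrix.of fun A B => tSign A B * f (A, B)
  map_add' f g := by ext A B; simp [mul_add]
  map_smul' c f := by ext A B; simp [mul_left_comm]
  invFun x := Finsupp.equivFunOnFinite.symm fun p => tSign p.1 p.2 * x p.1 p.2
  left_inv f := by ext p; simp [← mul_assoc, tSign_mul_self]
  right_inv x := by ext A B; simp [← mul_assoc, tSign_mul_self]

theorem tIso_apply (f : T M N) (A B : Idx M N) : tIso M N f A B = tSign A B * f (A, B) := rfl

theorem tIso_tb (A B : Idx M N) : tIso M N (tb A B) = tSign A B • Matrix.single A B 1 := by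
  ext C D
  rw [tIso_apply, tb, Finsupp.single_apply, Matrix.smul_apply, Matrix.single_apply]
  by_cases h : A = C ∧ B = D
  · obtain ⟨rfl, rfl⟩ := h; simp
  · rw [if_neg (fun h' => h (Prod.mk.injEq _ _ _ _ ▸ h')), if_neg h]; simp

theorem mem_tGrading {i : ZMod 2} {f : T M N} :
    f ∈ tGrading M N i ↔ ∀ A B, par A + par B ≠ i → f (A, B) = 0 := by
  rw [tGrading, Finsupp.mem_supported']
  simp

theorem tIso_mem {i : ZMod 2} {f : T M N} :
    tIso M N f ∈ glGrading M N i ↔ f ∈ tGrading M N i := by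
  rw [mem_glGrading, mem_tGrading]
  refine forall_congr' fun A => forall_congr' fun B => imp_congr_right fun _ => ?_
  have : tSign A B ≠ 0 := fun h => by simpa [h] using tSign_mul_self A B
  rw [tIso_apply]
  simp [this]

theorem single_mem_glGrading (A B : Idx M N) :
    (Matrix.single A B 1 : Gl M N) ∈ glGrading M N (par A + par B) := by
  rw [mem_glGrading]
  intro C D h
  rw [Matrix.single_apply, if_neg]
  rintro ⟨rfl, rfl⟩
  exact h rfl

theorem single_mul_single_eq (A B C D : Idx M N) :
    (Matrix.single A B 1 : Gl M N) * Matrix.single C D 1 = kd B C • Matrix.single A D 1 := by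
  by_cases h : B = C
  · subst h; simp [kd]
  · simp [kd, h]

theorem tBracket_tb (A B C D : Idx M N) :
    tBracket M N (tb A B) (tb C D) = tBracketBasis A B C D := by
  simp [tBracket, tb]

theorem tForm_tb (A B C D : Idx M N) :
    tForm M N (tb A B) (tb C D) = tFormBasis A B C D := by
  simp [tForm, tb]

/-- Two bilinear maps on `T` agree when they agree on the basis. -/
theorem tBilin_ext {V : Type} [AddCommGroup V] [Module ℂ V] {b b' : T M N →ₗ[ℂ] T M N →ₗ[ℂ] V}
    (h : ∀ A B C D, b (tb A B) (tb C D) = b' (tb A B) (tb C D)) : b = b' := by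
  refine Finsupp.lhom_ext' fun p => LinearMap.ext_ring (Finsupp.lhom_ext' fun q =>
    LinearMap.ext_ring ?_)
  exact h p.1 p.2 q.1 q.2

theorem tIso_bracket (f g : T M N) :
    tIso M N (tBracket M N f g) = glBracket M N (tIso M N f) (tIso M N g) := by
  refine LinearMap.congr_fun₂ (f := (tBracket M N).compr₂ (tIso M N).toLinearMap)
    (g := (glBracket M N).compl₁₂ (tIso M N).toLinearMap (tIso M N).toLinearMap)
    (tBilin_ext fun A B C D => ?_) f g
  simp only [LinearMap.compr₂_apply, LinearMap.compl₁₂_apply, LinearEquiv.coe_coe, tBracket_tb]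
  rw [tBracketBasis_eq, map_sub, map_smul, map_smul, tIso_tb, tIso_tb, tIso_tb, tIso_tb, map_smul,
    map_smul, LinearMap.smul_apply, glBracket_of_mem (single_mem_glGrading A B)
    (single_mem_glGrading C D), single_mul_single_eq, single_mul_single_eq, smul_smul, smul_smul,
    kd_comm D A]
  have h1 := tSign_mul_self A D
  have h2 := tSign_mul_self C B
  match_scalars
  · linear_combination tSign A B * tSign C D * kd B C * h1
  · linear_combination -(koszul (par A + par B) (par C + par D) * tSign A B * tSign C D *
      kd A D) * h2

theorem tIso_form (f g : T M N) : tForm M N f g = glForm M N (tIso M N f) (tIso M N g) := by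
  refine LinearMap.congr_fun₂ (f := tForm M N)
    (g := (glForm M N).compl₁₂ (tIso M N).toLinearMap (tIso M N).toLinearMap)
    (tBilin_ext fun A B C D => ?_) f g
  simp only [LinearMap.compl₁₂_apply, LinearEquiv.coe_coe, tForm_tb]
  rw [tFormBasis_eq, tIso_tb, tIso_tb, map_smul, map_smul, LinearMap.smul_apply, glForm_apply,
    single_mul_single_eq, map_smul, str_eq, Finset.sum_eq_single A]
  · rw [Matrix.single_apply]
    simp only [smul_eq_mul, true_and, kd, eq_comm]
    ring
  · intro C _ hC
    rw [Matrix.single_apply, if_neg (fun h => hC h.1.symm), mul_zero]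
  · simp

/-- The isomorphism of affinizations induced by `tIso`. -/
def affIso (M N : ℕ) : Affine (T M N) ≃ₗ[ℂ] Affine (Gl M N) :=
  LinearEquiv.prodCongr (Finsupp.mapRange.linearEquiv (tIso M N)) (LinearEquiv.refl ℂ ℂ)

theorem affIso_mode (X : T M N) (m : ℤ) :
    affIso M N (Affine.mode X m) = Affine.mode (tIso M N X) m := by
  simp [affIso, Affine.mode]

theorem affIso_K : affIso M N Affine.K = Affine.K := by
  simp [affIso, Affine.K]

theorem affIso_smul_K (c : ℂ) : affIso M N (c • Affine.K) = c • Affine.K := by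
  rw [map_smul, affIso_K]

theorem affIso_isSuperIso :
    IsSuperIso (affGrading (tGrading M N)) (affBracket (tBracket M N) (tForm M N))
      (affGrading (glGrading M N)) (affBracket (glBracket M N) (glForm M N)) (affIso M N) where
  map_grading i := by
    ext y
    obtain ⟨x, rfl⟩ := (affIso M N).surjective y
    refine ((affIso M N).injective.mem_set_image
      (s := (affGrading (tGrading M N) i : Set (Affine (T M N))))).trans ?_
    rw [SetLike.mem_coe, mem_affGrading, mem_affGrading]
    refine and_congr (forall_congr' fun m => ?_) Iff.rfl
    exact tIso_mem.symm
  map_bracket x y := by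
    refine affine_induction (p := fun x => affIso M N (affBracket (tBracket M N) (tForm M N) x y) =
      affBracket (glBracket M N) (glForm M N) (affIso M N x) (affIso M N y))
      (fun x x' h1 h2 => ?_) (fun X m => ?_) (fun c => ?_) x
    · simp only [map_add, LinearMap.add_apply, h1, h2]
    · refine affine_induction (p := fun y =>
        affIso M N (affBracket (tBracket M N) (tForm M N) (Affine.mode X m) y) =
        affBracket (glBracket M N) (glForm M N) (affIso M N (Affine.mode X m)) (affIso M N y))
        (fun y y' h1 h2 => ?_) (fun Y n => ?_) (fun c => ?_) y
      · simp only [map_add, h1, h2]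
      · rw [affBracket_mode, map_add, map_smul, affIso_mode, affIso_mode, affIso_mode,
          affBracket_mode, affIso_K, tIso_bracket, tIso_form]
      · rw [affIso_smul_K, (affBracket_smul_K _ _ c _).2, (affBracket_smul_K _ _ c _).2,
          map_zero]
    · rw [affIso_smul_K, (affBracket_smul_K _ _ c _).1, (affBracket_smul_K _ _ c _).1,
        map_zero]

end TIso

/-! ### The bosonic Fock space -/

section Boson

variable {N : ℕ}

open MvPolynomial in
theorem pderiv_pderiv_comm {σ : Type} (x y : σ) (p : MvPolynomial σ ℂ) :
    pderiv x (pderiv y p) = pderiv y (pderiv x p) := by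
  classical
  have h : ⁅pderiv (R := ℂ) x, pderiv (R := ℂ) y⁆ = 0 := by
    refine derivation_ext fun z => ?_
    rw [Derivation.commutator_apply, pderiv_X, pderiv_X, Pi.single_apply, Pi.single_apply]
    split_ifs <;> simp
  have hp := congrArg (fun D : Derivation ℂ (MvPolynomial σ ℂ) (MvPolynomial σ ℂ) => D p) h
  simpa [Derivation.commutator_apply, sub_eq_zero] using hp

theorem phi_apply_of_nonpos (i : Fin N) {r : ℤ} (h : r ≤ 0) (p : Fock N) :
    phi i r p = MvPolynomial.X (Sum.inl (i, ⟨r, h⟩)) * p := by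
  rw [phi, dif_pos h]; rfl

theorem phi_apply_of_pos (i : Fin N) {r : ℤ} (h : ¬ r ≤ 0) (p : Fock N) :
    phi i r p = -MvPolynomial.pderiv (Sum.inr (i, ⟨1 - r, by omega⟩)) p := by
  rw [phi, dif_neg h]; rfl

theorem phiStar_apply_of_nonpos (i : Fin N) {r : ℤ} (h : r ≤ 0) (p : Fock N) :
    phiStar i r p = MvPolynomial.X (Sum.inr (i, ⟨r, h⟩)) * p := by
  rw [phiStar, dif_pos h]; rfl

theorem phiStar_apply_of_pos (i : Fin N) {r : ℤ} (h : ¬ r ≤ 0) (p : Fock N) :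
    phiStar i r p = MvPolynomial.pderiv (Sum.inl (i, ⟨1 - r, by omega⟩)) p := by
  rw [phiStar, dif_neg h]; rfl

theorem phi_comm (i j : Fin N) (r s : ℤ) : phi i r * phi j s = phi j s * phi i r := by
  refine LinearMap.ext fun p => ?_
  rw [Module.End.mul_apply, Module.End.mul_apply]
  by_cases hr : r ≤ 0 <;> by_cases hs : s ≤ 0
  · simp only [phi_apply_of_nonpos _ hr, phi_apply_of_nonpos _ hs]; ring
  · simp only [phi_apply_of_nonpos _ hr, phi_apply_of_pos _ hs, MvPolynomial.pderiv_mul]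
    rw [MvPolynomial.pderiv_X_of_ne (by simp)]; ring
  · simp only [phi_apply_of_nonpos _ hs, phi_apply_of_pos _ hr, MvPolynomial.pderiv_mul]
    rw [MvPolynomial.pderiv_X_of_ne (by simp)]; ring
  · simp only [phi_apply_of_pos _ hr, phi_apply_of_pos _ hs, map_neg]
    rw [pderiv_pderiv_comm]

theorem phiStar_comm (i j : Fin N) (r s : ℤ) :
    phiStar i r * phiStar j s = phiStar j s * phiStar i r := by
  refine LinearMap.ext fun p => ?_
  rw [Module.End.mul_apply, Module.End.mul_apply]
  by_cases hr : r ≤ 0 <;> by_cases hs : s ≤ 0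
  · simp only [phiStar_apply_of_nonpos _ hr, phiStar_apply_of_nonpos _ hs]; ring
  · simp only [phiStar_apply_of_nonpos _ hr, phiStar_apply_of_pos _ hs, MvPolynomial.pderiv_mul]
    rw [MvPolynomial.pderiv_X_of_ne (by simp)]; ring
  · simp only [phiStar_apply_of_nonpos _ hs, phiStar_apply_of_pos _ hr, MvPolynomial.pderiv_mul]
    rw [MvPolynomial.pderiv_X_of_ne (by simp)]; ring
  · simp only [phiStar_apply_of_pos _ hr, phiStar_apply_of_pos _ hs]
    rw [pderiv_pderiv_comm]

theorem phiStar_mul_phi (i j : Fin N) (r s : ℤ) :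
    phiStar j s * phi i r = phi i r * phiStar j s +
      (if i = j ∧ r + s = 1 then (1 : ℂ) else 0) • (1 : Module.End ℂ (Fock N)) := by
  refine LinearMap.ext fun p => ?_
  rw [LinearMap.add_apply, Module.End.mul_apply, Module.End.mul_apply, LinearMap.smul_apply,
    Module.End.one_apply]
  by_cases hr : r ≤ 0 <;> by_cases hs : s ≤ 0
  · simp only [phi_apply_of_nonpos _ hr, phiStar_apply_of_nonpos _ hs]
    rw [if_neg (by omega), zero_smul]
    ring
  · simp only [phi_apply_of_nonpos _ hr, phiStar_apply_of_pos _ hs, MvPolynomial.pderiv_mul]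
    rw [MvPolynomial.pderiv_X, Pi.single_apply]
    simp only [Sum.inl.injEq, Prod.mk.injEq, Subtype.mk.injEq]
    rw [ite_smul, one_smul, zero_smul, ite_mul, one_mul, zero_mul, add_comm]
    congr 1
    exact if_congr (and_congr Iff.rfl (by omega)) rfl rfl
  · simp only [phiStar_apply_of_nonpos _ hs, phi_apply_of_pos _ hr, MvPolynomial.pderiv_mul]
    rw [MvPolynomial.pderiv_X, Pi.single_apply]
    simp only [Sum.inr.injEq, Prod.mk.injEq, Subtype.mk.injEq]
    have : (if i = j ∧ r + s = 1 then (1 : ℂ) else 0) =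
        if j = i ∧ s = 1 - r then (1 : ℂ) else 0 :=
      if_congr (and_congr eq_comm (by omega)) rfl rfl
    rw [this]
    split_ifs
    · rw [one_smul]; ring
    · rw [zero_smul]; ring
  · simp only [phi_apply_of_pos _ hr, phiStar_apply_of_pos _ hs, map_neg]
    rw [if_neg (by omega), zero_smul, add_zero, pderiv_pderiv_comm]

theorem exists_phi_eq_zero (i : Fin N) (p : Fock N) : ∃ R : ℤ, ∀ r > R, phi i r p = 0 := by
  -- `φ_r` differentiates in the variable of degree `1 - r`, which is not in `p` for large `r`
  obtain ⟨R, hR⟩ := ((p.vars.finite_toSet.image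
    (Sum.elim (fun _ => (0 : ℤ)) fun x => 1 - (x.2 : ℤ))).union (Set.finite_singleton 0)).bddAbove
  refine ⟨R, fun r hr => ?_⟩
  have h0 : (0 : ℤ) ≤ R := hR (Or.inr rfl)
  rw [phi_apply_of_pos i (by omega), MvPolynomial.pderiv_eq_zero_of_notMem_vars, neg_zero]
  intro hx
  have : 1 - (1 - r) ≤ R := hR (Or.inl ⟨_, hx, rfl⟩)
  omega

theorem exists_phiStar_eq_zero (i : Fin N) (p : Fock N) :
    ∃ R : ℤ, ∀ r > R, phiStar i r p = 0 := by
  obtain ⟨R, hR⟩ := ((p.vars.finite_toSet.image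
    (Sum.elim (fun x => 1 - (x.2 : ℤ)) fun _ => (0 : ℤ))).union (Set.finite_singleton 0)).bddAbove
  refine ⟨R, fun r hr => ?_⟩
  have h0 : (0 : ℤ) ≤ R := hR (Or.inr rfl)
  rw [phiStar_apply_of_pos i (by omega), MvPolynomial.pderiv_eq_zero_of_notMem_vars]
  intro hx
  have : 1 - (1 - r) ≤ R := hR (Or.inl ⟨_, hx, rfl⟩)
  omega

/-- The normal orderings that switch at `2 r = m + 1` and at `r = 0` agree: for `m = 0` the
conditions are the same, and for `m ≠ 0` the two factors commute. -/
theorem phiNormal_eq (i j : Fin N) (m r : ℤ) :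
    phiNormal i j r (m - r + 1) = if r ≤ 0 then phi i r * phiStar j (m - r + 1)
      else phiStar j (m - r + 1) * phi i r := by
  rw [phiNormal]
  by_cases hm : m = 0
  · exact if_congr (by omega) rfl rfl
  · have := phiStar_mul_phi i j r (m - r + 1)
    rw [if_neg (by omega), zero_smul, add_zero] at this
    rw [this, ite_self, ite_self]

end Boson

/-! ### The free fields on `V[Γ] ⊗ 𝔉` -/

section Fields

variable {M N : ℕ}

/-- The fields `X(e_i)` (fermions) and `φ^j` (bosons). The index of the mode with subscript
`r - 1/2` is `r`. -/
def fieldA : Idx M N → ℤ → Module.End ℂ (VF M N)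
  | Sum.inl i, r => LinearMap.rTensor (Fock N) (Xodd (e i) r)
  | Sum.inr j, r => LinearMap.lTensor (VG M) (phi j r)

/-- The dual fields `X(-e_i)` and `φ^{j*}`. -/
def fieldB : Idx M N → ℤ → Module.End ℂ (VF M N)
  | Sum.inl i, r => LinearMap.rTensor (Fock N) (Xodd (-e i) r)
  | Sum.inr j, r => LinearMap.lTensor (VG M) (phiStar j r)

/-- Two fermions anticommute, all other pairs commute. -/
def fieldSign : Idx M N → Idx M N → ℂ
  | Sum.inl _, Sum.inl _ => -1
  | _, _ => 1

theorem lTensor_mul_rTensor_comm (f : Module.End ℂ (VG M)) (g : Module.End ℂ (Fock N)) :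
    (LinearMap.lTensor (VG M) g * LinearMap.rTensor (Fock N) f : Module.End ℂ (VF M N)) =
      LinearMap.rTensor (Fock N) f * LinearMap.lTensor (VG M) g :=
  TensorProduct.ext' fun _ _ => rfl

theorem rTensor_mul_lTensor (f : Module.End ℂ (VG M)) (g : Module.End ℂ (Fock N)) :
    (LinearMap.rTensor (Fock N) f * LinearMap.lTensor (VG M) g : Module.End ℂ (VF M N)) =
      TensorProduct.map f g :=
  TensorProduct.ext' fun _ _ => rfl

theorem rTensor_anticomm {f g : Module.End ℂ (VG M)} (h : f * g = -(g * f)) :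
    (LinearMap.rTensor (Fock N) f * LinearMap.rTensor (Fock N) g : Module.End ℂ (VF M N)) =
      (-1 : ℂ) • (LinearMap.rTensor (Fock N) g * LinearMap.rTensor (Fock N) f) := by
  have h' : f * g = (-1 : ℂ) • (g * f) := h.trans (LinearMap.ext fun v => (neg_one_smul ℂ _).symm)
  rw [← LinearMap.rTensor_mul, ← LinearMap.rTensor_mul, h', LinearMap.rTensor_smul]

theorem Xodd_e_anticomm (i j : Fin M) (r s : ℤ) :
    Xodd (e i) r * Xodd (e j) s = -(Xodd (e j) s * Xodd (e i) r) := by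
  by_cases h : i = j
  · subst h
    exact Xodd_anticomm_self (by simp [ip_e_e]) r s
  · exact Xodd_anticomm_of_ip_eq_zero (by simp [ip_e_e, h]) (Fc_e_symm h) r s

theorem Xodd_neg_e_anticomm (i j : Fin M) (r s : ℤ) :
    Xodd (-e i) r * Xodd (-e j) s = -(Xodd (-e j) s * Xodd (-e i) r) := by
  by_cases h : i = j
  · subst h
    exact Xodd_anticomm_self (by simp [ip_neg_left, ip_neg_right, ip_e_e]) r s
  · exact Xodd_anticomm_of_ip_eq_zero (by simp [ip_neg_left, ip_neg_right, ip_e_e, h])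
      (by simp [Fc_neg_left, Fc_neg_right, Fc_e_symm h]) r s

theorem Xodd_neg_e_mul (i j : Fin M) (r s : ℤ) :
    Xodd (-e j) s * Xodd (e i) r = (-1 : ℂ) • (Xodd (e i) r * Xodd (-e j) s) +
      (if i = j ∧ r + s = 1 then (1 : ℂ) else 0) • (1 : Module.End ℂ (VG M)) := by
  by_cases h : i = j
  · subst h
    have := Xodd_anticomm_neg (α := e i) (by simp [ip_e_e]) (Fc_e_self i) r s
    have e1 : (if i = i ∧ r + s = 1 then (1 : ℂ) else 0) • (1 : Module.End ℂ (VG M)) =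
        if r + s = 1 then 1 else 0 := by
      by_cases h : r + s = 1 <;> simp [h]
    rw [e1, ← this]
    refine LinearMap.ext fun v => ?_
    simp only [LinearMap.add_apply, LinearMap.smul_apply]
    module
  · rw [Xodd_anticomm_of_ip_eq_zero (α := -e j) (β := e i) (by simp [ip_neg_left, ip_e_e, Ne.symm h])
      (by simp [Fc_neg_left, Fc_neg_right, Fc_e_symm (Ne.symm h)]) s r, if_neg (fun h' => h h'.1)]
    refine LinearMap.ext fun v => ?_
    simp

theorem exists_rTensor_eq_zero {f : ℤ → Module.End ℂ (VG M)}
    (h : ∀ v, ∃ R : ℤ, ∀ r > R, f r v = 0) (w : VF M N) :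
    ∃ R : ℤ, ∀ r > R, LinearMap.rTensor (Fock N) (f r) w = 0 := by
  induction w using TensorProduct.induction_on with
  | zero => exact ⟨0, fun r _ => map_zero _⟩
  | tmul v p =>
    obtain ⟨R, hR⟩ := h v
    exact ⟨R, fun r hr => by rw [LinearMap.rTensor_tmul, hR r hr, TensorProduct.zero_tmul]⟩
  | add v w hv hw =>
    obtain ⟨R, hR⟩ := hv
    obtain ⟨R', hR'⟩ := hw
    exact ⟨max R R', fun r hr => by
      rw [map_add, hR r ((le_max_left _ _).trans_lt hr), hR' r ((le_max_right _ _).trans_lt hr),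
        add_zero]⟩

theorem exists_lTensor_eq_zero {f : ℤ → Module.End ℂ (Fock N)}
    (h : ∀ v, ∃ R : ℤ, ∀ r > R, f r v = 0) (w : VF M N) :
    ∃ R : ℤ, ∀ r > R, LinearMap.lTensor (VG M) (f r) w = 0 := by
  induction w using TensorProduct.induction_on with
  | zero => exact ⟨0, fun r _ => map_zero _⟩
  | tmul v p =>
    obtain ⟨R, hR⟩ := h p
    exact ⟨R, fun r hr => by rw [LinearMap.lTensor_tmul, hR r hr, TensorProduct.tmul_zero]⟩
  | add v w hv hw =>
    obtain ⟨R, hR⟩ := hv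
    obtain ⟨R', hR'⟩ := hw
    exact ⟨max R R', fun r hr => by
      rw [map_add, hR r ((le_max_left _ _).trans_lt hr), hR' r ((le_max_right _ _).trans_lt hr),
        add_zero]⟩

/-- On `V[Γ] ⊗ 𝔉`, the operators `X(e_i)`, `X(-e_i)` are free fermions, and `φ^j`, `φ^{j*}` are free
bosons. -/
theorem isFreeFieldSystem :
    IsFreeFieldSystem (W := VF M N) fieldSign fieldA fieldB where
  symm A B := by rcases A with i | i <;> rcases B with j | j <;> rfl
  sq A B := by rcases A with i | i <;> rcases B with j | j <;> simp [fieldSign]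
  aa A C r s := by
    rcases A with i | i <;> rcases C with j | j <;> simp only [fieldA, fieldSign]
    · exact rTensor_anticomm (Xodd_e_anticomm i j r s)
    · rw [one_smul, lTensor_mul_rTensor_comm]
    · rw [one_smul, lTensor_mul_rTensor_comm]
    · rw [one_smul, ← LinearMap.lTensor_mul, ← LinearMap.lTensor_mul, phi_comm]
  bb A C r s := by
    rcases A with i | i <;> rcases C with j | j <;> simp only [fieldB, fieldSign]
    · exact rTensor_anticomm (Xodd_neg_e_anticomm i j r s)
    · rw [one_smul, lTensor_mul_rTensor_comm]
    · rw [one_smul, lTensor_mul_rTensor_comm]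
    · rw [one_smul, ← LinearMap.lTensor_mul, ← LinearMap.lTensor_mul, phiStar_comm]
  ba A B r s := by
    rcases A with i | i <;> rcases B with j | j <;> simp only [fieldA, fieldB, fieldSign]
    · rw [← LinearMap.rTensor_mul, ← LinearMap.rTensor_mul, Xodd_neg_e_mul, LinearMap.rTensor_add,
        LinearMap.rTensor_smul, LinearMap.rTensor_smul]
      simp only [Sum.inl.injEq]
      congr 2
      exact LinearMap.rTensor_id _ _
    · rw [lTensor_mul_rTensor_comm]
      simp
    · rw [lTensor_mul_rTensor_comm]
      simp
    · rw [← LinearMap.lTensor_mul, ← LinearMap.lTensor_mul, phiStar_mul_phi, LinearMap.lTensor_add,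
        LinearMap.lTensor_smul, one_smul]
      simp only [Sum.inr.injEq]
      congr 2
      exact LinearMap.lTensor_id _ _
  a_zero A w := by
    rcases A with i | i
    · exact exists_rTensor_eq_zero (exists_Xodd_eq_zero (e i)) w
    · exact exists_lTensor_eq_zero (exists_phi_eq_zero i) w
  b_zero A w := by
    rcases A with i | i
    · exact exists_rTensor_eq_zero (exists_Xodd_eq_zero (-e i)) w
    · exact exists_lTensor_eq_zero (exists_phiStar_eq_zero i) w

theorem finSum_rTensor {κ : Type} {f : κ → Module.End ℂ (VG M)} {T : Module.End ℂ (VG M)}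
    (h : ∀ v, FinSum (fun k => f k v) (T v)) (w : VF M N) :
    FinSum (fun k => LinearMap.rTensor (Fock N) (f k) w) (LinearMap.rTensor (Fock N) T w) := by
  induction w using TensorProduct.induction_on with
  | zero => simpa using finSum_zero
  | tmul v p =>
    simp only [LinearMap.rTensor_tmul]
    exact (h v).map (W := VF M N) ((TensorProduct.mk ℂ (VG M) (Fock N)).flip p)
  | add v w hv hw =>
    simp only [map_add]
    exact hv.add hw

/-- The terms of the current for `(A, B)`. -/
abbrev currentTerm (A B : Idx M N) (m r : ℤ) : Module.End ℂ (VF M N) :=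
  orderedProd (W := VF M N) fieldSign fieldA fieldB A B r r (m - r + 1)

/-- The current for `(A, B)` on `V[Γ] ⊗ 𝔉`. -/
abbrev fieldCurrent (A B : Idx M N) (m : ℤ) : Module.End ℂ (VF M N) :=
  current (W := VF M N) fieldSign fieldA fieldB A B m

theorem upperTerm_eq (i : Fin M) (j : Fin N) (m r : ℤ) :
    upperTerm i j m r = currentTerm (Sum.inl i) (Sum.inr j) m r := by
  simp only [orderedProd, fieldA, fieldB, fieldSign, one_smul, lTensor_mul_rTensor_comm, ite_self,
    rTensor_mul_lTensor]
  rfl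

/-- In `lowerTerm` the summation index is that of the fermion, so it is reversed here. -/
theorem lowerTerm_eq (j : Fin N) (i : Fin M) (m r : ℤ) :
    lowerTerm j i m r = currentTerm (Sum.inr j) (Sum.inl i) m (m - r + 1) := by
  simp only [orderedProd, fieldA, fieldB, fieldSign, one_smul, lTensor_mul_rTensor_comm, ite_self,
    rTensor_mul_lTensor]
  rw [show m - (m - r + 1) + 1 = r by ring]
  rfl

theorem bosonTerm_eq (i j : Fin N) (m r : ℤ) :
    bosonTerm (M := M) i j m r = currentTerm (Sum.inr i) (Sum.inr j) m r := by
  simp only [orderedProd, fieldA, fieldB, fieldSign, one_smul]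
  rw [← LinearMap.lTensor_mul, ← LinearMap.lTensor_mul, bosonTerm, phiNormal_eq]
  split_ifs <;> rfl

theorem upperTerm_locFinite (i : Fin M) (j : Fin N) (m : ℤ) : LocFinite (upperTerm i j m) := by
  rw [show upperTerm i j m = _ from funext (upperTerm_eq i j m)]
  exact isFreeFieldSystem.locFinite _ _ m

theorem finSum_lowerTerm (j : Fin N) (i : Fin M) (m : ℤ) (w : VF M N) :
    FinSum (fun r => lowerTerm j i m r w)
      (fieldCurrent (Sum.inr j) (Sum.inl i) m w) :=
  ((isFreeFieldSystem.finSum_current (Sum.inr j) (Sum.inl i) m w).equiv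
    (Equiv.subLeft (m + 1))).congr (fun r => by
      rw [lowerTerm_eq, Equiv.subLeft_apply, show m + 1 - r = m - r + 1 by ring]) rfl

theorem lowerTerm_locFinite (j : Fin N) (i : Fin M) (m : ℤ) : LocFinite (lowerTerm j i m) :=
  locFinite_of_finSum (V := VF M N) (W := VF M N) (finSum_lowerTerm j i m)

theorem bosonTerm_locFinite (i j : Fin N) (m : ℤ) : LocFinite (bosonTerm (M := M) i j m) := by
  rw [show bosonTerm (M := M) i j m = _ from funext (bosonTerm_eq i j m)]
  exact isFreeFieldSystem.locFinite _ _ m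

/-- The operators of the representation are, up to sign, the currents of the free fields. -/
theorem modeOp_eq (m : ℤ) (A B : Idx M N) :
    modeOp m A B = tSign A B • fieldCurrent A B m := by
  rcases A with i | i <;> rcases B with j | j <;> simp only [modeOp, tSign, one_smul]
  · by_cases h : i = j
    · subst h
      rw [if_pos rfl, Fc_e_self, one_smul]
      refine (locSum_eq fun w => (finSum_rTensor (finSum_XXnormal (α := e i) (by simp [ip_e_e])
        (Fc_e_self i) m) w).congr (fun r => ?_) rfl).symm
      rw [orderedProd]
      split_ifs
      · rw [LinearMap.rTensor_mul]; rfl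
      · rw [LinearMap.rTensor_neg, LinearMap.rTensor_mul]
        simp only [fieldA, fieldB, fieldSign]
        exact (neg_one_smul ℂ (M := VF M N) _).symm
    -- the two fermions anticommute here, so the normal ordering has no effect
    · rw [if_neg h]
      have hij : ip (e i) (-e j) = 0 := by simp [ip_neg_right, ip_e_e, h]
      have hn : ip (e i + -e j) (e i + -e j) / 2 = 1 := by
        simp [ip_neg_right, ip_neg_left, ip_add_left, ip_add_right, ip_e_e, h, Ne.symm h]
      refine LinearMap.ext fun w => ((finSum_rTensor (f := fun r => Fc (e i) (-e j) •
        (Xodd (e i) r * Xodd (-e j) (m - r + 1)))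
        (finSum_Xodd_mul hij hn m) w).congr (fun r => ?_) (by rw [← sub_eq_add_neg])).unique
        ((isFreeFieldSystem.finSum_current (Sum.inl i) (Sum.inl j) m w).smul _)
      have hc : Xodd (-e j) (m - r + 1) * Xodd (e i) r =
          (-1 : ℂ) • (Xodd (e i) r * Xodd (-e j) (m - r + 1)) := by
        rw [Xodd_neg_e_mul, if_neg (fun h' => h h'.1), zero_smul, add_zero]
      simp only [orderedProd, fieldA, fieldB, fieldSign]
      rw [← LinearMap.rTensor_mul, ← LinearMap.rTensor_mul, hc, LinearMap.rTensor_smul,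
        LinearMap.rTensor_smul, smul_smul, Fc_neg_right]
      simp
  · rw [show upperTerm i j m = _ from funext (upperTerm_eq i j m)]
    rfl
  · exact locSum_eq (V := VF M N) (W := VF M N) (finSum_lowerTerm i j m)
  · rw [show bosonTerm (M := M) i j m = _ from funext (bosonTerm_eq i j m)]
    rfl

end Fields

/-! ### The grading of `V[Γ] ⊗ 𝔉` -/

section Grading

variable {M N : ℕ}

/-- The projection of `V[Γ]` to its component of parity `i`. -/
def vProj (i : ZMod 2) : Module.End ℂ (VG M) :=
  Finsupp.lsum ℂ fun γ : Lat M => if latPar γ = i then Finsupp.lsingle γ else 0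

theorem vProj_single (i : ZMod 2) (γ : Lat M) (u : SymH M) :
    vProj i (Finsupp.single γ u) = if latPar γ = i then Finsupp.single γ u else 0 := by
  rw [vProj, Finsupp.lsum_single]
  split_ifs <;> rfl

theorem vProj_isParityProjection : IsParityProjection (vGrading M) vProj where
  add x := by
    refine LinearMap.congr_fun (f := vProj 0 + vProj 1) (g := LinearMap.id)
      (Finsupp.lhom_ext fun γ u => ?_) x
    rw [LinearMap.add_apply, vProj_single, vProj_single]
    rcases zmod_two_cases (latPar γ) with h | h <;> simp [h]
  mem i x := by
    induction x using Finsupp.induction_linear with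
    | zero => rw [map_zero]; exact zero_mem _
    | add x y hx hy => rw [map_add]; exact add_mem hx hy
    | single γ u =>
      rw [vProj_single]
      split_ifs with h
      · exact single_mem_vGrading h u
      · exact zero_mem _
  self i x hx := by
    conv_rhs => rw [← Finsupp.sum_single x]
    conv_lhs => rw [← Finsupp.sum_single x]
    rw [Finsupp.sum, map_sum]
    refine Finset.sum_congr rfl fun γ hγ => ?_
    rw [vProj_single, if_pos (show latPar γ = i from hx hγ)]

theorem tmul_mem_vfGrading {i : ZMod 2} {v : VG M} (h : v ∈ vGrading M i) (p : Fock N) :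
    v ⊗ₜ[ℂ] p ∈ vfGrading M N i := Submodule.subset_span ⟨v, h, p, rfl⟩

theorem rTensor_vProj_add (x : VF M N) : LinearMap.rTensor (Fock N) (vProj 0) x +
    LinearMap.rTensor (Fock N) (vProj 1) x = x := by
  have h : vProj 0 + vProj 1 = (LinearMap.id : VG M →ₗ[ℂ] VG M) :=
    LinearMap.ext vProj_isParityProjection.add
  rw [← LinearMap.add_apply, ← LinearMap.rTensor_add, h, LinearMap.rTensor_id, LinearMap.id_apply]

theorem rTensor_vProj_mem (i : ZMod 2) (x : VF M N) :
    LinearMap.rTensor (Fock N) (vProj i) x ∈ vfGrading M N i := by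
  induction x using TensorProduct.induction_on with
  | zero => rw [map_zero]; exact zero_mem _
  | tmul v p =>
    rw [LinearMap.rTensor_tmul]
    exact tmul_mem_vfGrading (vProj_isParityProjection.mem i v) p
  | add x y hx hy => rw [map_add]; exact add_mem hx hy

theorem rTensor_vProj_self (i : ZMod 2) (x : VF M N) (hx : x ∈ vfGrading M N i) :
    LinearMap.rTensor (Fock N) (vProj i) x = x := by
  induction hx using Submodule.span_induction with
  | mem x hx =>
    obtain ⟨v, hv, p, rfl⟩ := hx
    rw [LinearMap.rTensor_tmul, vProj_isParityProjection.self i v hv]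
  | zero => exact map_zero _
  | add x y _ _ hx hy => rw [map_add, hx, hy]
  | smul c x _ hx => rw [map_smul, hx]

theorem vfGrading_isInternal : DirectSum.IsInternal (vfGrading M N) :=
  IsParityProjection.isInternal (V := VF M N) (π := fun i => LinearMap.rTensor (Fock N) (vProj i))
    ⟨rTensor_vProj_add, rTensor_vProj_mem, rTensor_vProj_self⟩

/-- The operator `f` is homogeneous of parity `d`. -/
def HasParity (d : ZMod 2) (f : Module.End ℂ (VF M N)) : Prop :=
  ∀ j, ∀ w ∈ vfGrading M N j, f w ∈ vfGrading M N (d + j)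

theorem HasParity.mul {d d' : ZMod 2} {f g : Module.End ℂ (VF M N)} (hf : HasParity d f)
    (hg : HasParity d' g) : HasParity (d + d') (f * g) := fun j w hw => by
  rw [add_assoc]
  exact hf _ _ (hg _ _ hw)

theorem HasParity.smul {d : ZMod 2} {f : Module.End ℂ (VF M N)} (hf : HasParity d f) (c : ℂ) :
    HasParity d (c • f) := fun j w hw => Submodule.smul_mem _ _ (hf j w hw)

theorem hasParity_Xodd {α : Lat M} (h : latPar α = 1) (r : ℤ) :
    HasParity 1 (LinearMap.rTensor (Fock N) (Xodd α r)) := fun j w hw => by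
  refine Submodule.span_induction (p := fun w _ => LinearMap.rTensor (Fock N) (Xodd α r) w ∈
    vfGrading M N (1 + j)) ?_ (by rw [map_zero]; exact zero_mem _)
    (fun x y _ _ hx hy => by rw [map_add]; exact add_mem hx hy)
    (fun c x _ hx => by rw [map_smul]; exact Submodule.smul_mem _ _ hx) hw
  rintro _ ⟨v, hv, p, rfl⟩
  rw [LinearMap.rTensor_tmul, ← h]
  exact tmul_mem_vfGrading (vertexCoeff_mem α _ hv) p

theorem hasParity_lTensor (f : Module.End ℂ (Fock N)) :
    HasParity 0 (LinearMap.lTensor (VG M) f) := fun j w hw => by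
  refine Submodule.span_induction (p := fun w _ => LinearMap.lTensor (VG M) f w ∈
    vfGrading M N (0 + j)) ?_ (by rw [map_zero]; exact zero_mem _)
    (fun x y _ _ hx hy => by rw [map_add]; exact add_mem hx hy)
    (fun c x _ hx => by rw [map_smul]; exact Submodule.smul_mem _ _ hx) hw
  rintro _ ⟨v, hv, p, rfl⟩
  rw [LinearMap.lTensor_tmul, zero_add]
  exact tmul_mem_vfGrading hv _

theorem latPar_e (i : Fin M) : latPar (e i) = 1 := by simp [latPar, ip_e_e]

theorem latPar_neg_e (i : Fin M) : latPar (-e i) = 1 := by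
  simp [latPar, ip_neg_left, ip_neg_right, ip_e_e]

/-- The fields of the even indices are odd, and those of the odd indices are even. -/
theorem hasParity_fieldA (A : Idx M N) (r : ℤ) : HasParity (1 + par A) (fieldA A r) := by
  rcases A with i | i
  · exact hasParity_Xodd (latPar_e i) r
  · exact hasParity_lTensor _

theorem hasParity_fieldB (A : Idx M N) (r : ℤ) : HasParity (1 + par A) (fieldB A r) := by
  rcases A with i | i
  · exact hasParity_Xodd (latPar_neg_e i) r
  · exact hasParity_lTensor _

theorem hasParity_current (A B : Idx M N) (m : ℤ) :
    HasParity (par A + par B) (fieldCurrent A B m) := fun j w hw => by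
  have h2 : (1 + par A) + (1 + par B) = par A + par B := by
    linear_combination CharTwo.two_eq_zero (R := ZMod 2)
  refine (isFreeFieldSystem.finSum_current A B m w).mem fun r => ?_
  rw [orderedProd]
  split_ifs
  · have := (hasParity_fieldA A r).mul (hasParity_fieldB B (m - r + 1))
    rw [h2] at this
    exact this j w hw
  · have := (hasParity_fieldB B (m - r + 1)).mul (hasParity_fieldA A r)
    rw [add_comm, h2] at this
    exact this.smul _ j w hw

end Grading

/-! ### The representation -/

section Representation

variable {M N : ℕ}

/-- The even, respectively odd, part of the affinization of `T` is spanned by the modes of the basis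
vectors of this parity and, in the even case, by the central element. -/
theorem affGrading_tGrading_le {i : ZMod 2} {S : Submodule ℂ (Affine (T M N))}
    (hS : ∀ A B, par A + par B = i → ∀ m, Affine.mode (tb A B) m ∈ S)
    (hK : i = 0 → Affine.K ∈ S) : affGrading (tGrading M N) i ≤ S := by
  intro x hx
  refine affGrading_induction (p := (· ∈ S)) (fun x y hx hy => add_mem hx hy) (fun X hX m => ?_)
    (fun c hc => ?_) hx
  · rw [tGrading, Finsupp.supported_eq_span_single] at hX
    induction hX using Submodule.span_induction with
    | mem X hX =>
      obtain ⟨⟨A, B⟩, h, rfl⟩ := hX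
      exact hS A B h m
    | zero =>
      rw [← zero_smul ℂ (0 : T M N), mode_smul, zero_smul]
      exact zero_mem _
    | add X Y _ _ hX hY => rw [mode_add]; exact add_mem hX hY
    | smul c X _ hX => rw [mode_smul]; exact S.smul_mem c hX
  · by_cases hi : i = 0
    · exact S.smul_mem c (hK hi)
    · rw [hc hi, zero_smul]
      exact zero_mem _

theorem rho_mode_tb (A B : Idx M N) (m : ℤ) :
    rho M N (Affine.mode (tb A B) m) = tSign A B • fieldCurrent A B m := by
  rw [rho_mode, modeOp_eq]

/-- The sign of two fields is the Koszul sign of their parities, which are opposite to those of the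
indices. -/
theorem fieldSign_eq (A B : Idx M N) : fieldSign A B = koszul (1 + par A) (1 + par B) := by
  have h11 : (1 + 1 : ZMod 2) = 0 := rfl
  rcases A with i | i <;> rcases B with j | j <;>
    simp [fieldSign, par, h11, koszul_zero_left, koszul_zero_right, koszul_one_one]

theorem fieldSign_self (A : Idx M N) : fieldSign A A = -strSign A := by
  rcases A with i | i <;> simp [fieldSign, strSign]

theorem fieldSign_mul (A B C D : Idx M N) :
    fieldSign A C * fieldSign B C * (fieldSign A D * fieldSign B D) =
      koszul (par A + par B) (par C + par D) := by
  have h2 : ∀ A B : Idx M N, par A + par B = (1 + par A) + (1 + par B) := fun A B => by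
    linear_combination -CharTwo.two_eq_zero (R := ZMod 2)
  rw [h2 A B, h2 C D, koszul_add_left (1 + par A), koszul_add_right _ (1 + par C),
    koszul_add_right _ (1 + par C)]
  simp only [fieldSign_eq]
  generalize koszul (1 + par A) (1 + par C) = a
  generalize koszul (1 + par A) (1 + par D) = b
  ring

theorem smul_mul_smul_sub {A : Type} [Ring A] [Algebra ℂ A] {a b x y c : A} {s s' k : ℂ}
    {p q r : ℂ} (h : a * b = k • (b * a) + (p • x - q • y - r • c)) :
    (s • a) * (s' • b) - k • ((s' • b) * (s • a)) =
      (s * s' * p) • x - (s * s' * q) • y - (s * s' * r) • c := by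
  rw [smul_mul_smul_comm, smul_mul_smul_comm, h]
  module

section Abstract

variable {W : Type} [AddCommGroup W] [Module ℂ W] {ρ : Affine (T M N) →ₗ[ℂ] Module.End ℂ W}
  {a b : Idx M N → ℤ → Module.End ℂ W}

/-- Wick's theorem, compared with the brackets of the modes of basis vectors. -/
theorem IsFreeFieldSystem.map_affBracket_mode (h : IsFreeFieldSystem fieldSign a b)
    (hK : ρ Affine.K = 1)
    (hρ : ∀ A B m, ρ (Affine.mode (tb A B) m) = tSign A B • current fieldSign a b A B m)
    (A B C D : Idx M N) (m n : ℤ) :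
    ρ (affBracket (tBracket M N) (tForm M N) (Affine.mode (tb A B) m) (Affine.mode (tb C D) n)) =
      ρ (Affine.mode (tb A B) m) * ρ (Affine.mode (tb C D) n) -
        koszul (par A + par B) (par C + par D) •
          (ρ (Affine.mode (tb C D) n) * ρ (Affine.mode (tb A B) m)) := by
  have hc := h.current_mul_current A B C D m n
  rw [fieldSign_mul, fieldSign_self] at hc
  rw [hρ, hρ, smul_mul_smul_sub hc, affBracket_mode, tBracket_tb, tForm_tb, tBracketBasis_eq,
    tFormBasis_eq, sub_eq_add_neg (_ • tb A D), mode_add, ← neg_smul, mode_smul, mode_smul, map_add,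
    map_add, map_smul, map_smul, map_smul, hρ, hρ, hK, smul_smul, smul_smul, sub_eq_add_neg,
    sub_eq_add_neg, ← neg_smul, ← neg_smul]
  congr 1
  · congr 2
    · rw [kd]
      linear_combination (tSign A B * tSign C D * (if B = C then 1 else 0)) * tSign_mul_self A D
    · rw [kd]
      linear_combination -(koszul (par A + par B) (par C + par D) * tSign A B * tSign C D *
        (if A = D then 1 else 0)) * tSign_mul_self C B
  · rw [kd, kd]
    congr 1
    ring

/-- The quadratic expressions in free fields whose signs are those of `X(± e_i)` and `φ`, `φ*`
satisfy the relations of `T̂`, with `K = 1`. -/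
theorem IsFreeFieldSystem.map_affBracket (h : IsFreeFieldSystem fieldSign a b)
    (hK : ρ Affine.K = 1)
    (hρ : ∀ A B m, ρ (Affine.mode (tb A B) m) = tSign A B • current fieldSign a b A B m)
    {i j : ZMod 2} {x y : Affine (T M N)}
    (hx : x ∈ affGrading (tGrading M N) i) (hy : y ∈ affGrading (tGrading M N) j) :
    ρ (affBracket (tBracket M N) (tForm M N) x y) = ρ x * ρ y - koszul i j • (ρ y * ρ x) := by
  -- the difference of the two sides, as a bilinear map
  let D : Affine (T M N) →ₗ[ℂ] Affine (T M N) →ₗ[ℂ] Module.End ℂ W :=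
    (affBracket (tBracket M N) (tForm M N)).compr₂ ρ -
      ((LinearMap.mul ℂ (Module.End ℂ W)).compl₁₂ ρ ρ -
        koszul i j • (LinearMap.mul ℂ (Module.End ℂ W)).flip.compl₁₂ ρ ρ)
  have hD : ∀ x y, D x y = ρ (affBracket (tBracket M N) (tForm M N) x y) -
      (ρ x * ρ y - koszul i j • (ρ y * ρ x)) := fun _ _ => rfl
  suffices h : D x y = 0 from sub_eq_zero.1 h
  have hKl : i = 0 → ∀ y, D Affine.K y = 0 := by
    rintro rfl y
    rw [hD, (affBracket_K _ _ y).1, map_zero, hK, one_mul, mul_one, koszul_zero_left, one_smul,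
      sub_self, sub_self]
  have hKr : j = 0 → ∀ x, D x Affine.K = 0 := by
    rintro rfl x
    rw [hD, (affBracket_K _ _ x).2, map_zero, hK, one_mul, mul_one, koszul_zero_right, one_smul,
      sub_self, sub_self]
  refine affGrading_tGrading_le (S := LinearMap.ker (D.flip y)) (fun A B hAB m => ?_)
    (fun hi => hKl hi y) hx
  refine affGrading_tGrading_le (S := LinearMap.ker (D (Affine.mode (tb A B) m)))
    (fun A' B' hAB' n => ?_) (fun hj => hKr hj _) hy
  subst hAB hAB'
  exact sub_eq_zero.2 (h.map_affBracket_mode hK hρ A B A' B' m n)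

end Abstract

/-- The operators of the representation are homogeneous of the expected parity. -/
theorem rho_mem {i j : ZMod 2} {x : Affine (T M N)} (hx : x ∈ affGrading (tGrading M N) i)
    {w : VF M N} (hw : w ∈ vfGrading M N j) : rho M N x w ∈ vfGrading M N (i + j) := by
  refine affGrading_tGrading_le
    (S := (vfGrading M N (i + j)).comap ((rho M N).flip w)) (fun A B hAB m => ?_) (fun hi => ?_) hx
  · rw [Submodule.mem_comap, LinearMap.flip_apply, rho_mode_tb, ← hAB]
    exact (hasParity_current A B m).smul _ j w hw
  · rw [Submodule.mem_comap, LinearMap.flip_apply, rho_K, hi, zero_add]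
    exact hw

theorem finSum_XXnormal_e (i : Fin M) (m : ℤ) (v : VG M) :
    FinSum (fun r : ℤ => XXnormal (e i) (-e i) r (m - r + 1) v) (heis (e i) m v) := by
  have h : ip (e i) (e i) = 1 := by simp [ip_e_e]
  exact (finSum_XXnormal h (Fc_e_self i) m v).congr
    (fun r => by rw [XXnormal_eq h (Fc_e_self i)]) rfl

end Representation

end AffineGlSuper

end

theorem proposition3p3 (M N : ℕ) :
    -- `T̂` is a Lie superalgebra
    IsLieSuperalgebra (affGrading (tGrading M N)) (affBracket (tBracket M N) (tForm M N)) ∧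
    -- it is isomorphic to the affinization of `gl(M|N)`
    (∃ Φ : Affine (T M N) ≃ₗ[ℂ] Affine (Gl M N),
      IsSuperIso (affGrading (tGrading M N)) (affBracket (tBracket M N) (tForm M N))
        (affGrading (glGrading M N)) (affBracket (glBracket M N) (glForm M N)) Φ ∧
      Φ Affine.K = Affine.K) ∧
    -- all the operator sums involved are locally finite
    (∀ (α : Lat M) (p : ℤ), LocFinite (vertexTerm α p)) ∧
    (∀ (i : Fin M) (j : Fin N) (m : ℤ), LocFinite (upperTerm i j m)) ∧
    (∀ (j : Fin N) (i : Fin M) (m : ℤ), LocFinite (lowerTerm j i m)) ∧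
    (∀ (i j : Fin N) (m : ℤ), LocFinite (bosonTerm (M := M) i j m)) ∧
    -- `e_i(z) = :X(e_i, z) X(-e_i, z):`
    (∀ (i : Fin M) (m : ℤ),
      LocFinite (fun r : ℤ => XXnormal (e i) (-e i) r (m - r + 1)) ∧
      heis (e i) m = locSum (fun r : ℤ => XXnormal (e i) (-e i) r (m - r + 1))) ∧
    -- the map is a representation
    IsSuperRepresentation (W := VF M N) (affGrading (tGrading M N)) (affBracket (tBracket M N) (tForm M N))
      (vfGrading M N) (rho M N) := by
  refine ⟨affIso_isSuperIso.isLieSuperalgebra affineGl_isLieSuperalgebra,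
    ⟨affIso M N, affIso_isSuperIso, affIso_K⟩, vertexTerm_locFinite, upperTerm_locFinite,
    lowerTerm_locFinite, bosonTerm_locFinite,
    fun i m => ⟨locFinite_of_finSum (finSum_XXnormal_e i m),
      (locSum_eq (finSum_XXnormal_e i m)).symm⟩, ?_⟩
  exact ⟨vfGrading_isInternal, fun _ _ _ hx _ hw => rho_mem hx hw,
    fun _ _ _ hx _ hy => isFreeFieldSystem.map_affBracket (rho_K M N) rho_mode_tb hx hy⟩
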